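/- Let $\rho=\frac{1+i\sqrt3}{2}$, and let $\mathbb{Z}[\rho]=\mathbb{Z}+\mathbb{Z}\rho\subset\mathbb{C}=\mathbb{R}^2$ be the hexagonal lattice. A lattice in the plane is well-rounded if its non-zero vectors of minimal length span $\mathbb{R}^2$. For $n\ge 1$ let $a_\triangle(n)$ be the (finite) number of well-rounded sublattices of index $n$ in $\mathbb{Z}[\rho]$, and let $A_\triangle(x)=\sum_{n\le x}a_\triangle(n)$. Let $\chi_{-3}$ be the non-trivial Dirichlet character modulo $3$, let $L(s,\chi_{-3})$ be its $L$-function, and let $\gamma$ be the Euler--Mascheroni constant. Then, as $x\to\infty$, $$A_\triangle(x)=\frac{9\log 3}{16}\,\frac{L(1,\chi_{-3})}{\zeta(2)}\,x(\log x-1)+c_\triangle x+O\bigl(x^{3/4}\log x\bigr)=\frac{3\sqrt3\,\log 3}{8\pi}\,x(\log x-1)+c_\triangle x+O\bigl(x^{3/4}\log x\bigr),$$ where $$c_\triangle=L(1,\chi_{-3})+\frac{9\log 3\;L(1,\chi_{-3})}{16\,\zeta(2)}\Biggl(\gamma+\frac{L'(1,\chi_{-3})}{L(1,\chi_{-3})}-2\,\frac{\zeta'(2)}{\zeta(2)}+2\gamma-\frac{\log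 3}{4}-\frac{1}{\log 3}\Biggl[\sum_{p=1}^{\infty}\frac1p\Bigl(\log 3-\sum_{p<q<3p}\frac1q\Bigr)+\sum_{k=0}^{\infty}\frac{4}{2k+1}\Bigl(\frac{\log 3}{2}-\sum_{k<\ell\le 3k}\frac{1}{2\ell+1}\Bigr)\Biggr]\Biggr),$$ both infinite series being convergent, and $c_\triangle\approx 0.4915036$ (rounded to seven decimals). The Dirichlet series $\sum_{n\ge1}a_\triangle(n)n^{-s}$ converges absolutely for $\operatorname{Re}(s)>1$ and extends to a function that is meromorphic around $s=1$, with a pole of order $2$ there; its Laurent series around $s=1$ has $(s-1)^{-2}$-coefficient $\frac{9\log 3}{16}\frac{L(1,\chi_{-3})}{\zeta(2)}$ and $(s-1)^{-1}$-coefficient $c_\triangle$. -/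

import Mathlib

open Filter Topology Asymptotics

/-- The set of nonzero vectors of minimal length of an additive subgroup of a normed space. -/
def minimalVectors {E : Type*} [NormedAddCommGroup E] (M : AddSubgroup E) : Set E :=
  {v | v ∈ M ∧ v ≠ 0 ∧ ∀ w ∈ M, w ≠ 0 → ‖v‖ ≤ ‖w‖}

/-- A lattice is well-rounded if its nonzero vectors of minimal length span the ambient
real vector space. -/
def IsWellRounded {E : Type*} [NormedAddCommGroup E] [NormedSpace ℝ E] (M : AddSubgroup E) :
    Prop :=
  Submodule.span ℝ (minimalVectors M) = ⊤

/-- The Eisenstein number `ρ = (1 + i√3) / 2`. -/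
noncomputable def eisensteinRho : ℂ := (1 + Complex.I * (Real.sqrt 3 : ℂ)) / 2

/-- The hexagonal lattice `ℤ[ρ] = ℤ + ℤρ` in the Euclidean plane `ℂ`. -/
noncomputable def hexLattice : AddSubgroup ℂ := AddSubgroup.closure {1, eisensteinRho}

/-- The well-rounded sublattices of index `n` in the hexagonal lattice (`n ≥ 1`). -/
def wrSublattices (n : ℕ) : Set (AddSubgroup ℂ) :=
  {M | M ≤ hexLattice ∧ M.relIndex hexLattice = n ∧ IsWellRounded M}

/-- The number of well-rounded sublattices of index `n` in the hexagonal lattice. -/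
noncomputable def wrCount (n : ℕ) : ℕ := (wrSublattices n).ncard

/-- The summatory function `∑_{1 ≤ n ≤ x} wrCount n`. -/
noncomputable def wrSum (x : ℝ) : ℝ := ∑ n ∈ Finset.Icc 1 ⌊x⌋₊, (wrCount n : ℝ)

/-- The nontrivial Dirichlet character modulo `3`. -/
noncomputable def chiNegThree : DirichletCharacter ℂ 3 :=
  (quadraticChar (ZMod 3)).ringHomComp (Int.castRingHom ℂ)

theorem chiNegThree_zero : chiNegThree 0 = 0 := by
  simp [chiNegThree]

theorem chiNegThree_one : chiNegThree 1 = 1 := by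
  simp

theorem chiNegThree_two : chiNegThree 2 = -1 := by
  have h : quadraticChar (ZMod 3) 2 = -1 := by decide
  simp [chiNegThree, h]

/-- The term `(1/p) (log 3 - ∑_{p < q < 3p} 1/q)`, for `p ≥ 1`. -/
noncomputable def evenTerm (p : ℕ) : ℝ :=
  1 / (p : ℝ) * (Real.log 3 - ∑ q ∈ Finset.Ioo p (3 * p), 1 / (q : ℝ))

/-- The term `(4/(2k+1)) ((1/2) log 3 - ∑_{k < l ≤ 3k} 1/(2l+1))`, for `k ≥ 0`. -/
noncomputable def oddTerm (k : ℕ) : ℝ :=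
  4 / (2 * (k : ℝ) + 1) *
    (1 / 2 * Real.log 3 - ∑ l ∈ Finset.Ioc k (3 * k), 1 / (2 * (l : ℝ) + 1))

/-- The leading coefficient `(9 log 3 / 16) · L(1, χ₋₃) / ζ(2)`. -/
noncomputable def leadCoeff : ℂ :=
  9 * (Real.log 3 : ℂ) / 16 * (chiNegThree.LFunction 1 / riemannZeta 2)

/-- The explicit expression for the linear coefficient. -/
noncomputable def linCoeff : ℂ :=
  chiNegThree.LFunction 1 + leadCoeff *
    ((Real.eulerMascheroniConstant : ℂ)
      + deriv chiNegThree.LFunction 1 / chiNegThree.LFunction 1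
      - 2 * (deriv riemannZeta 2 / riemannZeta 2)
      + 2 * (Real.eulerMascheroniConstant : ℂ) - (Real.log 3 : ℂ) / 4
      - 1 / (Real.log 3 : ℂ) *
        (((∑' p : ℕ, evenTerm (p + 1) : ℝ) : ℂ) + ((∑' k : ℕ, oddTerm k : ℝ) : ℂ)))

/-! Geometry. A subgroup of `ℤ[ω]` is well-rounded when it has two independent minimal vectors `u`,
`v`. These generate it (`EisInt.eq_closure_of_isMin`), and as their norms agree, the diagonals `u +
v` and `u - v` are orthogonal. Two orthogonal directions of the lattice are spanned by `z` and `√-3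
z` with `z` primitive of norm prime to `3`. So the subgroup is `rhomb z b j`, with diagonals `(2j +
b) z` and `b √-3 z` and index `b (2j + b) N(z)`; after a choice of signs, minimality of `u` and `v`
amounts to `0 ≤ j ≤ b`. For `0 < j < b` the vector `z` is unique up to sign. For `j = 0` or `j = b`
the subgroup is an ideal, hence hexagonal, and `z` is unique up to the six units
(`EisInt.bijOn_params`). Therefore `wrCount` is the Dirichlet convolution of `primCount` (primitive
elements up to units) and `shapeCount` (pairs `(b, j)`, the non-hexagonal ones with weight `6 / 2 =
3`); this is `wrCount_eq`.

Dirichlet series. Comparing Euler factors (`primFun_mul_sqFun`), the series of `primCount` is `ζ(s)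
L(s, χ₋₃) / ((1 + 3^(-s)) ζ(2s))`. The series of `shapeCount` is `3 ∑ b^(-s) ∑_{0<j<b} (2j + b)^(-s)
+ (1 + 3^(-s)) ζ(2s)`. The inner sum is a Riemann sum; replacing it by its integral gives `halfQuot
s * ζ(2s - 1)`, and the defect sums to a series that still converges at `s = 1`. Split by the parity
of `b`, its value there is a quarter of the two series in the constant (`tsum_rhombDefectOne`).

Asymptotics. Both sequences have partial sums `κ x + O(√x (1 + log x))`, the predicate `LinearSum`.
This makes each Dirichlet series a simple pole plus a function analytic at `1`
(`LinearSum.lSeries_eq`), and the hyperbola method (`LinearSum.convolution`) gives the sum of the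
convolution with error `x^(3/4) log x`. The constants in both statements are the same residues and
constant terms, which are evaluated by letting real `s` decrease to `1` (`LinearSum.polar_eq`).

Numerics. Each series in the constant is a finite sum plus a tail, and the tail is enclosed by
truncated asymptotic expansions that are verified by telescoping. -/

open ArithmeticFunction

/-! ### Arithmetic of the Eisenstein integers. -/

/-- The Eisenstein integers `ℤ[ω]` with `ω ^ 2 = ω - 1`. -/
abbrev EisInt := QuadraticAlgebra ℤ (-1) 1

namespace EisInt

theorem norm_eq (z : EisInt) : z.norm = z.re ^ 2 + z.re * z.im + z.im ^ 2 := by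
  rw [QuadraticAlgebra.norm_def]; ring

theorem norm_nonneg (z : EisInt) : 0 ≤ z.norm := by
  rw [norm_eq]; nlinarith [sq_nonneg (z.re + z.im), sq_nonneg z.re, sq_nonneg z.im]

theorem norm_eq_zero {z : EisInt} : z.norm = 0 ↔ z = 0 := by
  refine ⟨fun h => ?_, fun h => by simp [h]⟩
  rw [norm_eq] at h
  have h1 : z.re = 0 := by
    by_contra h0
    have := pow_pos (abs_pos.mpr h0) 2
    rw [sq_abs] at this
    nlinarith [sq_nonneg (z.re + 2 * z.im)]
  have h2 : z.im = 0 := by simpa [h1] using h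
  ext <;> simp [h1, h2]

theorem norm_pos {z : EisInt} (h : z ≠ 0) : 0 < z.norm :=
  lt_of_le_of_ne (norm_nonneg z) fun h0 => h (norm_eq_zero.1 h0.symm)

instance : IsDomain EisInt :=
  have : NoZeroDivisors EisInt := ⟨fun {a b} h => by
    have : a.norm * b.norm = 0 := by rw [← map_mul, h]; simp
    exact (mul_eq_zero.1 this).imp norm_eq_zero.1 norm_eq_zero.1⟩
  NoZeroDivisors.to_isDomain _

theorem mul_star_eq (z : EisInt) : z * star z = ((z.norm : ℤ) : EisInt) := by
  rw [norm_eq]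
  ext <;> simp [pow_two] <;> ring

/-- The six units of the Eisenstein integers. -/
theorem norm_eq_one {e : EisInt} (h : e.norm = 1) :
    e = ⟨1, 0⟩ ∨ e = ⟨-1, 0⟩ ∨ e = ⟨0, 1⟩ ∨ e = ⟨0, -1⟩ ∨ e = ⟨1, -1⟩ ∨ e = ⟨-1, 1⟩ := by
  rcases e with ⟨x, y⟩
  rw [norm_eq] at h
  simp only at h
  have hx : x ≤ 1 := by nlinarith [sq_nonneg (x + 2 * y)]
  have hx' : -1 ≤ x := by nlinarith [sq_nonneg (x + 2 * y)]
  have hy : y ≤ 1 := by nlinarith [sq_nonneg (2 * x + y)]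
  have hy' : -1 ≤ y := by nlinarith [sq_nonneg (2 * x + y)]
  interval_cases x <;> interval_cases y <;> simp_all

/-- An Eisenstein integer whose coordinates are coprime. -/
def IsPrim (z : EisInt) : Prop := IsCoprime z.re z.im

/-- The sector `0 ≤ arg z < π / 3`. -/
def InSector (z : EisInt) : Prop := 0 < z.re ∧ 0 ≤ z.im

/-- The half-plane `0 ≤ arg z < π`. -/
def InHalf (z : EisInt) : Prop := 0 < z.im ∨ z.im = 0 ∧ 0 < z.re

instance : DecidablePred InSector := fun _ => inferInstanceAs (Decidable (_ ∧ _))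

theorem IsPrim.ne_zero {z : EisInt} (h : z.IsPrim) : z ≠ 0 := by
  rintro rfl; exact not_isCoprime_zero_zero h

theorem InHalf.neg_not {z : EisInt} (h : z.InHalf) : ¬ (-z).InHalf := by
  simp only [InHalf, QuadraticAlgebra.re_neg, QuadraticAlgebra.im_neg] at *; omega

theorem inHalf_or_neg {z : EisInt} (h : z ≠ 0) : z.InHalf ∨ (-z).InHalf := by
  have : ¬ (z.re = 0 ∧ z.im = 0) := fun h' => h (by ext <;> simp [h'.1, h'.2])
  simp only [InHalf, QuadraticAlgebra.re_neg, QuadraticAlgebra.im_neg] at *; omega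

/-- Units rotate by multiples of `π / 3`, and the six rotated sectors tile the punctured plane. -/
theorem exists_unit_mul_inSector {z : EisInt} (h : z ≠ 0) :
    ∃ e : EisInt, e.norm = 1 ∧ (e * z).InSector := by
  have : ¬ (z.re = 0 ∧ z.im = 0) := fun h' => h (by ext <;> simp [h'.1, h'.2])
  have key : ∀ e : EisInt, e.norm = 1 → (0 < e.re * z.re + -1 * e.im * z.im ∧
      0 ≤ e.re * z.im + e.im * z.re + 1 * e.im * z.im) →
      ∃ e : EisInt, e.norm = 1 ∧ (e * z).InSector := fun e he h' =>
    ⟨e, he, by simpa [InSector] using h'⟩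
  by_cases h1 : 0 < z.re ∧ 0 ≤ z.im
  · exact key ⟨1, 0⟩ (by simp [norm_eq]) (by simp; omega)
  by_cases h2 : 0 < -z.re ∧ 0 ≤ -z.im
  · exact key ⟨-1, 0⟩ (by simp [norm_eq]) (by simp; omega)
  by_cases h3 : 0 < -z.im ∧ 0 ≤ z.re + z.im
  · exact key ⟨0, 1⟩ (by simp [norm_eq]) (by simp; omega)
  by_cases h4 : 0 < z.im ∧ 0 ≤ -z.re - z.im
  · exact key ⟨0, -1⟩ (by simp [norm_eq]) (by simp; omega)
  by_cases h5 : 0 < z.re + z.im ∧ 0 ≤ -z.re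
  · exact key ⟨1, -1⟩ (by simp [norm_eq]) (by simp; omega)
  · exact key ⟨-1, 1⟩ (by simp [norm_eq]) (by simp; omega)

theorem eq_of_inSector_of_eq_mul {z w e : EisInt} (he : e.norm = 1) (hz : z.InSector)
    (hw : w.InSector) (h : w = e * z) : w = z := by
  subst h
  simp only [InSector, QuadraticAlgebra.re_mul, QuadraticAlgebra.im_mul] at *
  rcases norm_eq_one he with rfl | rfl | rfl | rfl | rfl | rfl <;> simp at * <;>
    first | omega | (ext <;> simp)

theorem eq_of_inHalf {z w : EisInt} (hz : z.InHalf) (hw : w.InHalf) (h : w = z ∨ w = -z) :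
    w = z := by
  rcases h with h | rfl
  · exact h
  · exact absurd hw hz.neg_not

/-- An integer dividing a primitive Eisenstein integer times `t` divides `t`. -/
theorem IsPrim.dvd_of_mul {z w : EisInt} (hz : z.IsPrim) {A t : ℤ}
    (h : (A : EisInt) * w = (t : EisInt) * z) : A ∣ t := by
  have h1 : A * w.re = t * z.re := by simpa using congrArg QuadraticAlgebra.re h
  have h2 : A * w.im = t * z.im := by simpa using congrArg QuadraticAlgebra.im h
  obtain ⟨a, b, hab⟩ := hz
  exact ⟨a * w.re + b * w.im, by linear_combination (-t) * hab + (-a) * h1 + (-b) * h2⟩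

theorem IsPrim.exists_mul {z w : EisInt} (hz : z.IsPrim) {A t : ℤ} (hA : A ≠ 0)
    (h : (A : EisInt) * w = (t : EisInt) * z) : ∃ c : ℤ, w = (c : EisInt) * z := by
  obtain ⟨c, rfl⟩ := hz.dvd_of_mul h
  refine ⟨c, mul_left_cancel₀ (Int.cast_ne_zero.2 hA) (h.trans ?_)⟩
  push_cast; ring

/-- A line through the origin contains at most two primitive vectors, which are opposite to each
other. -/
theorem IsPrim.eq_or_neg {z w : EisInt} (hz : z.IsPrim) (hw : w.IsPrim) {a b : ℤ} (ha : 0 < a)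
    (hb : 0 < b ∨ b < 0) (h : (a : EisInt) * w = (b : EisInt) * z) :
    a = |b| ∧ (w = z ∨ w = -z) := by
  have h1 := hz.dvd_of_mul h
  have h2 := hw.dvd_of_mul h.symm
  have h3 : a = |b| := by
    have := Int.natAbs_dvd_natAbs.2 h1
    have := Int.natAbs_dvd_natAbs.2 h2
    have := Nat.dvd_antisymm ‹_› ‹_›
    rw [Int.abs_eq_natAbs]
    omega
  refine ⟨h3, ?_⟩
  have ha' : (a : EisInt) ≠ 0 := Int.cast_ne_zero.2 ha.ne'
  rcases hb with hb | hb
  · rw [abs_of_pos hb] at h3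
    subst h3
    exact Or.inl (mul_left_cancel₀ ha' h)
  · rw [abs_of_neg hb] at h3
    obtain rfl : b = -a := by omega
    exact Or.inr (mul_left_cancel₀ ha' (by rw [h]; push_cast; ring))

theorem exists_isPrim {w : EisInt} (h : w ≠ 0) :
    ∃ (a : ℤ) (z : EisInt), 0 < a ∧ z.IsPrim ∧ w = (a : EisInt) * z := by
  have hne : ¬ (w.re = 0 ∧ w.im = 0) := fun h' => h (by ext <;> simp [h'.1, h'.2])
  have hg : 0 < Int.gcd w.re w.im := Int.gcd_pos_iff.2 (by tauto)
  obtain ⟨g, x, y, hg0, hc, hx, hy⟩ := Int.exists_gcd_one' (m := w.re) (n := w.im) hg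
  refine ⟨g, ⟨x, y⟩, by exact_mod_cast hg0, Int.isCoprime_iff_gcd_eq_one.2 hc, ?_⟩
  ext <;> simp [hx, hy, mul_comm]

theorem IsPrim.of_dvd {z w : EisInt} (h : w.IsPrim) (hd : ∃ r, w = r * z) : z.IsPrim := by
  obtain ⟨r, rfl⟩ := hd
  obtain ⟨a, b, hab⟩ := h
  simp only [QuadraticAlgebra.re_mul, QuadraticAlgebra.im_mul] at hab
  exact ⟨a * r.re + b * r.im, -a * r.im + b * r.re + b * r.im, by linear_combination hab⟩

theorem IsPrim.unit_mul {z e : EisInt} (h : z.IsPrim) (he : e.norm = 1) : (e * z).IsPrim :=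
  h.of_dvd ⟨star e, by rw [← mul_assoc, mul_comm (star e), mul_star_eq, he]; simp⟩

/-- The element `√-3 = 2 ω - 1`. -/
def theta : EisInt := ⟨-1, 2⟩

theorem norm_theta : theta.norm = 3 := by simp [norm_eq, theta]

theorem theta_sq : theta * theta = ((-3 : ℤ) : EisInt) := by
  ext <;> simp only [theta, QuadraticAlgebra.re_mul, QuadraticAlgebra.im_mul,
    QuadraticAlgebra.re_intCast, QuadraticAlgebra.im_intCast] <;> norm_num

/-- Modulo `3` the norm is `(re - im) ^ 2`, and `theta` divides `z` as soon as `re ≡ im`. -/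
theorem theta_dvd {z : EisInt} (h : (3 : ℤ) ∣ z.norm) : ∃ w, z = theta * w := by
  have h1 : (3 : ℤ) ∣ z.re - z.im := by
    rw [norm_eq] at h
    have : (3 : ℤ) ∣ (z.re - z.im) ^ 2 := by
      rw [show (z.re - z.im) ^ 2 = z.re ^ 2 + z.re * z.im + z.im ^ 2 - 3 * (z.re * z.im) by ring]
      exact dvd_sub h (dvd_mul_right 3 _)
    exact Int.prime_three.dvd_of_dvd_pow this
  obtain ⟨c, hc⟩ := h1
  obtain h2 : z.re = z.im + 3 * c := by omega
  exact ⟨⟨z.im + c, -z.im - 2 * c⟩, by ext <;> simp [theta, h2] <;> ring⟩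

theorem three_dvd_norm_theta_mul (w : EisInt) : (3 : ℤ) ∣ (theta * w).norm := by
  rw [map_mul, norm_theta]; exact dvd_mul_right _ _

/-- The content `a` of `theta * z` divides `3`, because `theta * (theta * z) = -3 z` with `z`
primitive. Content `3` would give `9 ∣ 3 N(z)`. -/
theorem IsPrim.theta_mul {z : EisInt} (h : z.IsPrim) (h3 : ¬ (3 : ℤ) ∣ z.norm) :
    (theta * z).IsPrim := by
  obtain ⟨a, w, ha, hw, hz⟩ := exists_isPrim (mul_ne_zero (b := z) (a := theta)
    (by rw [Ne, ← norm_eq_zero, norm_theta]; norm_num) h.ne_zero)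
  have h1 : (a : EisInt) * (theta * w) = ((-3 : ℤ) : EisInt) * z := by
    rw [mul_left_comm, ← hz, ← mul_assoc, theta_sq]
  have h2 := h.dvd_of_mul h1
  have h3' : ¬ (3 : ℤ) ∣ a := by
    intro hd
    apply h3
    have : (theta * z).norm = a ^ 2 * w.norm := by rw [hz, map_mul]; simp
    rw [map_mul, norm_theta] at this
    obtain ⟨k, rfl⟩ := hd
    exact ⟨k ^ 2 * w.norm, by nlinarith⟩
  have h4 : a = 1 := by
    have h5 : a ≤ 3 := by
      have := Int.le_of_dvd (by norm_num) (dvd_neg.1 h2)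
      omega
    have : a ∣ 3 := dvd_neg.1 h2
    interval_cases a <;> omega
  rw [hz, h4]; simpa using hw

theorem exists_quot_rem (A : ℤ) {n : ℤ} (hn : 0 < n) : ∃ q r : ℤ, A = q * n + r ∧ |2 * r| ≤ n := by
  refine ⟨(2 * A + n) / (2 * n), A - (2 * A + n) / (2 * n) * n, by ring, ?_⟩
  have h1 := Int.emod_add_mul_ediv (2 * A + n) (2 * n)
  have h2 := Int.emod_nonneg (2 * A + n) (show (2 * n) ≠ 0 by omega)
  have h3 := Int.emod_lt_of_pos (2 * A + n) (show 0 < 2 * n by omega)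
  rw [abs_le]
  constructor <;> nlinarith

/-- Euclidean division: rounding both coordinates of `α * star g / N(g)` leaves a remainder of norm
at most `3/4 N(g)`. -/
theorem exists_norm_sub_mul_lt (α : EisInt) {g : EisInt} (hg : g ≠ 0) :
    ∃ q : EisInt, (α - q * g).norm < g.norm := by
  have hn := norm_pos hg
  obtain ⟨q₁, r₁, h1, h1'⟩ := exists_quot_rem (α * star g).re hn
  obtain ⟨q₂, r₂, h2, h2'⟩ := exists_quot_rem (α * star g).im hn
  refine ⟨⟨q₁, q₂⟩, ?_⟩
  have h3 : (α - ⟨q₁, q₂⟩ * g) * star g = ⟨r₁, r₂⟩ := by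
    rw [sub_mul, mul_assoc, mul_star_eq]
    ext
    · rw [QuadraticAlgebra.re_sub, h1]; simp
    · rw [QuadraticAlgebra.im_sub, h2]; simp
  have h4 := congrArg QuadraticAlgebra.norm h3
  rw [map_mul, QuadraticAlgebra.norm_star, norm_eq ⟨r₁, r₂⟩] at h4
  simp only at h4
  rw [abs_le] at h1' h2'
  by_contra! hc
  nlinarith [mul_le_mul_of_nonneg_right hc hn.le, mul_pos hn hn, sq_nonneg (r₁ - r₂)]

end EisInt

/-! ### Primitive elements of norm `k` and roots of `t ^ 2 - t + 1` modulo `k`. -/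

namespace EisInt

/-- The root of `t ^ 2 - t + 1` in `ZMod k` by which a primitive element of norm `k` vanishes. -/
theorem exists_root {k : ℕ} {z : EisInt} (hz : z.IsPrim) (hk : z.norm = k) :
    ∃ t : ZMod k, t ^ 2 - t + 1 = 0 ∧ (z.re : ZMod k) + z.im * t = 0 := by
  have h0 : (z.re : ZMod k) ^ 2 + z.re * z.im + z.im ^ 2 = 0 := by
    have := congrArg (Int.cast : ℤ → ZMod k) (norm_eq z ▸ hk)
    push_cast at this
    simpa using this
  obtain ⟨a, b, hab⟩ := hz
  have hab' : (a : ZMod k) * z.re + b * z.im = 1 := by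
    simpa using congrArg (Int.cast : ℤ → ZMod k) hab
  have hu : IsUnit (z.im : ZMod k) := by
    -- Square the Bézout relation `a re + b im = 1` and eliminate `re ^ 2` by the norm equation:
    -- what remains is a multiple of `im`, and the cofactor is this inverse.
    refine IsUnit.of_mul_eq_one
      ((b : ZMod k) ^ 2 * z.im + 2 * a * b * z.re - (a : ZMod k) ^ 2 * (z.re + z.im)) ?_
    linear_combination (-(a : ZMod k) ^ 2) * h0 + (a * z.re + b * z.im + 1) * hab'
  obtain ⟨u, hu⟩ := hu
  have hi : (u : ZMod k) * (↑u⁻¹ : ZMod k) = 1 := u.mul_inv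
  refine ⟨-(z.re * (↑u⁻¹ : ZMod k)), ?_, ?_⟩
  · rw [← hu] at h0
    linear_combination (↑u⁻¹ : ZMod k) ^ 2 * h0 +
      (-(1 + (u : ZMod k) * (↑u⁻¹ : ZMod k)) - z.re * (↑u⁻¹ : ZMod k)) * hi
  · rw [← hu]; linear_combination (-(z.re : ZMod k)) * hi

/-- Both elements lie in the kernel of the ring map `ω ↦ t` to `ZMod k`. This forces `k` to divide
`w * star z`, and since `z * star z = k` the quotient is the required unit. -/
theorem eq_of_root {k : ℕ} (hk0 : 0 < k) {z w : EisInt} (hz : z.norm = k) (hw : w.norm = k)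
    {t : ZMod k} (ht : t ^ 2 - t + 1 = 0) (hzt : (z.re : ZMod k) + z.im * t = 0)
    (hwt : (w.re : ZMod k) + w.im * t = 0) : ∃ e : EisInt, e.norm = 1 ∧ w = e * z := by
  have h1 : ((w * star z).re : ZMod k) = 0 := by
    simp
    linear_combination (w.re : ZMod k) * hzt +
      (z.im * (1 - t)) * hwt + (w.im * z.im) * ht
  have h2 : ((w * star z).im : ZMod k) = 0 := by
    simp
    linear_combination (w.im : ZMod k) * hzt - (z.im : ZMod k) * hwt
  rw [ZMod.intCast_zmod_eq_zero_iff_dvd] at h1 h2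
  obtain ⟨a, ha⟩ := h1
  obtain ⟨b, hb⟩ := h2
  have h3 : w * star z = ((k : ℤ) : EisInt) * ⟨a, b⟩ := by
    ext
    · rw [ha]; simp
    · rw [hb]; simp
  have hk' : ((k : ℤ) : EisInt) ≠ 0 := Int.cast_ne_zero.2 (by exact_mod_cast hk0.ne')
  refine ⟨⟨a, b⟩, ?_, mul_left_cancel₀ hk' ?_⟩
  · have := congrArg QuadraticAlgebra.norm h3
    rw [map_mul, map_mul, QuadraticAlgebra.norm_star, hz, hw, QuadraticAlgebra.norm_intCast] at this
    have hkk : (0 : ℤ) < k := by exact_mod_cast hk0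
    exact mul_left_cancel₀ (mul_pos hkk hkk).ne' (by linear_combination -this)
  · rw [← mul_assoc, ← h3, mul_assoc, mul_comm (star z), mul_star_eq, hz, mul_comm]

/-- The kernel `I` of `ω ↦ t` is an ideal, so an element `g` of least norm generates it. As `g`
divides the primitive element `ω - t`, it is primitive. Evaluating the norm at the root gives `k ∣
N(g)`, and `N(g)` divides `k (ω - t)`, whose `im` is `k`. -/
theorem exists_of_root {k : ℕ} (hk0 : 0 < k) {t : ZMod k} (ht : t ^ 2 - t + 1 = 0) :
    ∃ z : EisInt, z.IsPrim ∧ z.norm = k ∧ (z.re : ZMod k) + z.im * t = 0 := by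
  let I : EisInt → Prop := fun z => (z.re : ZMod k) + z.im * t = 0
  have hmul : ∀ q z, I z → I (q * z) := by
    intro q z hz
    simp only [I] at *
    simp
    linear_combination ((q.re : ZMod k) + q.im * t) * hz - (q.im * z.im : ZMod k) * ht
  have hsub : ∀ z w, I z → I w → I (z - w) := by
    intro z w hz hw
    simp only [I] at *
    simp
    linear_combination hz - hw
  have hk : I (k : EisInt) := by simp [I]
  have hkne : (k : EisInt) ≠ 0 := Nat.cast_ne_zero.2 hk0.ne'
  have hex : ∃ n : ℕ, ∃ z, I z ∧ z ≠ 0 ∧ z.norm.toNat = n := ⟨_, _, hk, hkne, rfl⟩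
  classical
  obtain ⟨g, hg, hg0, hgn⟩ := Nat.find_spec hex
  have hmin : ∀ z, I z → z ≠ 0 → g.norm ≤ z.norm := by
    intro z hz hz0
    have := Nat.find_min' hex ⟨z, hz, hz0, rfl⟩
    rw [← hgn] at this
    have := norm_nonneg z
    have := norm_nonneg g
    omega
  have hgen : ∀ z, I z → ∃ q, z = q * g := by
    intro z hz
    obtain ⟨q, hq⟩ := exists_norm_sub_mul_lt z hg0
    refine ⟨q, ?_⟩
    by_contra hne
    exact absurd (hmin _ (hsub _ _ hz (hmul q g hg)) (sub_ne_zero.2 hne)) (not_le.2 hq)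
  obtain ⟨h, hh⟩ := hgen _ hk
  obtain ⟨h', hh'⟩ := hgen ⟨-(t.cast : ℤ), 1⟩ (by simp [I])
  refine ⟨g, IsPrim.of_dvd (w := ⟨-(t.cast : ℤ), 1⟩) ⟨0, 1, by simp⟩ ⟨h', hh'⟩, ?_, hg⟩
  have h1 : (k : ℤ) ∣ g.norm := by
    rw [← ZMod.intCast_zmod_eq_zero_iff_dvd, norm_eq]
    push_cast
    linear_combination (g.re - g.im * t + g.im : ZMod k) * hg + (g.im : ZMod k) ^ 2 * ht
  have h2 : g.norm ∣ (k : ℤ) := by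
    have e1 : (k : ℤ) = (star (k : EisInt) * ⟨-(t.cast : ℤ), 1⟩).im := by simp
    have e2 : star (k : EisInt) * ⟨-(t.cast : ℤ), 1⟩ = ((g.norm : ℤ) : EisInt) * (star h * h') := by
      rw [hh, hh', star_mul, ← mul_star_eq]; ring
    rw [e1, e2]
    exact ⟨(star h * h').im, by simp⟩
  exact Int.dvd_antisymm (norm_nonneg g) (by positivity) h2 h1

/-- The primitive elements of norm `k`, prime to `3`, up to units. -/
theorem card_sector_eq_card_roots {k : ℕ} (hk0 : 0 < k) :
    Set.ncard {z : EisInt | z.IsPrim ∧ z.InSector ∧ z.norm = k} =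
      Nat.card {t : ZMod k // t ^ 2 - t + 1 = 0} := by
  rw [← Nat.card_coe_set_eq]
  have h : ∀ z : {z : EisInt | z.IsPrim ∧ z.InSector ∧ z.norm = k}, ∃ t : ZMod k,
      t ^ 2 - t + 1 = 0 ∧ (z.1.re : ZMod k) + z.1.im * t = 0 := fun z =>
    exists_root z.2.1 z.2.2.2
  choose f hf hf' using h
  refine Nat.card_congr (Equiv.ofBijective (fun z => ⟨f z, hf z⟩) ⟨?_, ?_⟩)
  · intro z w hzw
    have hzw' : f z = f w := congrArg Subtype.val hzw
    obtain ⟨e, he, hwz⟩ := eq_of_root hk0 w.2.2.2 z.2.2.2 (hf z) (hzw' ▸ hf' w) (hf' z)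
    exact Subtype.ext (eq_of_inSector_of_eq_mul he w.2.2.1 z.2.2.1 hwz)
  · rintro ⟨t, ht⟩
    obtain ⟨z, hz, hzk, hzt⟩ := exists_of_root hk0 ht
    obtain ⟨e, he, hs⟩ := exists_unit_mul_inSector hz.ne_zero
    have hmem : (e * z).IsPrim ∧ (e * z).InSector ∧ (e * z).norm = k :=
      ⟨hz.unit_mul he, hs, by rw [map_mul, he, hzk, one_mul]⟩
    refine ⟨⟨e * z, hmem⟩, Subtype.ext ?_⟩
    have h1 := hf' ⟨e * z, hmem⟩
    have h2 : (((e * z).re : ℤ) : ZMod k) + ((e * z).im : ℤ) * t = 0 := by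
      simp
      linear_combination ((e.re : ZMod k) + e.im * t) * hzt - (e.im * z.im : ZMod k) * ht
    -- Primitivity makes `im` invertible modulo `k`, so an element determines its root.
    have hu : IsUnit (((e * z).im : ℤ) : ZMod k) := by
      obtain ⟨a, b, hab⟩ := hmem.1
      have hab' : (a : ZMod k) * ((e * z).re : ℤ) + b * ((e * z).im : ℤ) = 1 := by
        simpa only [Int.cast_add, Int.cast_mul, Int.cast_one] using
          congrArg (Int.cast : ℤ → ZMod k) hab
      exact IsUnit.of_mul_eq_one (b - a * t) (by linear_combination hab' - (a : ZMod k) * h2)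
    exact hu.mul_left_cancel (by linear_combination h1 - h2)

end EisInt

/-! ### Subgroups spanned by minimal vectors, and rhombic lattices. -/

namespace EisInt

/-- The determinant of a pair of Eisenstein integers in the basis `1, ω`. -/
def det (u v : EisInt) : ℤ := u.re * v.im - u.im * v.re

/-- Nonzero elements of minimal norm. -/
def IsMin (N : AddSubgroup EisInt) (u : EisInt) : Prop :=
  u ∈ N ∧ u ≠ 0 ∧ ∀ w ∈ N, w ≠ 0 → u.norm ≤ w.norm

theorem mem_closure_pair_iff {u v w : EisInt} :
    w ∈ AddSubgroup.closure {u, v} ↔ ∃ m n : ℤ, w = (m : EisInt) * u + (n : EisInt) * v := by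
  rw [AddSubgroup.mem_closure_pair]
  simp only [zsmul_eq_mul, eq_comm]

/-- The subgroup is the range of the `ℤ`-linear map with `1 ↦ u`, `ω ↦ v`, and the index of a range
is the absolute value of the determinant. -/
theorem index_closure_pair {u v : EisInt} (h : det u v ≠ 0) :
    (AddSubgroup.closure {u, v}).index = (det u v).natAbs := by
  let b := QuadraticAlgebra.basis (R := ℤ) (-1) 1
  let f : EisInt →ₗ[ℤ] EisInt := Matrix.toLin b b !![u.re, v.re; u.im, v.im]
  have hf : ∀ w, f w = (w.re : EisInt) * u + (w.im : EisInt) * v := by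
    intro w
    rw [Matrix.toLin_apply]
    have e1 : (QuadraticAlgebra.equivProd (-1) 1 w).1 = w.re := rfl
    have e2 : (QuadraticAlgebra.equivProd (-1) 1 w).2 = w.im := rfl
    ext <;> simp [b, Matrix.mulVec, dotProduct, Fin.sum_univ_two, QuadraticAlgebra.basis,
      QuadraticAlgebra.linearEquivTuple, e1, e2] <;> ring
  have hinj : Function.Injective f := by
    rw [injective_iff_map_eq_zero]
    intro w hw
    rw [hf] at hw
    have h1 := congrArg QuadraticAlgebra.re hw
    have h2 := congrArg QuadraticAlgebra.im hw
    simp at h1 h2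
    have h3 : w.re * det u v = 0 := by
      unfold det; linear_combination v.im * h1 - v.re * h2
    have h4 : w.im * det u v = 0 := by
      unfold det; linear_combination u.re * h2 - u.im * h1
    ext
    · simpa [h] using h3
    · simpa [h] using h4
  have hrange : LinearMap.range f = (AddSubgroup.closure {u, v}).toIntSubmodule := by
    ext w
    rw [LinearMap.mem_range]
    change _ ↔ w ∈ AddSubgroup.closure {u, v}
    rw [mem_closure_pair_iff]
    constructor
    · rintro ⟨y, rfl⟩
      exact ⟨_, _, hf y⟩
    · rintro ⟨m, n, rfl⟩
      exact ⟨⟨m, n⟩, hf _⟩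
  have key := Submodule.natAbs_det_equiv (LinearMap.range f) (LinearEquiv.ofInjective f hinj)
  have hcomp : (LinearMap.range f).subtype ∘ₗ AddMonoidHom.toIntLinearMap
      ((LinearEquiv.ofInjective f hinj : EisInt ≃ₗ[ℤ] LinearMap.range f) :
        EisInt →+ LinearMap.range f) = f := by
    ext w <;> rfl
  rw [hcomp, LinearMap.det_toLin, Matrix.det_fin_two_of] at key
  rw [hrange] at key
  rw [show (AddSubgroup.closure {u, v}).index =
    Nat.card (EisInt ⧸ (AddSubgroup.closure {u, v}).toIntSubmodule) from rfl, ← key, det]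
  congr 1; ring

/-- Two independent elements of minimal norm generate. -/
theorem eq_closure_of_isMin {N : AddSubgroup EisInt} {u v : EisInt} (hu : IsMin N u)
    (hv : IsMin N v) (h : det u v ≠ 0) : N = AddSubgroup.closure {u, v} := by
  apply le_antisymm
  · intro w hw
    have hn : u.norm = v.norm := le_antisymm (hu.2.2 v hv.1 hv.2.1) (hv.2.2 u hu.1 hu.2.1)
    have hq := norm_pos hu.2.1
    have hD : 0 < |det u v| := abs_pos.2 h
    -- By Cramer's rule the coordinates of `w` in `u`, `v` are `det w v / det u v` and `det u w /
    -- det u v`. Rounding them leaves `w' = (r u + r' v) / D` with `|r|, |r'| ≤ D / 2`; the sign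
    -- factor makes the denominator positive.
    obtain ⟨q, r, hs, hr⟩ := exists_quot_rem ((det u v).sign * det w v) hD
    obtain ⟨q', r', ht, hr'⟩ := exists_quot_rem ((det u v).sign * det u w) hD
    rw [mem_closure_pair_iff]
    refine ⟨q, q', sub_eq_zero.1 ?_⟩
    by_contra hne
    set w' := w - ((q : EisInt) * u + (q' : EisInt) * v) with hw'
    have hmem : w' ∈ N := by
      refine N.sub_mem hw (N.add_mem ?_ ?_)
      · rw [← zsmul_eq_mul]; exact N.zsmul_mem hu.1 _
      · rw [← zsmul_eq_mul]; exact N.zsmul_mem hv.1 _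
    have hle := hu.2.2 w' hmem hne
    set D := |det u v| with hDdef
    have hsg : (det u v).sign * det u v = D := Int.sign_mul_self_eq_abs _
    have h1 : D * w'.re = r * u.re + r' * v.re := by
      have : D * w.re = ((det u v).sign * det w v) * u.re + ((det u v).sign * det u w) * v.re := by
        rw [← hsg]; unfold det; ring
      rw [hs, ht] at this
      simp [hw']
      linear_combination this
    have h2 : D * w'.im = r * u.im + r' * v.im := by
      have : D * w.im = ((det u v).sign * det w v) * u.im + ((det u v).sign * det u w) * v.im := by
        rw [← hsg]; unfold det; ring
      rw [hs, ht] at this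
      simp [hw']
      linear_combination this
    -- `T` is twice the inner product of `u` and `v`. The Gram identity `4 N(u)^2 - T^2 = 3 D^2` and
    -- independence give `|T| < 2 N(u)`, whence `N(w') < N(u)`, against minimality.
    set T := 2 * u.re * v.re + u.re * v.im + u.im * v.re + 2 * u.im * v.im with hT
    have h3 : D ^ 2 * w'.norm = (r ^ 2 + r' ^ 2) * u.norm + r * r' * T := by
      have e : r ^ 2 * u.norm + r' ^ 2 * v.norm + r * r' * T = D ^ 2 * w'.norm := by
        rw [norm_eq, norm_eq, norm_eq, hT]
        linear_combination (-(D * w'.re) - (r * u.re + r' * v.re) - D * w'.im) * h1 +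
          (-(D * w'.im) - (r * u.im + r' * v.im) - (r * u.re + r' * v.re)) * h2
      rw [← hn] at e
      linear_combination -e
    have h4 : 4 * u.norm ^ 2 - T ^ 2 = 3 * D ^ 2 := by
      have : 4 * u.norm * v.norm - T ^ 2 = 3 * D ^ 2 := by
        rw [hDdef, sq_abs, norm_eq, norm_eq, hT, det]; ring
      rw [← hn] at this
      linear_combination this
    have h5 : |T| < 2 * u.norm := abs_lt_of_sq_lt_sq (by nlinarith [mul_pos hD hD]) (by omega)
    have h6 : |2 * r| * |2 * r'| ≤ D * D := mul_le_mul hr hr' (abs_nonneg _) hD.le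
    have h7 : 4 * (r * r' * T) < 2 * u.norm * (D * D) := by
      have e1 : 4 * (r * r' * T) ≤ |2 * r| * |2 * r'| * |T| := by
        rw [← abs_mul, ← abs_mul]
        exact le_trans (by ring_nf; rfl) (le_abs_self _)
      have e2 : |2 * r| * |2 * r'| * |T| ≤ D * D * |T| :=
        mul_le_mul_of_nonneg_right h6 (abs_nonneg _)
      nlinarith [mul_pos hD hD]
    have h8 : 4 * r ^ 2 ≤ D ^ 2 := by nlinarith [abs_le.1 hr]
    have h9 : 4 * r' ^ 2 ≤ D ^ 2 := by nlinarith [abs_le.1 hr']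
    nlinarith [mul_pos hD hD, mul_le_mul_of_nonneg_left hle (mul_pos hD hD).le]
  · rw [AddSubgroup.closure_le]
    rintro x (rfl | rfl)
    · exact hu.1
    · exact hv.1

/-- The rhombic lattice with diagonals `(2 j + b) z` and `b √-3 z`. -/
def rhomb (z : EisInt) (b j : ℤ) : AddSubgroup EisInt :=
  AddSubgroup.closure {z * ⟨j, b⟩, z * ⟨j + b, -b⟩}

theorem mem_rhomb {z w : EisInt} {b j : ℤ} :
    w ∈ rhomb z b j ↔ ∃ m n : ℤ, w = z * ⟨m * j + n * (j + b), m * b - n * b⟩ := by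
  rw [rhomb, mem_closure_pair_iff]
  refine exists₂_congr fun m n => ?_
  have : (m : EisInt) * (z * ⟨j, b⟩) + (n : EisInt) * (z * ⟨j + b, -b⟩) =
      z * ⟨m * j + n * (j + b), m * b - n * b⟩ := by ext <;> simp <;> ring
  rw [this]

theorem det_rhomb (z : EisInt) (b j : ℤ) :
    det (z * ⟨j, b⟩) (z * ⟨j + b, -b⟩) = -(b * (2 * j + b) * z.norm) := by
  rw [norm_eq]; simp [det]; ring

theorem index_rhomb {z : EisInt} (hz : z ≠ 0) {b j : ℤ} (hb : 0 < b) (hj : 0 ≤ j) :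
    ((rhomb z b j).index : ℤ) = b * (2 * j + b) * z.norm := by
  have : 0 < b * (2 * j + b) * z.norm := mul_pos (mul_pos hb (by omega)) (norm_pos hz)
  rw [rhomb, index_closure_pair (by rw [det_rhomb]; omega), det_rhomb]
  omega

theorem norm_rhomb (z : EisInt) (b j m n : ℤ) :
    (z * ⟨m * j + n * (j + b), m * b - n * b⟩ : EisInt).norm = z.norm *
      ((m ^ 2 + n ^ 2) * (j ^ 2 + j * b + b ^ 2) + m * n * (2 * j ^ 2 + 2 * j * b - b ^ 2)) := by
  rw [map_mul, norm_eq ⟨m * j + n * (j + b), m * b - n * b⟩]; ring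

/-- Write `q = j^2 + jb + b^2` and `c = 2j^2 + 2jb - b^2`. Here `-q ≤ c` says `j (j + b) ≥ 0` and `c
≤ q` says `(j - b)(j + 2b) ≤ 0`; so `0 ≤ j ≤ b` gives `|c| ≤ q`, and the form is at least `q (m^2 +
n^2 - |mn|) ≥ q`. -/
theorem rhomb_form_ge {b j : ℤ} (hb : 0 < b) (hj : 0 ≤ j) (hjb : j ≤ b) {m n : ℤ}
    (h : ¬ (m = 0 ∧ n = 0)) : j ^ 2 + j * b + b ^ 2 ≤
      (m ^ 2 + n ^ 2) * (j ^ 2 + j * b + b ^ 2) + m * n * (2 * j ^ 2 + 2 * j * b - b ^ 2) := by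
  have h1 : 1 ≤ m ^ 2 + n ^ 2 - |m * n| := by
    rw [abs_mul, ← sq_abs m, ← sq_abs n]
    have : ¬ (|m| = 0 ∧ |n| = 0) := by simpa using h
    have h0 := abs_nonneg m
    have h0' := abs_nonneg n
    generalize |m| = x at *
    generalize |n| = y at *
    rcases eq_or_lt_of_le h0 with rfl | hx
    · have : 0 < y := by omega
      nlinarith
    · rcases eq_or_lt_of_le h0' with rfl | hy
      · nlinarith
      · nlinarith [sq_nonneg (x - y), mul_pos hx hy]
  have h2 : |2 * j ^ 2 + 2 * j * b - b ^ 2| ≤ j ^ 2 + j * b + b ^ 2 := by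
    rw [abs_le]; constructor <;> nlinarith [mul_nonneg hj hb.le]
  have h3 : -(|m * n| * (j ^ 2 + j * b + b ^ 2)) ≤ m * n * (2 * j ^ 2 + 2 * j * b - b ^ 2) := by
    refine le_trans ?_ (neg_abs_le _)
    rw [abs_mul (m * n)]
    exact neg_le_neg (mul_le_mul_of_nonneg_left h2 (abs_nonneg _))
  nlinarith [mul_nonneg hj hb.le]

theorem isMin_rhomb {z : EisInt} (hz : z ≠ 0) {b j : ℤ} (hb : 0 < b) (hj : 0 ≤ j) (hjb : j ≤ b)
    {m n : ℤ} (h : (m ^ 2 + n ^ 2) * (j ^ 2 + j * b + b ^ 2) +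
      m * n * (2 * j ^ 2 + 2 * j * b - b ^ 2) = j ^ 2 + j * b + b ^ 2) :
    IsMin (rhomb z b j) (z * ⟨m * j + n * (j + b), m * b - n * b⟩) := by
  have hq : 0 < j ^ 2 + j * b + b ^ 2 := by nlinarith [mul_nonneg hj hb.le]
  refine ⟨mem_rhomb.2 ⟨m, n, rfl⟩, ?_, ?_⟩
  · rw [Ne, ← norm_eq_zero, norm_rhomb, h]
    exact (mul_pos (norm_pos hz) hq).ne'
  · intro w hw hw0
    obtain ⟨m', n', rfl⟩ := mem_rhomb.1 hw
    rw [norm_rhomb, norm_rhomb, h]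
    refine mul_le_mul_of_nonneg_left (rhomb_form_ge hb hj hjb ?_) (norm_nonneg z)
    rintro ⟨rfl, rfl⟩
    apply hw0
    ext <;> simp

theorem isMin_rhomb_left {z : EisInt} (hz : z ≠ 0) {b j : ℤ} (hb : 0 < b) (hj : 0 ≤ j)
    (hjb : j ≤ b) : IsMin (rhomb z b j) (z * ⟨j, b⟩) := by
  simpa using isMin_rhomb hz hb hj hjb (m := 1) (n := 0) (by ring)

theorem isMin_rhomb_right {z : EisInt} (hz : z ≠ 0) {b j : ℤ} (hb : 0 < b) (hj : 0 ≤ j)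
    (hjb : j ≤ b) : IsMin (rhomb z b j) (z * ⟨j + b, -b⟩) := by
  simpa using isMin_rhomb hz hb hj hjb (m := 0) (n := 1) (by ring)

/-- In a rhombic lattice that is not hexagonal there are only four minimal vectors. -/
theorem eq_of_isMin_rhomb {z : EisInt} (hz : z ≠ 0) {b j : ℤ} (hj : 0 < j) (hjb : j < b)
    {w : EisInt} (hw : IsMin (rhomb z b j) w) : w = z * ⟨j, b⟩ ∨ w = -(z * ⟨j, b⟩) ∨
      w = z * ⟨j + b, -b⟩ ∨ w = -(z * ⟨j + b, -b⟩) := by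
  have hb : 0 < b := by omega
  obtain ⟨m, n, rfl⟩ := mem_rhomb.1 hw.1
  have h1 := hw.2.2 _ (isMin_rhomb_left hz hb hj.le hjb.le).1
    (isMin_rhomb_left hz hb hj.le hjb.le).2.1
  rw [norm_rhomb, map_mul, norm_eq ⟨j, b⟩] at h1
  have h2 := le_of_mul_le_mul_left h1 (norm_pos hz)
  simp only at h2
  have h3 : |2 * j ^ 2 + 2 * j * b - b ^ 2| < j ^ 2 + j * b + b ^ 2 := by
    rw [abs_lt]; constructor <;> nlinarith [mul_pos hj hb]
  have hq : 0 < j ^ 2 + j * b + b ^ 2 := by positivity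
  have hmn : m * n = 0 := by
    by_contra hne
    have h4 : 0 < |m * n| := abs_pos.2 hne
    have h5 : -(|m * n| * (j ^ 2 + j * b + b ^ 2)) < m * n * (2 * j ^ 2 + 2 * j * b - b ^ 2) := by
      refine lt_of_lt_of_le ?_ (neg_abs_le _)
      rw [abs_mul (m * n)]
      exact neg_lt_neg (mul_lt_mul_of_pos_left h3 h4)
    have h6 : 1 ≤ m ^ 2 + n ^ 2 - |m * n| := by
      rw [abs_mul] at *
      rw [← sq_abs m, ← sq_abs n]
      have := abs_nonneg m
      nlinarith [sq_nonneg (|m| - |n|)]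
    nlinarith
  have hlt : m ^ 2 + n ^ 2 ≤ 1 := by
    rw [hmn] at h2
    by_contra! hc
    nlinarith
  have hne : ¬ (m = 0 ∧ n = 0) := by
    rintro ⟨rfl, rfl⟩
    exact hw.2.1 (by ext <;> simp)
  rcases mul_eq_zero.1 hmn with rfl | rfl
  · have : n = 1 ∨ n = -1 := by
      have h1 : n ≤ 1 := by nlinarith
      have h2 : -1 ≤ n := by nlinarith
      omega
    rcases this with rfl | rfl
    · right; right; left; ext <;> simp
    · right; right; right; ext <;> simp <;> ring
  · have : m = 1 ∨ m = -1 := by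
      have h1 : m ≤ 1 := by nlinarith
      have h2 : -1 ≤ m := by nlinarith
      omega
    rcases this with rfl | rfl
    · left; ext <;> simp
    · right; left; ext <;> simp <;> ring

end EisInt

/-! ### Uniqueness and existence of the parameters of a rhombic lattice. -/

namespace EisInt

/-- The extreme parameters `j = 0` and `j = b` give the ideals generated by `b z` and `b theta z`.
These are the hexagonal cases, insensitive to units. -/
theorem mem_rhomb_zero {z w : EisInt} {b : ℤ} :
    w ∈ rhomb z b 0 ↔ ∃ r : EisInt, w = (b : EisInt) * z * r := by
  rw [mem_rhomb]
  constructor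
  · rintro ⟨m, n, rfl⟩
    exact ⟨⟨n, m - n⟩, by ext <;> simp <;> ring⟩
  · rintro ⟨r, rfl⟩
    exact ⟨r.re + r.im, r.re, by ext <;> simp <;> ring⟩

theorem mem_rhomb_self {z w : EisInt} {b : ℤ} :
    w ∈ rhomb z b b ↔ ∃ r : EisInt, w = (b : EisInt) * (theta * z) * r := by
  rw [mem_rhomb]
  constructor
  · rintro ⟨m, n, rfl⟩
    exact ⟨⟨m, -m - n⟩, by ext <;> simp [theta] <;> ring⟩
  · rintro ⟨r, rfl⟩
    exact ⟨r.re, -r.re - r.im, by ext <;> simp [theta] <;> ring⟩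

theorem rhomb_neg (z : EisInt) (b j : ℤ) : rhomb (-z) b j = rhomb z b j := by
  ext w
  rw [mem_rhomb, mem_rhomb]
  constructor
  · rintro ⟨m, n, rfl⟩
    exact ⟨-m, -n, by ext <;> simp <;> ring⟩
  · rintro ⟨m, n, rfl⟩
    exact ⟨-m, -n, by ext <;> simp <;> ring⟩

theorem rhomb_unit_mul {z e : EisInt} (he : e.norm = 1) {b j : ℤ} (hj : j = 0 ∨ j = b) :
    rhomb (e * z) b j = rhomb z b j := by
  have hs : e * star e = 1 := by rw [mul_star_eq, he]; simp
  ext w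
  rcases hj with rfl | rfl
  · rw [mem_rhomb_zero, mem_rhomb_zero]
    constructor
    · rintro ⟨r, rfl⟩; exact ⟨e * r, by ring⟩
    · rintro ⟨r, rfl⟩; exact ⟨star e * r, by linear_combination (-(b : EisInt) * z * r) * hs⟩
  · rw [mem_rhomb_self, mem_rhomb_self]
    constructor
    · rintro ⟨r, rfl⟩; exact ⟨e * r, by ring⟩
    · rintro ⟨r, rfl⟩
      exact ⟨star e * r, by linear_combination (-(j : EisInt) * theta * z * r) * hs⟩

theorem eq_of_principal_eq {y y' : EisInt} (hy : y.IsPrim) (hy' : y'.IsPrim) {b b' : ℤ}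
    (hb : 0 < b) (hb' : 0 < b')
    (h : ∀ w : EisInt, (∃ r, w = (b : EisInt) * y * r) ↔ ∃ r, w = (b' : EisInt) * y' * r) :
    b = b' ∧ ∃ e : EisInt, e.norm = 1 ∧ y' = e * y := by
  obtain ⟨r, hr⟩ := (h (b * y)).1 ⟨1, by simp⟩
  obtain ⟨r', hr'⟩ := (h (b' * y')).2 ⟨1, by simp⟩
  have hby : (b : EisInt) * y ≠ 0 := mul_ne_zero (Int.cast_ne_zero.2 hb.ne') hy.ne_zero
  have h1 : r' * r = 1 := mul_left_cancel₀ hby (by rw [mul_one, ← mul_assoc, ← hr', ← hr])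
  have h2 : r'.norm = 1 := by
    have e := congrArg QuadraticAlgebra.norm h1
    rw [map_mul, QuadraticAlgebra.norm_one] at e
    have := norm_nonneg r'
    rcases Int.mul_eq_one_iff_eq_one_or_neg_one.1 e with h | h <;> omega
  have h3 := (hy.unit_mul h2).eq_or_neg hy' hb' (Or.inl hb)
    (show (b' : EisInt) * y' = b * (r' * y) by rw [hr']; ring)
  refine ⟨by rw [h3.1, abs_of_pos hb], ?_⟩
  rcases h3.2 with h | h
  · exact ⟨r', h2, h⟩
  · exact ⟨-r', by rw [QuadraticAlgebra.norm_neg, h2], by rw [h]; ring⟩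

theorem not_three_dvd_unit_mul {z e : EisInt} (he : e.norm = 1) (h : ¬ (3 : ℤ) ∣ z.norm)
    (w : EisInt) : z ≠ e * (theta * w) := by
  rintro rfl
  rw [map_mul, he, one_mul] at h
  exact h (three_dvd_norm_theta_mul w)

/-- Generators of an ideal differ by a unit. The types `j = 0` and `j = b` cannot coincide, since
`3` divides the norm of `theta * z` but not that of `z`. -/
theorem eq_of_rhomb_eq_hex {z z' : EisInt} (hz : z.IsPrim) (hz' : z'.IsPrim)
    (h3 : ¬ (3 : ℤ) ∣ z.norm) (h3' : ¬ (3 : ℤ) ∣ z'.norm) {b j b' j' : ℤ} (hb : 0 < b)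
    (hb' : 0 < b') (hj : j = 0 ∨ j = b) (hj' : j' = 0 ∨ j' = b')
    (h : rhomb z b j = rhomb z' b' j') :
    b = b' ∧ j = j' ∧ ∃ e : EisInt, e.norm = 1 ∧ z' = e * z := by
  have ht : theta ≠ 0 := by rw [Ne, ← norm_eq_zero, norm_theta]; norm_num
  rcases hj with rfl | rfl <;> rcases hj' with rfl | rfl
  · obtain ⟨h1, h2⟩ := eq_of_principal_eq hz hz' hb hb'
      (fun w => by rw [← mem_rhomb_zero, ← mem_rhomb_zero, h])
    exact ⟨h1, rfl, h2⟩
  · obtain ⟨-, e, he, h2⟩ := eq_of_principal_eq (hz'.theta_mul h3') hz hb' hb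
      (fun w => by rw [← mem_rhomb_self, ← mem_rhomb_zero, h])
    exact absurd h2 (not_three_dvd_unit_mul he h3 z')
  · obtain ⟨-, e, he, h2⟩ := eq_of_principal_eq (hz.theta_mul h3) hz' hb hb'
      (fun w => by rw [← mem_rhomb_self, ← mem_rhomb_zero, h])
    exact absurd h2 (not_three_dvd_unit_mul he h3' z)
  · obtain ⟨h1, e, he, h2⟩ := eq_of_principal_eq (hz.theta_mul h3) (hz'.theta_mul h3') hb hb'
      (fun w => by rw [← mem_rhomb_self, ← mem_rhomb_self, h])
    exact ⟨h1, h1, e, he, mul_left_cancel₀ ht (by rw [h2]; ring)⟩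

theorem diag_add (z : EisInt) (b j : ℤ) :
    z * ⟨j, b⟩ + z * ⟨j + b, -b⟩ = ((2 * j + b : ℤ) : EisInt) * z := by
  ext <;> simp only [QuadraticAlgebra.re_mul, QuadraticAlgebra.im_mul, QuadraticAlgebra.re_add,
    QuadraticAlgebra.im_add, QuadraticAlgebra.re_intCast, QuadraticAlgebra.im_intCast,
    Int.cast_id] <;> ring

theorem diag_sub (z : EisInt) (b j : ℤ) :
    z * ⟨j, b⟩ - z * ⟨j + b, -b⟩ = (b : EisInt) * (theta * z) := by
  ext <;> simp [theta] <;> ring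

/-- With only the four minimal vectors `±u`, `±v`, the pair of diagonals is determined up to signs
and order. Exchanging the diagonals would make `z'` equal to `±theta z`, of norm divisible by `3`;
so each diagonal is matched with its own counterpart, and primitivity recovers the parameters. -/
theorem eq_of_rhomb_eq {z z' : EisInt} (hz : z.IsPrim) (hz' : z'.IsPrim)
    (h3 : ¬ (3 : ℤ) ∣ z.norm) (h3' : ¬ (3 : ℤ) ∣ z'.norm) {b j b' j' : ℤ} (hj : 0 < j)
    (hjb : j < b) (hb' : 0 < b') (hj' : 0 ≤ j') (hjb' : j' ≤ b')
    (h : rhomb z b j = rhomb z' b' j') : b = b' ∧ j = j' ∧ (z' = z ∨ z' = -z) := by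
  have ht : theta ≠ 0 := by rw [Ne, ← norm_eq_zero, norm_theta]; norm_num
  have h1 := eq_of_isMin_rhomb hz.ne_zero hj hjb (h ▸ isMin_rhomb_left hz'.ne_zero hb' hj' hjb')
  have h2 := eq_of_isMin_rhomb hz.ne_zero hj hjb (h ▸ isMin_rhomb_right hz'.ne_zero hb' hj' hjb')
  have a1 := diag_add z b j
  have a2 := diag_sub z b j
  have a1' := diag_add z' b' j'
  have a2' := diag_sub z' b' j'
  set u := z * ⟨j, b⟩
  set v := z * ⟨j + b, -b⟩
  set u' := z' * ⟨j', b'⟩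
  set v' := z' * ⟨j' + b', -b'⟩
  have key : (u' + v' = u + v ∧ (u' - v' = u - v ∨ u' - v' = -(u - v))) ∨
      (u' + v' = -(u + v) ∧ (u' - v' = u - v ∨ u' - v' = -(u - v))) ∨
      u' + v' = u - v ∨ u' + v' = -(u - v) := by
    -- Neither diagonal vanishes, which discards the combinations with `u' = ±v'`.
    have n1 : u' + v' ≠ 0 := by
      rw [a1']
      exact mul_ne_zero (Int.cast_ne_zero.2 (by omega)) hz'.ne_zero
    have n2 : u' - v' ≠ 0 := by
      rw [a2']
      exact mul_ne_zero (Int.cast_ne_zero.2 (by omega)) (mul_ne_zero ht hz'.ne_zero)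
    rcases h1 with h1 | h1 | h1 | h1 <;> rcases h2 with h2 | h2 | h2 | h2 <;>
      rw [h1, h2] at n1 n2 ⊢ <;>
      first
        | exact absurd (by ring1) n1
        | exact absurd (by ring1) n2
        | exact Or.inl ⟨by ring1, Or.inl (by ring1)⟩
        | exact Or.inl ⟨by ring1, Or.inr (by ring1)⟩
        | exact Or.inr (Or.inl ⟨by ring1, Or.inl (by ring1)⟩)
        | exact Or.inr (Or.inl ⟨by ring1, Or.inr (by ring1)⟩)
        | exact Or.inr (Or.inr (Or.inl (by ring1)))
        | exact Or.inr (Or.inr (Or.inr (by ring1)))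
  have hb0 : 0 < b := by omega
  have hsub : (u' - v' = u - v ∨ u' - v' = -(u - v)) → b = b' := by
    rw [a2, a2']
    rintro (h | h)
    · have := ((hz.theta_mul h3).eq_or_neg (hz'.theta_mul h3') hb' (Or.inl hb0) h).1
      rw [this, abs_of_pos hb0]
    · have := ((hz.theta_mul h3).eq_or_neg (hz'.theta_mul h3') hb' (b := -b) (Or.inr (by omega))
        (by rw [h]; push_cast; ring)).1
      rw [this, abs_neg, abs_of_pos hb0]
  have hcross : ∀ c : ℤ, 0 < c ∨ c < 0 → u' + v' ≠ (c : EisInt) * (theta * z) := by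
    intro c hc h
    rw [a1'] at h
    rcases ((hz.theta_mul h3).eq_or_neg hz' (by omega) hc h).2 with h | h
    · exact not_three_dvd_unit_mul (e := 1) (by simp) h3' z (by rw [h]; ring)
    · exact not_three_dvd_unit_mul (e := -1) (by simp) h3' z (by rw [h]; ring)
  rcases key with ⟨k1, k2⟩ | ⟨k1, k2⟩ | k | k
  · have hbb := hsub k2
    rw [a1, a1'] at k1
    have := hz.eq_or_neg hz' (by omega) (Or.inl (by omega)) k1
    rw [abs_of_pos (by omega)] at this
    exact ⟨hbb, by omega, this.2⟩
  · have hbb := hsub k2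
    rw [a1, a1'] at k1
    have := hz.eq_or_neg hz' (a := 2 * j' + b') (b := -(2 * j + b)) (by omega) (Or.inr (by omega))
      (by rw [k1]; push_cast; ring)
    rw [abs_neg, abs_of_pos (by omega)] at this
    exact ⟨hbb, by omega, this.2⟩
  · exact absurd (k.trans a2) (hcross b (Or.inl hb0))
  · exact absurd (k.trans (by rw [a2]; push_cast; ring)) (hcross (-b) (Or.inr (by omega)))

/-- Two orthogonal vectors are multiples of `z` and `√-3 z` in some order. -/
theorem exists_axes {w₁ w₂ : EisInt} (h1 : w₁ ≠ 0)
    (h : 2 * w₁.re * w₂.re + w₁.re * w₂.im + w₁.im * w₂.re + 2 * w₁.im * w₂.im = 0) :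
    ∃ (z : EisInt) (a b : ℤ), z.IsPrim ∧ ¬ (3 : ℤ) ∣ z.norm ∧
      ((w₁ = (a : EisInt) * z ∧ w₂ = (b : EisInt) * (theta * z)) ∨
        (w₂ = (a : EisInt) * z ∧ w₁ = (b : EisInt) * (theta * z))) := by
  obtain ⟨a, z₁, ha, hz₁, rfl⟩ := exists_isPrim h1
  have hn := norm_pos hz₁.ne_zero
  simp only [QuadraticAlgebra.re_mul, QuadraticAlgebra.im_mul, QuadraticAlgebra.re_intCast,
    QuadraticAlgebra.im_intCast] at h
  have h' : 2 * z₁.re * w₂.re + z₁.re * w₂.im + z₁.im * w₂.re + 2 * z₁.im * w₂.im = 0 :=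
    mul_left_cancel₀ ha.ne' (by linear_combination h)
  -- The orthogonal complement of `z₁` is the line of `theta * z₁`; this is the projection formula
  -- with denominators cleared.
  have key : ((2 * z₁.norm : ℤ) : EisInt) * w₂ = ((det z₁ w₂ : ℤ) : EisInt) * (theta * z₁) := by
    rw [norm_eq]
    ext
    · simp only [theta, det, QuadraticAlgebra.re_mul, QuadraticAlgebra.im_mul,
        QuadraticAlgebra.re_intCast, QuadraticAlgebra.im_intCast, Int.cast_id]
      linear_combination z₁.re * h'
    · simp only [theta, det, QuadraticAlgebra.re_mul, QuadraticAlgebra.im_mul,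
        QuadraticAlgebra.re_intCast, QuadraticAlgebra.im_intCast, Int.cast_id]
      linear_combination z₁.im * h'
  -- If `3 ∣ N(z₁)` then `z₁ = theta z₂` and the two axes exchange roles. A second factor `theta`
  -- would make the primitive `z₁` divisible by `3`.
  by_cases h3 : (3 : ℤ) ∣ z₁.norm
  · obtain ⟨z₂, rfl⟩ := theta_dvd h3
    have hz₂ : z₂.IsPrim := hz₁.of_dvd ⟨theta, rfl⟩
    have h3' : ¬ (3 : ℤ) ∣ z₂.norm := by
      intro hd
      obtain ⟨z₃, rfl⟩ := theta_dvd hd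
      have := hz₁.dvd_of_mul (A := 3) (t := 1) (w := -z₃)
        (by rw [← mul_assoc theta theta, theta_sq]; push_cast; ring)
      omega
    rw [← mul_assoc theta theta, theta_sq] at key
    obtain ⟨c, hc⟩ := hz₂.exists_mul (A := 2 * (theta * z₂).norm)
      (t := det (theta * z₂) w₂ * (-3)) (by omega) (by rw [key]; push_cast; ring)
    exact ⟨z₂, c, a, hz₂, h3', Or.inr ⟨hc, rfl⟩⟩
  · obtain ⟨c, hc⟩ := (hz₁.theta_mul h3).exists_mul (by omega) key
    exact ⟨z₁, a, c, hz₁, h3, Or.inl ⟨rfl, hc⟩⟩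

theorem IsMin.neg {N : AddSubgroup EisInt} {u : EisInt} (h : IsMin N u) : IsMin N (-u) :=
  ⟨N.neg_mem h.1, neg_ne_zero.2 h.2.1, by rw [QuadraticAlgebra.norm_neg]; exact h.2.2⟩

/-- A subgroup with two independent elements of minimal norm is rhombic. -/
theorem exists_rhomb_of_axes {N : AddSubgroup EisInt} {u v z : EisInt} (hu : IsMin N u)
    (hv : IsMin N v) (h : det u v ≠ 0) (hz : z.IsPrim) {a b : ℤ}
    (h1 : u + v = (a : EisInt) * z) (h2 : u - v = (b : EisInt) * (theta * z)) :
    ∃ b' j' : ℤ, 0 < b' ∧ 0 ≤ j' ∧ j' ≤ b' ∧ N = rhomb z b' j' := by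
  have e1 := congrArg QuadraticAlgebra.re h1
  have e2 := congrArg QuadraticAlgebra.im h1
  have e3 := congrArg QuadraticAlgebra.re h2
  have e4 := congrArg QuadraticAlgebra.im h2
  simp [theta] at e1 e2 e3 e4
  have hn := norm_pos hz.ne_zero
  have hadd : u + v ≠ 0 := by
    intro h0
    obtain rfl : v = -u := by linear_combination h0
    apply h; simp [det]; ring
  have hsub : u - v ≠ 0 := by
    intro h0
    obtain rfl : v = u := by linear_combination -h0
    apply h; simp [det]; ring
  have ha : a ≠ 0 := by rintro rfl; apply hadd; rw [h1]; simp
  have hb : b ≠ 0 := by rintro rfl; apply hsub; rw [h2]; simp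
  -- Since `theta = 2ω - 1`, one has `2u = (a - b + 2bω) z`; hence `2` divides `(a - b) z` with `z`
  -- primitive.
  obtain ⟨j, hj⟩ : (2 : ℤ) ∣ a - b := by
    obtain ⟨x, y, hxy⟩ := hz
    exact ⟨x * (u.re + b * z.im) + y * (u.im - b * z.re - b * z.im), by
      linear_combination (-(a - b)) * hxy + x * (-(e1 + e3)) + y * (-(e2 + e4))⟩
  have hu' : u = z * ⟨j, b⟩ := by
    ext
    · simp; apply mul_left_cancel₀ (two_ne_zero (α := ℤ))
      linear_combination e1 + e3 + z.re * hj
    · simp; apply mul_left_cancel₀ (two_ne_zero (α := ℤ))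
      linear_combination e2 + e4 + z.im * hj
  have hv' : v = z * ⟨j + b, -b⟩ := by
    ext
    · simp; apply mul_left_cancel₀ (two_ne_zero (α := ℤ))
      linear_combination e1 - e3 + z.re * hj
    · simp; apply mul_left_cancel₀ (two_ne_zero (α := ℤ))
      linear_combination e2 - e4 + z.im * hj
  have hnu : u.norm = (j ^ 2 + j * b + b ^ 2) * z.norm := by
    rw [hu', map_mul, norm_eq ⟨j, b⟩]; ring
  have i1 := hu.2.2 _ (N.add_mem hu.1 hv.1) hadd
  have i2 := hu.2.2 _ (N.sub_mem hu.1 hv.1) hsub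
  rw [h1, map_mul, hnu, QuadraticAlgebra.norm_intCast] at i1
  rw [h2, map_mul, map_mul, norm_theta, hnu, QuadraticAlgebra.norm_intCast] at i2
  have i1' := le_of_mul_le_mul_right i1 hn
  have i2' : j ^ 2 + j * b + b ^ 2 ≤ b ^ 2 * 3 :=
    le_of_mul_le_mul_right (by rw [mul_assoc (b ^ 2)]; exact i2) hn
  obtain rfl : a = 2 * j + b := by omega
  have hN := eq_closure_of_isMin hu hv h
  rw [Int.cast_id] at i1'
  -- The diagonals are not shorter than `u`: `N(u) ≤ N(u + v)` gives this inequality and `N(u) ≤ N(u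
  -- - v)` the next one.
  have c1 : 0 ≤ j * (j + b) := by nlinarith
  have c2 : (j - b) * (j + 2 * b) ≤ 0 := by nlinarith
  -- Reversing the diagonal `u - v` swaps `u` and `v`; reversing `u + v` swaps and negates them.
  -- According to the signs of `b` and `2j + b`, the normalised pair is `(-b, j + b)`, `(-b, -j)`,
  -- `(b, j)` or `(b, -j - b)`.
  rcases lt_or_gt_of_ne hb with hb | hb
  · rcases lt_or_ge 0 (2 * j + b) with hp | hp
    · have k1 : 0 ≤ j + b := nonneg_of_mul_nonneg_right c1 (by omega)
      have k2 : j + 2 * b ≤ 0 := by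
        by_contra! hc; nlinarith [mul_pos (show 0 < j - b by omega) hc]
      refine ⟨-b, j + b, by omega, k1, by omega, ?_⟩
      rw [hN, hu', hv', rhomb, Set.pair_comm]; simp
    · have hp' : 2 * j + b < 0 := lt_of_le_of_ne hp ha
      have k1 : j ≤ 0 := by
        by_contra! hc; nlinarith [mul_pos hc (show 0 < -(j + b) by omega)]
      have k2 : b ≤ j := by
        by_contra! hc; nlinarith [mul_pos (sub_pos.2 hc) (show 0 < -(j + 2 * b) by omega)]
      refine ⟨-b, -j, by omega, by omega, by omega, ?_⟩
      rw [hN, hu', hv', ← rhomb_neg, rhomb]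
      congr 2
      · ext <;> simp <;> ring
      · congr 1; ext <;> simp <;> ring
  · rcases lt_or_ge 0 (2 * j + b) with hp | hp
    · have k1 : 0 ≤ j := nonneg_of_mul_nonneg_left c1 (by omega)
      have k2 : j ≤ b := by
        by_contra! hc; nlinarith [mul_pos (sub_pos.2 hc) (show 0 < j + 2 * b by omega)]
      exact ⟨b, j, hb, k1, k2, by rw [hN, hu', hv', rhomb]⟩
    · have hp' : 2 * j + b < 0 := lt_of_le_of_ne hp ha
      have k1 : j + b ≤ 0 := by
        by_contra! hc; nlinarith [mul_pos hc (show 0 < -j by omega)]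
      have k2 : 0 ≤ j + 2 * b := by
        by_contra! hc; nlinarith [mul_pos (neg_pos.2 hc) (show 0 < -(j - b) by omega)]
      refine ⟨b, -j - b, by omega, by omega, by omega, ?_⟩
      rw [hN, hu', hv', ← rhomb_neg, rhomb, Set.pair_comm]
      congr 2
      · ext <;> simp <;> ring
      · congr 1; ext <;> simp <;> ring

theorem exists_rhomb {N : AddSubgroup EisInt} {u v : EisInt} (hu : IsMin N u)
    (hv : IsMin N v) (h : det u v ≠ 0) : ∃ (z : EisInt) (b j : ℤ), z.IsPrim ∧
      ¬ (3 : ℤ) ∣ z.norm ∧ 0 < b ∧ 0 ≤ j ∧ j ≤ b ∧ N = rhomb z b j := by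
  have hn : u.norm = v.norm := le_antisymm (hu.2.2 v hv.1 hv.2.1) (hv.2.2 u hu.1 hu.2.1)
  have hadd : u + v ≠ 0 := by
    intro h0
    obtain rfl : v = -u := by linear_combination h0
    apply h; simp [det]; ring
  have hsub : u - v ≠ 0 := by
    intro h0
    obtain rfl : v = u := by linear_combination -h0
    apply h; simp [det]; ring
  rw [norm_eq, norm_eq] at hn
  obtain ⟨z, a, b, hz, h3, (⟨h1, h2⟩ | ⟨h1, h2⟩)⟩ := exists_axes (w₁ := u + v)
    (w₂ := u - v) hadd (by simp; linear_combination 2 * hn)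
  · obtain ⟨b', j', h⟩ := exists_rhomb_of_axes hu hv h hz h1 h2
    exact ⟨z, b', j', hz, h3, h⟩
  · have hd : det u (-v) ≠ 0 := by
      intro h0; apply h; simp [det] at *; linear_combination -h0
    obtain ⟨b', j', h⟩ := exists_rhomb_of_axes hu hv.neg hd hz
      (by rw [← sub_eq_add_neg]; exact h1) (by rw [sub_neg_eq_add]; exact h2)
    exact ⟨z, b', j', hz, h3, h⟩

end EisInt

/-! ### Counting the parameters. -/

namespace EisInt

theorem finite_norm_eq (k : ℤ) : {z : EisInt | z.norm = k}.Finite := by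
  have h : ((Finset.Icc (-(k + 1)) (k + 1) ×ˢ Finset.Icc (-(k + 1)) (k + 1)).image
      (fun p : ℤ × ℤ => (⟨p.1, p.2⟩ : EisInt)) : Set EisInt).Finite := Finset.finite_toSet _
  refine h.subset fun z hz => ?_
  simp only [Set.mem_ofPred_eq, norm_eq] at hz
  simp only [Finset.coe_image, Set.mem_image, Finset.mem_coe, Finset.mem_product, Finset.mem_Icc]
  exact ⟨(z.re, z.im), ⟨⟨by nlinarith [sq_nonneg (z.re + 2 * z.im)],
    by nlinarith [sq_nonneg (z.re + 2 * z.im)]⟩, by nlinarith [sq_nonneg (2 * z.re + z.im)],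
    by nlinarith [sq_nonneg (2 * z.re + z.im)]⟩, rfl⟩

/-- Grouping triples `(z, b, j)` by the norm of `z`. -/
theorem ncard_triples (S : Set EisInt) (R : ℕ × ℕ → Prop) (Q : ℕ → Finset (ℕ × ℕ))
    (hQ : ∀ m q, q ∈ Q m ↔ R q ∧ q.1 * (2 * q.2 + q.1) = m) {n : ℕ} (hn : n ≠ 0) :
    {x : EisInt × ℕ × ℕ | x.1 ∈ S ∧ R x.2 ∧
      ((x.2.1 * (2 * x.2.2 + x.2.1) : ℕ) : ℤ) * x.1.norm = n}.Finite ∧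
    {x : EisInt × ℕ × ℕ | x.1 ∈ S ∧ R x.2 ∧
      ((x.2.1 * (2 * x.2.2 + x.2.1) : ℕ) : ℤ) * x.1.norm = n}.ncard =
    ∑ p ∈ n.divisorsAntidiagonal, {z : EisInt | z ∈ S ∧ z.norm = p.1}.ncard * (Q p.2).card := by
  have hfin : ∀ k : ℕ, {z : EisInt | z ∈ S ∧ z.norm = k}.Finite := fun k =>
    (finite_norm_eq k).subset fun z hz => hz.2
  classical
  let F : Finset (EisInt × ℕ × ℕ) :=
    n.divisorsAntidiagonal.biUnion fun p => (hfin p.1).toFinset ×ˢ Q p.2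
  have hF : {x : EisInt × ℕ × ℕ | x.1 ∈ S ∧ R x.2 ∧
      ((x.2.1 * (2 * x.2.2 + x.2.1) : ℕ) : ℤ) * x.1.norm = n} = F := by
    ext ⟨z, q⟩
    simp only [F, Set.mem_ofPred_eq, Finset.coe_biUnion, Set.mem_iUnion, Finset.mem_coe,
      Finset.mem_product, Set.Finite.mem_toFinset, hQ, Nat.mem_divisorsAntidiagonal]
    constructor
    · rintro ⟨h1, h2, h3⟩
      obtain ⟨k, hk⟩ := Int.eq_ofNat_of_zero_le (norm_nonneg z)
      rw [hk] at h3
      exact ⟨(k, _), ⟨by rw [mul_comm]; exact_mod_cast h3, hn⟩, ⟨h1, hk⟩, h2, rfl⟩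
    · rintro ⟨p, ⟨h1, -⟩, ⟨h2, h3⟩, h4, h5⟩
      refine ⟨h2, h4, ?_⟩
      rw [h3, h5, ← h1]; push_cast; ring
  rw [hF]
  refine ⟨F.finite_toSet, ?_⟩
  rw [Set.ncard_coe_finset, Finset.card_biUnion]
  · refine Finset.sum_congr rfl fun p _ => ?_
    rw [Finset.card_product, Set.ncard_eq_toFinset_card _ (hfin p.1)]
  · intro p _ p' _ hne
    rw [Function.onFun, Finset.disjoint_left]
    rintro ⟨z, q⟩ h1 h2
    simp only [Finset.mem_product, Set.Finite.mem_toFinset, Set.mem_ofPred_eq, hQ] at h1 h2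
    apply hne
    ext
    · exact_mod_cast h1.1.2.symm.trans h2.1.2
    · exact h1.2.2.symm.trans h2.2.2

/-- The half-plane is the disjoint union of the sector and its images under `ω` and `ω ^ 2 = ω - 1`,
and `P` is stable under units. -/
theorem ncard_half (P : EisInt → Prop) (hP : ∀ e z : EisInt, e.norm = 1 → P z → P (e * z))
    (k : ℕ) : {z : EisInt | (P z ∧ z.InHalf) ∧ z.norm = k}.ncard =
      3 * {z : EisInt | (P z ∧ z.InSector) ∧ z.norm = k}.ncard := by
  set A := {z : EisInt | (P z ∧ z.InSector) ∧ z.norm = k} with hA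
  have hAfin : A.Finite := (finite_norm_eq k).subset fun z hz => hz.2
  have hinj : ∀ e : EisInt, e.norm = 1 → Function.Injective fun z => e * z := by
    intro e he z w h
    exact mul_left_cancel₀ (by rintro rfl; simp at he) h
  have key : {z : EisInt | (P z ∧ z.InHalf) ∧ z.norm = k} =
      (A ∪ (fun z => (⟨0, 1⟩ : EisInt) * z) '' A) ∪ (fun z => (⟨-1, 1⟩ : EisInt) * z) '' A := by
    ext z
    constructor
    · rintro ⟨⟨h1, h2⟩, h3⟩
      have back : ∀ e e' : EisInt, e'.norm = 1 → e * e' = 1 → (e' * z).InSector →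
          ∃ w ∈ A, e * w = z := by
        intro e e' he' hee hs
        exact ⟨e' * z, ⟨⟨hP _ _ he' h1, hs⟩, by rw [map_mul, he', h3, one_mul]⟩,
          by rw [← mul_assoc, hee, one_mul]⟩
      by_cases c1 : z.InSector
      · exact Or.inl (Or.inl ⟨⟨h1, c1⟩, h3⟩)
      by_cases c2 : InSector ((⟨1, -1⟩ : EisInt) * z)
      · exact Or.inl (Or.inr (back ⟨0, 1⟩ ⟨1, -1⟩ (by simp [norm_eq])
          (by ext <;> simp [QuadraticAlgebra.re_one, QuadraticAlgebra.im_one]) c2))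
      · refine Or.inr (back ⟨-1, 1⟩ ⟨0, -1⟩ (by simp [norm_eq])
          (by ext <;> simp [QuadraticAlgebra.re_one, QuadraticAlgebra.im_one]) ?_)
        simp [InSector, InHalf] at *
        omega
    · rintro ((⟨⟨h1, h2⟩, h3⟩ | ⟨z, ⟨⟨h1, h2⟩, h3⟩, rfl⟩) | ⟨z, ⟨⟨h1, h2⟩, h3⟩, rfl⟩)
      · refine ⟨⟨h1, ?_⟩, h3⟩
        simp [InSector, InHalf] at *; omega
      · refine ⟨⟨hP _ _ (by simp [norm_eq]) h1, ?_⟩, ?_⟩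
        · simp [InSector, InHalf] at *; omega
        · rw [map_mul, h3]; simp [norm_eq]
      · refine ⟨⟨hP _ _ (by simp [norm_eq]) h1, ?_⟩, ?_⟩
        · simp [InSector, InHalf] at *; omega
        · rw [map_mul, h3]; simp [norm_eq]
  rw [key, Set.ncard_union_eq _ (hAfin.union (hAfin.image _)) (hAfin.image _),
    Set.ncard_union_eq _ hAfin (hAfin.image _), Set.ncard_image_of_injective _ (hinj _ ?_),
    Set.ncard_image_of_injective _ (hinj _ ?_)]
  · ring
  · simp [norm_eq]
  · simp [norm_eq]
  · rw [Set.disjoint_left]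
    rintro _ ⟨⟨-, h2⟩, -⟩ ⟨z, ⟨⟨-, h2'⟩, -⟩, rfl⟩
    simp [InSector] at *; omega
  · rw [Set.disjoint_left]
    rintro _ (⟨⟨-, h2⟩, -⟩ | ⟨w, ⟨⟨-, h2⟩, -⟩, rfl⟩) ⟨z, ⟨⟨-, h2'⟩, -⟩, h⟩
    · subst h
      simp [InSector] at *; omega
    · have e1 := congrArg QuadraticAlgebra.re h
      have e2 := congrArg QuadraticAlgebra.im h
      simp [InSector] at *; omega

end EisInt

/-- The number of primitive ideals of `ℤ[ρ]` of norm `k` prime to `3`, given as a number of roots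
of `t ^ 2 - t + 1` modulo `k`. -/
noncomputable def primCount (k : ℕ) : ℕ :=
  if 3 ∣ k then 0 else Nat.card {t : ZMod k // t ^ 2 - t + 1 = 0}

/-- Parameters of non-hexagonal rhombic lattices. -/
def rhombPairs (m : ℕ) : Finset (ℕ × ℕ) :=
  (Finset.range (m + 1) ×ˢ Finset.range (m + 1)).filter fun q =>
    (0 < q.2 ∧ q.2 < q.1) ∧ q.1 * (2 * q.2 + q.1) = m

/-- Parameters of hexagonal lattices. -/
def hexPairs (m : ℕ) : Finset (ℕ × ℕ) :=
  (Finset.range (m + 1) ×ˢ Finset.range (m + 1)).filter fun q =>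
    (0 < q.1 ∧ (q.2 = 0 ∨ q.2 = q.1)) ∧ q.1 * (2 * q.2 + q.1) = m

/-- The weighted number of shapes of rhombic lattices. -/
def shapeCount (m : ℕ) : ℕ := 3 * (rhombPairs m).card + (hexPairs m).card

theorem mem_rhombPairs {m : ℕ} {q : ℕ × ℕ} :
    q ∈ rhombPairs m ↔ (0 < q.2 ∧ q.2 < q.1) ∧ q.1 * (2 * q.2 + q.1) = m := by
  rw [rhombPairs, Finset.mem_filter, Finset.mem_product, Finset.mem_range, Finset.mem_range]
  refine ⟨fun h => h.2, fun h => ⟨⟨?_, ?_⟩, h⟩⟩ <;> nlinarith [h.1.1, h.1.2, h.2]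

theorem mem_hexPairs {m : ℕ} {q : ℕ × ℕ} :
    q ∈ hexPairs m ↔ (0 < q.1 ∧ (q.2 = 0 ∨ q.2 = q.1)) ∧ q.1 * (2 * q.2 + q.1) = m := by
  rw [hexPairs, Finset.mem_filter, Finset.mem_product, Finset.mem_range, Finset.mem_range]
  refine ⟨fun h => h.2, fun h => ⟨⟨?_, ?_⟩, h⟩⟩ <;>
    rcases h with ⟨⟨h1, h2 | h2⟩, h3⟩ <;> rw [h2] at * <;> nlinarith

namespace EisInt

/-- Subgroups of index `n` with two independent elements of minimal norm. -/
def wellRounded (n : ℕ) : Set (AddSubgroup EisInt) :=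
  {N | N.index = n ∧ ∃ u v, IsMin N u ∧ IsMin N v ∧ det u v ≠ 0}

/-- Normal forms of the parameters of well-rounded subgroups. -/
def params (n : ℕ) : Set (EisInt × ℕ × ℕ) :=
  {x | x.1 ∈ {z : EisInt | (z.IsPrim ∧ ¬ (3 : ℤ) ∣ z.norm) ∧ z.InHalf} ∧
      (0 < x.2.2 ∧ x.2.2 < x.2.1) ∧ ((x.2.1 * (2 * x.2.2 + x.2.1) : ℕ) : ℤ) * x.1.norm = n} ∪
  {x | x.1 ∈ {z : EisInt | (z.IsPrim ∧ ¬ (3 : ℤ) ∣ z.norm) ∧ z.InSector} ∧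
      (0 < x.2.1 ∧ (x.2.2 = 0 ∨ x.2.2 = x.2.1)) ∧
      ((x.2.1 * (2 * x.2.2 + x.2.1) : ℕ) : ℤ) * x.1.norm = n}

/-- The classification. In the strict range `z` matters up to sign, so the half-plane selects one
representative; in the hexagonal cases it matters up to units, so the sector does. -/
theorem bijOn_params (n : ℕ) :
    Set.BijOn (fun x : EisInt × ℕ × ℕ => rhomb x.1 x.2.1 x.2.2) (params n) (wellRounded n) := by
  have main : ∀ x ∈ params n, x.1.IsPrim ∧ ¬ (3 : ℤ) ∣ x.1.norm ∧ 0 < x.2.1 ∧ x.2.2 ≤ x.2.1 ∧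
      ((x.2.1 * (2 * x.2.2 + x.2.1) : ℕ) : ℤ) * x.1.norm = n := by
    rintro ⟨z, b, j⟩ (⟨⟨⟨h1, h2⟩, -⟩, h3, h4⟩ | ⟨⟨⟨h1, h2⟩, -⟩, h3, h4⟩)
    · exact ⟨h1, h2, by simp at h3 ⊢; omega, by simp at h3 ⊢; omega, h4⟩
    · exact ⟨h1, h2, by simp at h3 ⊢; omega, by simp at h3 ⊢; omega, h4⟩
  refine ⟨?_, ?_, ?_⟩
  · rintro ⟨z, b, j⟩ hx
    obtain ⟨h1, h2, h3, h4, h5⟩ := main _ hx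
    simp only at h1 h2 h3 h4 h5
    have hb : (0 : ℤ) < b := by exact_mod_cast h3
    have hj : (0 : ℤ) ≤ j := by positivity
    have hjb : (j : ℤ) ≤ b := by exact_mod_cast h4
    refine ⟨?_, _, _, isMin_rhomb_left h1.ne_zero hb hj hjb,
      isMin_rhomb_right h1.ne_zero hb hj hjb, ?_⟩
    · have := index_rhomb h1.ne_zero hb hj
      rw [← Nat.cast_inj (R := ℤ), this, ← h5]; push_cast; ring
    · rw [det_rhomb]
      have : 0 < (b : ℤ) * (2 * j + b) * z.norm :=
        mul_pos (mul_pos hb (by omega)) (norm_pos h1.ne_zero)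
      exact neg_ne_zero.2 this.ne'
  · rintro ⟨z, b, j⟩ hx ⟨z', b', j'⟩ hx' heq
    obtain ⟨h1, h2, h3, h4, -⟩ := main _ hx
    obtain ⟨h1', h2', h3', h4', -⟩ := main _ hx'
    simp only at h1 h2 h3 h4 h1' h2' h3' h4' heq
    have gen : ∀ (z z' : EisInt) (b j b' j' : ℕ), (z, b, j) ∈ params n → (z', b', j') ∈ params n →
        z.IsPrim → z'.IsPrim → ¬ (3 : ℤ) ∣ z.norm → ¬ (3 : ℤ) ∣ z'.norm → 0 < b' → j' ≤ b' →
        rhomb z b j = rhomb z' b' j' → 0 < j → j < b → (z, b, j) = (z', b', j') := by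
      intro z z' b j b' j' hx hx' h1 h1' h2 h2' h3 h4 heq hj hjb
      obtain ⟨e1, e2, e3⟩ := eq_of_rhomb_eq h1 h1' h2 h2' (by exact_mod_cast hj)
        (by exact_mod_cast hjb) (by exact_mod_cast h3) (by positivity) (by exact_mod_cast h4) heq
      have e1' : b = b' := by exact_mod_cast e1
      have e2' : j = j' := by exact_mod_cast e2
      subst e1' e2'
      rcases hx with ⟨⟨-, g⟩, -⟩ | ⟨-, g, -⟩
      · rcases hx' with ⟨⟨-, g'⟩, -⟩ | ⟨-, g', -⟩
        · obtain rfl : z' = z := eq_of_inHalf g g' e3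
          rfl
        · simp at g'; omega
      · simp at g; omega
    by_cases c : 0 < j ∧ j < b
    · exact gen z z' b j b' j' hx hx' h1 h1' h2 h2' h3' h4' heq c.1 c.2
    by_cases c' : 0 < j' ∧ j' < b'
    · exact (gen z' z b' j' b j hx' hx h1' h1 h2' h2 h3 h4 heq.symm c'.1 c'.2).symm
    obtain ⟨e1, e2, e, he, e3⟩ := eq_of_rhomb_eq_hex h1 h1' h2 h2' (by exact_mod_cast h3)
      (by exact_mod_cast h3') (by omega) (by omega) heq
    have e1' : b = b' := by exact_mod_cast e1
    have e2' : j = j' := by exact_mod_cast e2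
    subst e1' e2'
    rcases hx with ⟨-, g, -⟩ | ⟨⟨-, g⟩, -⟩
    · exact absurd g c
    · rcases hx' with ⟨-, g', -⟩ | ⟨⟨-, g'⟩, -⟩
      · exact absurd g' c
      · obtain rfl : z' = z := eq_of_inSector_of_eq_mul he g g' e3
        rfl
  · rintro N ⟨hN, u, v, hu, hv, hd⟩
    obtain ⟨z, b, j, hz, h3, hb, hj, hjb, rfl⟩ := exists_rhomb hu hv hd
    have hi := index_rhomb hz.ne_zero hb hj
    rw [hN] at hi
    lift b to ℕ using hb.le
    lift j to ℕ using hj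
    by_cases c : j = 0 ∨ j = b
    · obtain ⟨e, he, hs⟩ := exists_unit_mul_inSector hz.ne_zero
      refine ⟨(e * z, b, j), Or.inr ⟨⟨⟨hz.unit_mul he, ?_⟩, hs⟩, ⟨?_, c⟩, ?_⟩, ?_⟩
      · rw [map_mul, he, one_mul]; exact h3
      · exact_mod_cast hb
      · simp only [map_mul, he, one_mul]; rw [hi]; push_cast; ring
      · exact rhomb_unit_mul he (show (j : ℤ) = 0 ∨ (j : ℤ) = b by omega)
    · have c' : 0 < j ∧ j < b := by omega
      rcases inHalf_or_neg hz.ne_zero with hh | hh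
      · exact ⟨(z, b, j), Or.inl ⟨⟨⟨hz, h3⟩, hh⟩, c', by rw [hi]; push_cast; ring⟩, rfl⟩
      · refine ⟨(-z, b, j), Or.inl ⟨⟨⟨?_, ?_⟩, hh⟩, c', ?_⟩, rhomb_neg z b j⟩
        · simpa using hz.unit_mul (e := -1) (by simp [QuadraticAlgebra.norm_neg])
        · rw [QuadraticAlgebra.norm_neg]; exact h3
        · simp only [QuadraticAlgebra.norm_neg]; rw [hi]; push_cast; ring

theorem ncard_prim_sector {k : ℕ} (hk : 0 < k) :
    {z : EisInt | ((z.IsPrim ∧ ¬ (3 : ℤ) ∣ z.norm) ∧ z.InSector) ∧ z.norm = k}.ncard =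
      primCount k := by
  unfold primCount
  split_ifs with h
  · rw [Set.ncard_eq_zero ((finite_norm_eq k).subset fun z hz => hz.2)]
    ext z
    simp only [Set.mem_ofPred_eq, Set.mem_empty_iff_false, iff_false]
    rintro ⟨⟨⟨-, h1⟩, -⟩, h2⟩
    rw [h2] at h1
    exact h1 (by exact_mod_cast h)
  · rw [← card_sector_eq_card_roots hk]
    congr 1
    ext z
    constructor
    · rintro ⟨⟨⟨h1, -⟩, h2⟩, h3⟩; exact ⟨h1, h2, h3⟩
    · rintro ⟨h1, h2, h3⟩
      refine ⟨⟨⟨h1, ?_⟩, h2⟩, h3⟩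
      rw [h3]; exact_mod_cast h

theorem finite_params {n : ℕ} (hn : n ≠ 0) : (params n).Finite :=
  (ncard_triples _ _ rhombPairs (fun _ _ => mem_rhombPairs) hn).1.union
    (ncard_triples _ _ hexPairs (fun _ _ => mem_hexPairs) hn).1

/-- The weight `3` in `shapeCount` is the ratio of half-plane to sector. -/
theorem ncard_wellRounded {n : ℕ} (hn : n ≠ 0) : (wellRounded n).ncard =
    ∑ p ∈ n.divisorsAntidiagonal, primCount p.1 * shapeCount p.2 := by
  rw [← (bijOn_params n).image_eq, (bijOn_params n).injOn.ncard_image, params,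
    Set.ncard_union_eq ?_ (ncard_triples _ _ rhombPairs (fun _ _ => mem_rhombPairs) hn).1
      (ncard_triples _ _ hexPairs (fun _ _ => mem_hexPairs) hn).1,
    (ncard_triples _ _ rhombPairs (fun _ _ => mem_rhombPairs) hn).2,
    (ncard_triples _ _ hexPairs (fun _ _ => mem_hexPairs) hn).2, ← Finset.sum_add_distrib]
  · refine Finset.sum_congr rfl fun p hp => ?_
    have hk : 0 < p.1 := Nat.pos_of_ne_zero (Nat.left_ne_zero_of_mem_divisorsAntidiagonal hp)
    simp only [Set.mem_ofPred_eq]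
    rw [ncard_half (fun z => z.IsPrim ∧ ¬ (3 : ℤ) ∣ z.norm), ncard_prim_sector hk, shapeCount]
    · ring
    · rintro e z he ⟨h1, h2⟩
      exact ⟨h1.unit_mul he, by rw [map_mul, he, one_mul]; exact h2⟩
  · rw [Set.disjoint_left]
    rintro ⟨z, b, j⟩ ⟨-, h, -⟩ ⟨-, h', -⟩
    simp at h h'
    omega

end EisInt

/-! ### Passage from the Eisenstein integers to sublattices of `ℂ`. -/

theorem eisensteinRho_re : eisensteinRho.re = 1 / 2 := by
  simp [eisensteinRho]

theorem eisensteinRho_im : eisensteinRho.im = Real.sqrt 3 / 2 := by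
  simp [eisensteinRho]

theorem eisensteinRho_mul_self : eisensteinRho * eisensteinRho = eisensteinRho - 1 := by
  have h := Real.mul_self_sqrt (show (0 : ℝ) ≤ 3 by norm_num)
  apply Complex.ext
  · simp [eisensteinRho_re, eisensteinRho_im]; linear_combination -h / 4
  · simp [eisensteinRho_re, eisensteinRho_im]; ring

namespace EisInt

/-- The embedding of the Eisenstein integers in the complex plane. -/
noncomputable def toC : EisInt →ₐ[ℤ] ℂ :=
  QuadraticAlgebra.lift ⟨eisensteinRho, by rw [eisensteinRho_mul_self]; simp; ring⟩

theorem toC_apply (z : EisInt) : toC z = z.re + z.im * eisensteinRho := by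
  simp [toC, QuadraticAlgebra.lift]

theorem toC_re (z : EisInt) : (toC z).re = z.re + z.im / 2 := by
  simp [toC_apply, eisensteinRho_re]; ring

theorem toC_im (z : EisInt) : (toC z).im = z.im * (Real.sqrt 3 / 2) := by
  simp [toC_apply, eisensteinRho_im]

theorem normSq_toC (z : EisInt) : Complex.normSq (toC z) = z.norm := by
  have h := Real.mul_self_sqrt (show (0 : ℝ) ≤ 3 by norm_num)
  rw [Complex.normSq_apply, toC_re, toC_im, norm_eq]
  push_cast
  linear_combination (z.im : ℝ) ^ 2 / 4 * h

theorem norm_toC_le {z w : EisInt} : ‖toC z‖ ≤ ‖toC w‖ ↔ z.norm ≤ w.norm := by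
  rw [← pow_le_pow_iff_left₀ (_root_.norm_nonneg (toC z)) (_root_.norm_nonneg _) two_ne_zero,
    ← Complex.normSq_eq_norm_sq,
    ← Complex.normSq_eq_norm_sq, normSq_toC, normSq_toC, Int.cast_le]

theorem toC_injective : Function.Injective toC := by
  rw [injective_iff_map_eq_zero]
  intro z hz
  rw [← norm_eq_zero]
  have := normSq_toC z
  rw [hz] at this
  simpa using this.symm

theorem map_top_toC : (⊤ : AddSubgroup EisInt).map toC.toRingHom.toAddMonoidHom = hexLattice := by
  ext w
  rw [hexLattice, AddSubgroup.mem_closure_pair]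
  simp only [AddSubgroup.mem_map, AddSubgroup.mem_top, true_and]
  constructor
  · rintro ⟨z, rfl⟩
    exact ⟨z.re, z.im, by simp [toC_apply]⟩
  · rintro ⟨m, n, rfl⟩
    exact ⟨⟨m, n⟩, by simp [toC_apply]⟩

theorem mem_minimalVectors_map {N : AddSubgroup EisInt} {w : ℂ} :
    w ∈ minimalVectors (N.map toC.toRingHom.toAddMonoidHom) ↔ ∃ u, IsMin N u ∧ toC u = w := by
  constructor
  · rintro ⟨⟨u, hu, rfl⟩, h0, h⟩
    refine ⟨u, ⟨hu, fun h' => h0 (by simp [h']), fun v hv hv0 => ?_⟩, rfl⟩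
    exact norm_toC_le.1 (h (toC v) ⟨v, hv, rfl⟩ ((map_ne_zero_iff _ toC_injective).2 hv0))
  · rintro ⟨u, ⟨h1, h2, h3⟩, rfl⟩
    refine ⟨⟨u, h1, rfl⟩, (map_ne_zero_iff _ toC_injective).2 h2, ?_⟩
    rintro _ ⟨v, hv, rfl⟩ hv0
    exact norm_toC_le.2 (h3 v hv fun h' => hv0 (by simp [h']))

theorem det_toC (u v : EisInt) : (toC u).re * (toC v).im - (toC u).im * (toC v).re =
    det u v * (Real.sqrt 3 / 2) := by
  rw [toC_re, toC_re, toC_im, toC_im, det]; push_cast; ring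

theorem isWellRounded_map {N : AddSubgroup EisInt} :
    IsWellRounded (N.map toC.toRingHom.toAddMonoidHom) ↔
      ∃ u v, IsMin N u ∧ IsMin N v ∧ det u v ≠ 0 := by
  have h3 : Real.sqrt 3 / 2 ≠ 0 := by positivity
  constructor
  · intro h
    by_contra! hc
    rw [IsWellRounded] at h
    by_cases hex : ∃ u, IsMin N u
    · obtain ⟨u, hu⟩ := hex
      -- Without an independent pair, all minimal vectors lie in the kernel of the determinant
      -- against `u`. This is a proper subspace, as `i u` is not in it.
      let f : ℂ →ₗ[ℝ] ℝ := (toC u).re • Complex.imLm - (toC u).im • Complex.reLm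
      have hf : ∀ w, f w = (toC u).re * w.im - (toC u).im * w.re := fun w => by simp [f]
      have hle : Submodule.span ℝ (minimalVectors (N.map toC.toRingHom.toAddMonoidHom)) ≤
          LinearMap.ker f := by
        rw [Submodule.span_le]
        intro w hw
        obtain ⟨v, hv, rfl⟩ := mem_minimalVectors_map.1 hw
        rw [SetLike.mem_coe, LinearMap.mem_ker, hf, det_toC, hc u v hu hv]
        simp
      rw [h] at hle
      have h0 : f (Complex.I * toC u) = 0 := hle Submodule.mem_top
      have h1 : f (Complex.I * toC u) = Complex.normSq (toC u) := by
        rw [hf, Complex.normSq_apply]; simp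
      rw [h1, normSq_toC] at h0
      exact hu.2.1 (norm_eq_zero.1 (by exact_mod_cast h0))
    · have : minimalVectors (N.map toC.toRingHom.toAddMonoidHom) = ∅ := by
        rw [Set.eq_empty_iff_forall_notMem]
        intro w hw
        obtain ⟨v, hv, rfl⟩ := mem_minimalVectors_map.1 hw
        exact hex ⟨v, hv⟩
      rw [this, Submodule.span_empty] at h
      exact bot_ne_top h
  · rintro ⟨u, v, hu, hv, hd⟩
    rw [IsWellRounded, eq_top_iff]
    intro w _
    have hD : (toC u).re * (toC v).im - (toC u).im * (toC v).re ≠ 0 := by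
      rw [det_toC]; exact mul_ne_zero (by exact_mod_cast hd) h3
    have hw : w = (((w.re * (toC v).im - w.im * (toC v).re) /
        ((toC u).re * (toC v).im - (toC u).im * (toC v).re) : ℝ)) • toC u +
        (((w.im * (toC u).re - w.re * (toC u).im) /
        ((toC u).re * (toC v).im - (toC u).im * (toC v).re) : ℝ)) • toC v := by
      apply Complex.ext
      · rw [Complex.add_re, Complex.smul_re, Complex.smul_re]; simp only [smul_eq_mul]
        rw [div_mul_eq_mul_div, div_mul_eq_mul_div, ← add_div, eq_div_iff hD]; ring
      · rw [Complex.add_im, Complex.smul_im, Complex.smul_im]; simp only [smul_eq_mul]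
        rw [div_mul_eq_mul_div, div_mul_eq_mul_div, ← add_div, eq_div_iff hD]; ring
    rw [hw]
    exact Submodule.add_mem _
      (Submodule.smul_mem _ _ (Submodule.subset_span (mem_minimalVectors_map.2 ⟨u, hu, rfl⟩)))
      (Submodule.smul_mem _ _ (Submodule.subset_span (mem_minimalVectors_map.2 ⟨v, hv, rfl⟩)))

theorem wrSublattices_eq (n : ℕ) :
    wrSublattices n = (AddSubgroup.map toC.toRingHom.toAddMonoidHom) '' wellRounded n := by
  have hinj : Function.Injective toC.toRingHom.toAddMonoidHom := toC_injective
  have hidx : ∀ N : AddSubgroup EisInt,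
      (N.map toC.toRingHom.toAddMonoidHom).relIndex hexLattice = N.index := fun N => by
    rw [← map_top_toC, AddSubgroup.relIndex_map_map_of_injective _ _ hinj,
      AddSubgroup.relIndex_top_right]
  ext M
  constructor
  · rintro ⟨h1, h2, h3⟩
    have hM : (M.comap toC.toRingHom.toAddMonoidHom).map toC.toRingHom.toAddMonoidHom = M := by
      rw [AddSubgroup.map_comap_eq, inf_eq_right, AddMonoidHom.range_eq_map, map_top_toC]
      exact h1
    exact ⟨_, ⟨by rw [← hidx, hM, h2], isWellRounded_map.1 (by rw [hM]; exact h3)⟩, hM⟩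
  · rintro ⟨N, ⟨h1, h2⟩, rfl⟩
    exact ⟨by rw [← map_top_toC]; exact AddSubgroup.map_mono le_top, by rw [hidx, h1],
      isWellRounded_map.2 h2⟩

end EisInt

theorem finite_wrSublattices {n : ℕ} (hn : n ≠ 0) : (wrSublattices n).Finite := by
  rw [EisInt.wrSublattices_eq, ← (EisInt.bijOn_params n).image_eq]
  exact ((EisInt.finite_params hn).image _).image _

/-- The number of well-rounded sublattices as a Dirichlet convolution. -/
theorem wrCount_eq {n : ℕ} (hn : n ≠ 0) :
    wrCount n = ∑ p ∈ n.divisorsAntidiagonal, primCount p.1 * shapeCount p.2 := by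
  rw [wrCount, EisInt.wrSublattices_eq, Set.ncard_image_of_injective, EisInt.ncard_wellRounded hn]
  exact AddSubgroup.map_injective EisInt.toC_injective

/-! ### Root counts modulo prime powers and the Euler factors of `primCount`. -/

theorem pow_dvd_of_dvd_mul_of_not_dvd {p j : ℕ} (hp : p.Prime) {a b : ℤ}
    (h : ((p ^ j : ℕ) : ℤ) ∣ a * b) (ha : ¬ (p : ℤ) ∣ a) : ((p ^ j : ℕ) : ℤ) ∣ b := by
  have hc : IsCoprime ((p ^ j : ℕ) : ℤ) a := by
    push_cast
    exact ((Nat.prime_iff_prime_int.1 hp).irreducible.coprime_iff_not_dvd.2 ha).pow_left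
  exact hc.dvd_of_dvd_mul_left h

/-- For `x` lifting `u`, `x^3 - 1 = (x - 1)(x^2 + x + 1)`, and `x^2 + x + 1 - (x - 1)(x + 2) = 3`
prevents `p ≠ 3` from dividing both factors. So the whole power of `p` divides one of them. -/
theorem orderOf_eq_three_iff {p j : ℕ} (hp : p.Prime) (hp3 : p ≠ 3) (hj : j ≠ 0)
    (u : (ZMod (p ^ j))ˣ) :
    orderOf u = 3 ↔ (-(u : ZMod (p ^ j))) ^ 2 - (-(u : ZMod (p ^ j))) + 1 = 0 := by
  have h3 : ¬ (p : ℤ) ∣ 3 := by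
    intro h
    have : p ∣ 3 := by exact_mod_cast h
    exact hp3 ((Nat.prime_dvd_prime_iff_eq hp Nat.prime_three).1 this)
  have : Fact (Nat.Prime 3) := ⟨Nat.prime_three⟩
  rw [orderOf_eq_prime_iff]
  obtain ⟨x, hx⟩ := ZMod.intCast_surjective (u : ZMod (p ^ j))
  have e1 : u ^ 3 = 1 ↔ ((p ^ j : ℕ) : ℤ) ∣ (x - 1) * (x ^ 2 + x + 1) := by
    rw [← ZMod.intCast_zmod_eq_zero_iff_dvd, ← Units.val_inj]
    push_cast
    rw [hx, ← sub_eq_zero]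
    ring_nf
  have e2 : u = 1 ↔ ((p ^ j : ℕ) : ℤ) ∣ x - 1 := by
    rw [← ZMod.intCast_zmod_eq_zero_iff_dvd, ← Units.val_inj]
    push_cast
    rw [hx, ← sub_eq_zero]
  have e3 : (-(u : ZMod (p ^ j))) ^ 2 - (-(u : ZMod (p ^ j))) + 1 = 0 ↔
      ((p ^ j : ℕ) : ℤ) ∣ x ^ 2 + x + 1 := by
    rw [← ZMod.intCast_zmod_eq_zero_iff_dvd]
    push_cast
    rw [hx]
    ring_nf
  rw [Ne, e1, e2, e3]
  have hpj : (p : ℤ) ∣ ((p ^ j : ℕ) : ℤ) := by exact_mod_cast dvd_pow_self p hj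
  have key : (p : ℤ) ∣ x - 1 → (p : ℤ) ∣ x ^ 2 + x + 1 → False := by
    intro h1 h2
    apply h3
    have := dvd_sub h2 (h1.mul_right (x + 2))
    rwa [show x ^ 2 + x + 1 - (x - 1) * (x + 2) = 3 by ring] at this
  constructor
  · rintro ⟨h1, h2⟩
    by_contra h4
    by_cases h5 : (p : ℤ) ∣ x - 1
    · exact h2 (pow_dvd_of_dvd_mul_of_not_dvd hp (mul_comm (x - 1) _ ▸ h1) (key h5))
    · exact h4 (pow_dvd_of_dvd_mul_of_not_dvd hp h1 h5)
  · intro h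
    exact ⟨h.mul_left _, fun h' => key (hpj.trans h') (hpj.trans h)⟩

/-- Negation identifies the roots with the units of order `3`. The unit group has order `p^(j-1) (p
- 1)`, which `3` divides only for `p ≡ 1` modulo `3`; then `p` is odd, the group is cyclic, and it
has `φ(3) = 2` such elements. -/
theorem card_roots_prime_pow {p j : ℕ} (hp : p.Prime) (hp3 : p ≠ 3) (hj : j ≠ 0) :
    Nat.card {t : ZMod (p ^ j) // t ^ 2 - t + 1 = 0} = if p % 3 = 1 then 2 else 0 := by
  have hne : NeZero (p ^ j) := ⟨pow_ne_zero _ hp.ne_zero⟩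
  have e : {u : (ZMod (p ^ j))ˣ // orderOf u = 3} ≃ {t : ZMod (p ^ j) // t ^ 2 - t + 1 = 0} := by
    refine Equiv.ofBijective
      (fun u => ⟨-(u.1 : ZMod (p ^ j)), (orderOf_eq_three_iff hp hp3 hj u.1).1 u.2⟩) ⟨?_, ?_⟩
    · intro u v h
      exact Subtype.ext (Units.ext (neg_injective (congrArg Subtype.val h)))
    · rintro ⟨t, ht⟩
      let u : (ZMod (p ^ j))ˣ := ⟨-t, t ^ 2, by linear_combination (-t - 1) * ht,
        by linear_combination (-t - 1) * ht⟩
      refine ⟨⟨u, (orderOf_eq_three_iff hp hp3 hj u).2 ?_⟩, Subtype.ext (neg_neg t)⟩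
      change (- -t) ^ 2 - (- -t) + 1 = 0
      rw [neg_neg]; exact ht
  rw [← Nat.card_congr e, Nat.card_eq_fintype_card, Fintype.card_subtype]
  have hcard : Fintype.card (ZMod (p ^ j))ˣ = p ^ (j - 1) * (p - 1) := by
    rw [ZMod.card_units_eq_totient, Nat.totient_prime_pow hp (Nat.pos_of_ne_zero hj)]
  have h3 : 3 ∣ p ^ (j - 1) * (p - 1) ↔ p % 3 = 1 := by
    rw [Nat.prime_three.dvd_mul]
    have h1 : ¬ 3 ∣ p ^ (j - 1) := fun h => hp3
      ((Nat.prime_dvd_prime_iff_eq Nat.prime_three hp).1 (Nat.prime_three.dvd_of_dvd_pow h)).symm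
    have := hp.two_le
    omega
  split_ifs with h
  · have hp2 : p ≠ 2 := by rintro rfl; omega
    have := ZMod.isCyclic_units_of_prime_pow p hp hp2 j
    rw [IsCyclic.card_orderOf_eq_totient (by rw [hcard]; exact h3.2 h)]
    decide
  · rw [Finset.card_eq_zero, Finset.filter_eq_empty_iff]
    intro u _ hu
    apply h
    rw [← h3, ← hcard, ← hu]
    exact orderOf_dvd_card

theorem card_roots_mul {m n : ℕ} (h : m.Coprime n) :
    Nat.card {t : ZMod (m * n) // t ^ 2 - t + 1 = 0} =
      Nat.card {t : ZMod m // t ^ 2 - t + 1 = 0} * Nat.card {t : ZMod n // t ^ 2 - t + 1 = 0} := by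
  rw [← Nat.card_prod]
  let c := ZMod.chineseRemainder h
  have key : ∀ t : ZMod (m * n), t ^ 2 - t + 1 = 0 ↔
      (c t).1 ^ 2 - (c t).1 + 1 = 0 ∧ (c t).2 ^ 2 - (c t).2 + 1 = 0 := by
    intro t
    rw [← map_eq_zero_iff c c.injective, map_add, map_sub, map_pow, map_one, Prod.ext_iff]
    rfl
  refine Nat.card_congr
    ⟨fun t => (⟨(c t.1).1, ((key t.1).1 t.2).1⟩, ⟨(c t.1).2, ((key t.1).1 t.2).2⟩),
      fun s => ⟨c.symm (s.1.1, s.2.1), (key _).2 ?_⟩, fun t => ?_, fun s => ?_⟩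
  · rw [c.apply_symm_apply]; exact ⟨s.1.2, s.2.2⟩
  · exact Subtype.ext (c.symm_apply_apply t.1)
  · ext
    · exact congrArg Prod.fst (c.apply_symm_apply (s.1.1, s.2.1))
    · exact congrArg Prod.snd (c.apply_symm_apply (s.1.1, s.2.1))

/-- `primCount` as an arithmetic function. -/
noncomputable def primFun : ArithmeticFunction ℤ := ⟨fun k => primCount k, by simp [primCount]⟩

/-- The indicator function of the squares prime to `3`. -/
noncomputable def sqFun : ArithmeticFunction ℤ := by
  classical exact ⟨fun m => if IsSquare m ∧ ¬ 3 ∣ m then 1 else 0, by simp⟩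

/-- The nontrivial character modulo `3`. -/
def chiFun : ArithmeticFunction ℤ := ⟨fun n => quadraticChar (ZMod 3) n, by simp⟩

/-- The trivial character modulo `3`. -/
def trivFun : ArithmeticFunction ℤ := ⟨fun n => if 3 ∣ n then 0 else 1, by simp⟩

theorem three_not_dvd_mul {m n : ℕ} : ¬ 3 ∣ m * n ↔ ¬ 3 ∣ m ∧ ¬ 3 ∣ n := by
  rw [Nat.prime_three.dvd_mul, not_or]

theorem primFun_isMultiplicative : primFun.IsMultiplicative := by
  refine ⟨?_, fun {m n} h => ?_⟩
  · have : Unique {t : ZMod 1 // t ^ 2 - t + 1 = 0} :=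
      ⟨⟨⟨0, Subsingleton.elim _ _⟩⟩, fun _ => Subsingleton.elim _ _⟩
    simp only [primFun, coe_mk, primCount]
    rw [if_neg (by norm_num), Nat.card_unique]; rfl
  · simp only [primFun, coe_mk, primCount, Nat.prime_three.dvd_mul]
    by_cases h1 : 3 ∣ m <;> by_cases h2 : 3 ∣ n <;> simp [h1, h2, card_roots_mul h]

theorem isSquare_mul_of_coprime {m n : ℕ} (h : m.Coprime n) :
    IsSquare (m * n) ↔ IsSquare m ∧ IsSquare n := by
  refine ⟨fun hs => ?_, fun hs => hs.1.mul hs.2⟩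
  obtain ⟨c, hc⟩ := hs
  have hu : IsUnit (GCDMonoid.gcd m n) := by
    rw [Nat.isUnit_iff]; exact h
  have hu' : IsUnit (GCDMonoid.gcd n m) := by
    rw [Nat.isUnit_iff]; exact h.symm
  obtain ⟨d, hd⟩ := exists_eq_pow_of_mul_eq_pow hu (hc.trans (sq c).symm)
  obtain ⟨d', hd'⟩ := exists_eq_pow_of_mul_eq_pow hu' ((mul_comm n m).trans (hc.trans (sq c).symm))
  exact ⟨⟨d, by rw [hd, sq]⟩, ⟨d', by rw [hd', sq]⟩⟩

theorem sqFun_isMultiplicative : sqFun.IsMultiplicative := by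
  refine ⟨?_, fun {m n} h => ?_⟩
  · simp [sqFun]
  · simp only [sqFun, coe_mk, three_not_dvd_mul, isSquare_mul_of_coprime h]
    by_cases h1 : IsSquare m <;> by_cases h2 : IsSquare n <;> by_cases h3 : 3 ∣ m <;>
      by_cases h4 : 3 ∣ n <;> simp [h1, h2, h3, h4]

theorem chiFun_isMultiplicative : chiFun.IsMultiplicative :=
  ⟨by simp [chiFun], fun {m n} _ => by simp only [chiFun, coe_mk, Nat.cast_mul, map_mul]⟩

theorem trivFun_isMultiplicative : trivFun.IsMultiplicative := by
  refine ⟨by simp [trivFun], fun {m n} _ => ?_⟩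
  simp only [trivFun, coe_mk, Nat.prime_three.dvd_mul]
  by_cases h1 : 3 ∣ m <;> by_cases h2 : 3 ∣ n <;> simp [h1, h2]

theorem mul_apply_prime_pow {p : ℕ} (hp : p.Prime) (f g : ArithmeticFunction ℤ) (j : ℕ) :
    (f * g) (p ^ j) = ∑ i ∈ Finset.range (j + 1), f (p ^ i) * g (p ^ (j - i)) := by
  rw [ArithmeticFunction.mul_apply, Nat.sum_divisorsAntidiagonal (fun a b => f a * g b),
    Nat.sum_divisors_prime_pow hp]
  refine Finset.sum_congr rfl fun i hi => ?_
  rw [Nat.pow_div (by simpa [Nat.lt_succ_iff] using hi) hp.pos]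

theorem quadraticChar_three (p : ℕ) :
    quadraticChar (ZMod 3) p = if p % 3 = 1 then 1 else if p % 3 = 2 then -1 else 0 := by
  have h : (p : ZMod 3) = ((p % 3 : ℕ) : ZMod 3) := (ZMod.natCast_mod p 3).symm
  rw [h]
  have : p % 3 < 3 := Nat.mod_lt _ (by norm_num)
  interval_cases p % 3 <;> decide

theorem isSquare_pow_prime {p : ℕ} (hp : p.Prime) (i : ℕ) : IsSquare (p ^ i) ↔ Even i := by
  constructor
  · rintro ⟨c, hc⟩
    obtain ⟨k, -, rfl⟩ := (Nat.dvd_prime_pow hp).1 (Dvd.intro c hc.symm)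
    rw [← pow_add] at hc
    exact ⟨k, Nat.pow_right_injective hp.two_le hc⟩
  · intro h; exact h.isSquare_pow p

/-- At a prime `p ≠ 3`, with `χ = χ(p)` and `x = p^(-s)`, the Euler factor of `primFun` is `1 + ∑_{i
≥ 1} (1 + χ) x^i = (1 - x^2) / ((1 - x)(1 - χ x))`. The squares contribute `1 / (1 - x^2)`, which
cancels the numerator. At `3` all factors are trivial. -/
theorem primFun_mul_sqFun : primFun * sqFun = trivFun * chiFun := by
  rw [IsMultiplicative.eq_iff_eq_on_prime_powers _
    (primFun_isMultiplicative.mul sqFun_isMultiplicative) _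
    (trivFun_isMultiplicative.mul chiFun_isMultiplicative)]
  intro p j hp
  rw [mul_apply_prime_pow hp, mul_apply_prime_pow hp]
  by_cases hp3 : p = 3
  · subst hp3
    rw [Finset.sum_range_succ', Finset.sum_range_succ', Finset.sum_eq_zero, Finset.sum_eq_zero]
    · rw [pow_zero, primFun_isMultiplicative.1, trivFun_isMultiplicative.1]
      rcases Nat.eq_zero_or_pos j with rfl | hj
      · simp [sqFun_isMultiplicative.1, chiFun_isMultiplicative.1]
      · have h3 : 3 ∣ 3 ^ j := dvd_pow_self 3 hj.ne'
        have h0 : quadraticChar (ZMod 3) ((3 ^ j : ℕ) : ZMod 3) = 0 := by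
          rw [quadraticChar_three, Nat.mod_eq_zero_of_dvd h3]; norm_num
        simp only [sqFun, chiFun, coe_mk, Nat.sub_zero, h0]
        simp [h3]
    · intro i _
      simp [trivFun, dvd_pow_self 3 (Nat.succ_ne_zero i)]
    · intro i _
      simp [primFun, primCount, dvd_pow_self 3 (Nat.succ_ne_zero i)]
  have hnd : ∀ i, ¬ 3 ∣ p ^ i := fun i h => hp3
    ((Nat.prime_dvd_prime_iff_eq Nat.prime_three hp).1 (Nat.prime_three.dvd_of_dvd_pow h)).symm
  have hs : ∀ i, sqFun (p ^ i) = if Even i then 1 else 0 := by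
    intro i
    simp [sqFun, hnd i, isSquare_pow_prime hp]
  have ht : ∀ i, trivFun (p ^ i) = 1 := fun i => by simp [trivFun, hnd i]
  have hP : ∀ i, primFun (p ^ i) = if i = 0 then 1 else if p % 3 = 1 then 2 else 0 := by
    intro i
    split_ifs with h1 h2
    · rw [h1, pow_zero]; exact primFun_isMultiplicative.1
    · simp [primFun, primCount, hnd i, card_roots_prime_pow hp hp3 h1, h2]
    · simp [primFun, primCount, hnd i, card_roots_prime_pow hp hp3 h1, h2]
  have hc : ∀ i, chiFun (p ^ i) = (if p % 3 = 1 then 1 else -1) ^ i := by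
    intro i
    have := hnd 1
    rw [pow_one] at this
    have h1 : quadraticChar (ZMod 3) (p : ZMod 3) = if p % 3 = 1 then 1 else -1 := by
      rw [quadraticChar_three]
      split_ifs <;> first | rfl | omega
    simp only [chiFun, coe_mk, Nat.cast_pow, map_pow, h1]
  simp only [hs, ht, hP, hc, one_mul]
  clear hs ht hP hc hnd
  -- The indicator of even exponents has period two, so both sides are compared at `n + 2` and at
  -- `n`.
  induction j using Nat.twoStepInduction with
  | zero => simp
  | one =>
    simp [Finset.sum_range_succ]
  | more n ih _ =>
    rw [Finset.sum_range_succ, Finset.sum_range_succ, Finset.sum_range_succ' _ (n + 1 + 1),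
      Finset.sum_range_succ' _ (n + 1)]
    have e1 : ∀ i ∈ Finset.range (n + 1), ((if i = 0 then 1 else if p % 3 = 1 then 2 else 0) *
        if Even (n + 2 - i) then 1 else 0 : ℤ) = (if i = 0 then 1 else if p % 3 = 1 then 2 else 0) *
        if Even (n - i) then 1 else 0 := by
      intro i hi
      have hi' : i ≤ n := by simpa [Nat.lt_succ_iff] using hi
      rw [show n + 2 - i = n - i + 2 by omega]
      simp [Nat.even_add]
    rw [Finset.sum_congr rfl e1, ih]
    have e2 : ∀ i ∈ Finset.range (n + 1), ((if p % 3 = 1 then 1 else -1 : ℤ)) ^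
        (n + 2 - (i + 1 + 1)) = (if p % 3 = 1 then 1 else -1) ^ (n - i) := by
      intro i _
      rw [show n + 2 - (i + 1 + 1) = n - i by omega]
    rw [Finset.sum_congr rfl e2]
    rw [show n + 2 - (n + 1) = 1 by omega, show n + 2 - (n + 1 + 1) = 0 by omega]
    by_cases h : p % 3 = 1
    · simp [h]; ring
    · simp only [h, if_false]
      simp [pow_succ]

/-! ### Sequences with linear partial sums: Abel summation and analytic continuation. -/

/-- The partial sums of `a` are `κ x + O(√x (1 + log x))`. -/
def LinearSum (a : ℕ → ℝ) (κ : ℝ) : Prop :=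
  ∃ C : ℝ, ∀ x : ℝ, 1 ≤ x →
    |∑ n ∈ Finset.Icc 1 ⌊x⌋₊, a n - κ * x| ≤ C * (√x * (1 + Real.log x))

/-- The error term of the partial sums of `a`. -/
noncomputable def sumErr (a : ℕ → ℝ) (κ t : ℝ) : ℝ := ∑ n ∈ Finset.Icc 1 ⌊t⌋₊, a n - κ * t

theorem measurable_sumErr (a : ℕ → ℝ) (κ : ℝ) : Measurable (sumErr a κ) := by
  unfold sumErr
  refine Measurable.sub ?_ (measurable_const.mul measurable_id)
  exact (measurable_from_top (f := fun n : ℕ => ∑ n ∈ Finset.Icc 1 n, a n)).comp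
    Nat.measurable_floor

theorem sqrt_mul_one_add_log_nonneg {x : ℝ} (hx : 1 ≤ x) : 0 ≤ √x * (1 + Real.log x) :=
  mul_nonneg (Real.sqrt_nonneg x) (by have := Real.log_nonneg hx; linarith)

theorem one_add_log_le {x : ℝ} (hx : 1 ≤ x) : 1 + Real.log x ≤ 5 * x ^ (1 / 4 : ℝ) := by
  have h1 := Real.log_le_rpow_div (zero_le_one.trans hx) (show (0 : ℝ) < 1 / 4 by norm_num)
  have h2 := Real.one_le_rpow hx (show (0 : ℝ) ≤ 1 / 4 by norm_num)
  linarith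

theorem sqrt_mul_one_add_log_le {x : ℝ} (hx : 1 ≤ x) :
    √x * (1 + Real.log x) ≤ 5 * x ^ (3 / 4 : ℝ) := by
  have h := mul_le_mul_of_nonneg_left (one_add_log_le hx) (Real.sqrt_nonneg x)
  refine h.trans (le_of_eq ?_)
  rw [Real.sqrt_eq_rpow, mul_left_comm, ← Real.rpow_add (by linarith)]
  norm_num

theorem LinearSum.exists_nonneg {a : ℕ → ℝ} {κ : ℝ} (h : LinearSum a κ) :
    ∃ C : ℝ, 0 ≤ C ∧ ∀ x : ℝ, 1 ≤ x → |sumErr a κ x| ≤ C * (√x * (1 + Real.log x)) := by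
  obtain ⟨C, hC⟩ := h
  exact ⟨|C|, abs_nonneg C, fun x hx => (hC x hx).trans
    (mul_le_mul_of_nonneg_right (le_abs_self C) (sqrt_mul_one_add_log_nonneg hx))⟩

/-- An explicit primitive of the error bound divided by `x ^ 2`; it evaluates the tail of the
integral in `polarConst`. -/
theorem hasDerivAt_tail {x : ℝ} (hx : 0 < x) :
    HasDerivAt (fun t : ℝ => -2 * (t ^ (-(1 / 2) : ℝ) * (3 + Real.log t)))
      (√x * (1 + Real.log x) * (x ^ 2)⁻¹) x := by
  have h1 : HasDerivAt (fun t : ℝ => t ^ (-(1 / 2) : ℝ)) _ x :=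
    Real.hasDerivAt_rpow_const (Or.inl hx.ne')
  have h2 := (h1.mul ((Real.hasDerivAt_log hx.ne').const_add 3)).const_mul (-2)
  refine h2.congr_deriv ?_
  have e1 : x ^ (-(1 / 2) - 1 : ℝ) = √x * (x ^ 2)⁻¹ := by
    rw [Real.sqrt_eq_rpow, ← Real.rpow_natCast x 2, ← Real.rpow_neg hx.le, ← Real.rpow_add hx]
    norm_num
  have e2 : x ^ (-(1 / 2) : ℝ) = √x * x⁻¹ := by
    rw [Real.sqrt_eq_rpow, ← Real.rpow_neg_one x, ← Real.rpow_add hx]; norm_num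
  rw [e1, e2]
  field_simp
  ring

theorem tendsto_tail :
    Tendsto (fun t : ℝ => -2 * (t ^ (-(1 / 2) : ℝ) * (3 + Real.log t))) atTop (𝓝 0) := by
  have h1 : Tendsto (fun t : ℝ => t ^ (-(1 / 2) : ℝ)) atTop (𝓝 0) :=
    tendsto_rpow_neg_atTop (by norm_num)
  have h2 : Tendsto (fun t : ℝ => t ^ (-(1 / 2) : ℝ) * Real.log t) atTop (𝓝 0) := by
    refine (isLittleO_log_rpow_atTop (show (0 : ℝ) < 1 / 2 by
      norm_num)).tendsto_div_nhds_zero.congr'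
      ?_
    filter_upwards [eventually_gt_atTop 0] with t ht
    rw [Real.rpow_neg ht.le, div_eq_inv_mul]
  have := ((h1.mul_const 3).add h2).const_mul (-2)
  simp only [zero_mul, add_zero, mul_zero, ← mul_add] at this
  exact this

open MeasureTheory in
theorem integrableOn_tail {x : ℝ} (hx : 0 < x) (h1 : 1 ≤ x) :
    IntegrableOn (fun t : ℝ => √t * (1 + Real.log t) * (t ^ 2)⁻¹) (Set.Ioi x) ∧
    ∫ t in Set.Ioi x, √t * (1 + Real.log t) * (t ^ 2)⁻¹ =
      2 * (x ^ (-(1 / 2) : ℝ) * (3 + Real.log x)) := by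
  have hd : ∀ t ∈ Set.Ici x, HasDerivAt (fun t : ℝ => -2 * (t ^ (-(1 / 2) : ℝ) * (3 + Real.log t)))
      (√t * (1 + Real.log t) * (t ^ 2)⁻¹) t := fun t ht => hasDerivAt_tail (hx.trans_le ht)
  have hp : ∀ t ∈ Set.Ioi x, 0 ≤ √t * (1 + Real.log t) * (t ^ 2)⁻¹ := fun t ht =>
    mul_nonneg (sqrt_mul_one_add_log_nonneg (h1.trans (le_of_lt ht))) (by positivity)
  refine ⟨integrableOn_Ioi_deriv_of_nonneg' hd hp tendsto_tail, ?_⟩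
  rw [integral_Ioi_of_hasDerivAt_of_nonneg' hd hp tendsto_tail]
  ring

open MeasureTheory in
theorem LinearSum.integrableOn {a : ℕ → ℝ} {κ : ℝ} (h : LinearSum a κ) :
    IntegrableOn (fun t => sumErr a κ t * (t ^ 2)⁻¹) (Set.Ioi 1) := by
  obtain ⟨C, hC0, hC⟩ := h.exists_nonneg
  refine Integrable.mono' ((integrableOn_tail one_pos le_rfl).1.const_mul C)
    ((measurable_sumErr a κ).mul (by fun_prop)).aestronglyMeasurable ?_
  filter_upwards [ae_restrict_mem measurableSet_Ioi] with t ht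
  rw [norm_mul, Real.norm_eq_abs, Real.norm_of_nonneg (by positivity), ← mul_assoc]
  exact mul_le_mul_of_nonneg_right (hC t (le_of_lt ht)) (by positivity)

/-- The constant term of the Dirichlet series of `a` at its pole. -/
noncomputable def polarConst (a : ℕ → ℝ) (κ : ℝ) : ℝ :=
  κ + ∫ t in Set.Ioi (1 : ℝ), sumErr a κ t * (t ^ 2)⁻¹

open MeasureTheory in
-- Abel summation against `1 / t`. The linear part of the partial sums integrates to `κ log x`, the
-- error integrates to the constant, and what is lost is the tail of a convergent integral.
theorem LinearSum.sum_div {a : ℕ → ℝ} {κ : ℝ} (h : LinearSum a κ) :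
    ∃ C : ℝ, 0 ≤ C ∧ ∀ x : ℝ, 1 ≤ x →
      |∑ n ∈ Finset.Icc 1 ⌊x⌋₊, a n / n - (κ * Real.log x + polarConst a κ)| ≤
        C * ((1 + Real.log x) / √x) := by
  obtain ⟨C, hC0, hC⟩ := h.exists_nonneg
  refine ⟨7 * C, by positivity, fun x hx => ?_⟩
  have hx0 : 0 < x := by linarith
  have hlog := Real.log_nonneg hx
  have hi := h.integrableOn
  -- Abel's formula starts at index `0`, whereas `a 0` plays no role in `LinearSum`; it is set to
  -- zero.
  let c : ℕ → ℝ := fun n => if n = 0 then 0 else a n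
  have hsum : ∀ m : ℕ, ∀ g : ℕ → ℝ, ∑ k ∈ Finset.Icc 0 m, g k * c k =
      ∑ k ∈ Finset.Icc 1 m, g k * a k := by
    intro m g
    rw [← Finset.add_sum_Ioc_eq_sum_Icc (Nat.zero_le m), ← Finset.Icc_add_one_left_eq_Ioc]
    simp only [c, if_true, mul_zero, zero_add]
    refine Finset.sum_congr rfl fun k hk => ?_
    rw [if_neg (by have := (Finset.mem_Icc.1 hk).1; omega)]
  have hsum1 : ∀ m : ℕ, ∑ k ∈ Finset.Icc 0 m, c k = ∑ k ∈ Finset.Icc 1 m, a k := by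
    intro m; simpa using hsum m (fun _ => 1)
  have hderiv : ∀ t : ℝ, deriv (fun t : ℝ => t⁻¹) t = -(t ^ 2)⁻¹ := fun t => by simp
  have habel := sum_mul_eq_sub_integral_mul₀ (f := fun t : ℝ => t⁻¹) c (if_pos rfl) x
    (fun t ht => differentiableAt_inv (by have := ht.1; positivity))
    (by
      rw [funext hderiv]
      exact ContinuousOn.integrableOn_Icc (fun t ht => ContinuousAt.continuousWithinAt (by
        have : t ^ 2 ≠ 0 := by have := ht.1; positivity
        fun_prop (disch := exact this))))
  rw [hsum] at habel
  simp only [hsum1, hderiv] at habel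
  have e1 : ∑ n ∈ Finset.Icc 1 ⌊x⌋₊, a n / n = ∑ k ∈ Finset.Icc 1 ⌊x⌋₊, (k : ℝ)⁻¹ * a k :=
    Finset.sum_congr rfl fun k _ => by rw [div_eq_inv_mul]
  have hi1 : IntegrableOn (fun t : ℝ => sumErr a κ t * (t ^ 2)⁻¹) (Set.Ioc 1 x) :=
    hi.mono_set Set.Ioc_subset_Ioi_self
  have hi2 : IntegrableOn (fun t : ℝ => sumErr a κ t * (t ^ 2)⁻¹) (Set.Ioi x) :=
    hi.mono_set (Set.Ioi_subset_Ioi hx)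
  have hi3 : IntegrableOn (fun t : ℝ => t⁻¹) (Set.Ioc 1 x) := by
    refine (ContinuousOn.integrableOn_Icc (fun t ht => ContinuousAt.continuousWithinAt ?_)).mono_set
      Set.Ioc_subset_Icc_self
    have : t ≠ 0 := by have := ht.1; positivity
    fun_prop (disch := exact this)
  have e2 : ∫ t in Set.Ioc 1 x, -(t ^ 2)⁻¹ * ∑ k ∈ Finset.Icc 1 ⌊t⌋₊, a k =
      -(∫ t in Set.Ioc 1 x, sumErr a κ t * (t ^ 2)⁻¹) - κ * Real.log x := by
    have : ∫ t in Set.Ioc 1 x, t⁻¹ = Real.log x := by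
      rw [← intervalIntegral.integral_of_le hx, integral_inv_of_pos one_pos hx0, div_one]
    have hi1' : IntegrableOn (fun t : ℝ => -(sumErr a κ t * (t ^ 2)⁻¹)) (Set.Ioc 1 x) := hi1.neg
    rw [← this, ← integral_const_mul, ← integral_neg, ← integral_sub hi1' (hi3.const_mul κ)]
    refine setIntegral_congr_fun measurableSet_Ioc fun t ht => ?_
    have : t ≠ 0 := by have := ht.1; positivity
    simp only [sumErr]
    field_simp
    ring
  have e3 : ∫ t in Set.Ioi (1 : ℝ), sumErr a κ t * (t ^ 2)⁻¹ =
      (∫ t in Set.Ioc 1 x, sumErr a κ t * (t ^ 2)⁻¹) +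
        ∫ t in Set.Ioi x, sumErr a κ t * (t ^ 2)⁻¹ := by
    rw [← setIntegral_union (Set.Ioc_disjoint_Ioi le_rfl) measurableSet_Ioi hi1 hi2,
      Set.Ioc_union_Ioi_eq_Ioi hx]
  have e4 : ∑ n ∈ Finset.Icc 1 ⌊x⌋₊, a n / n - (κ * Real.log x + polarConst a κ) =
      x⁻¹ * sumErr a κ x - ∫ t in Set.Ioi x, sumErr a κ t * (t ^ 2)⁻¹ := by
    rw [e1, habel, e2, polarConst, e3, sumErr]
    field_simp
    ring
  have e5 : x ^ (-(1 / 2) : ℝ) = (√x)⁻¹ := by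
    rw [Real.sqrt_eq_rpow, Real.rpow_neg hx0.le]
  have e6 : x⁻¹ * √x = (√x)⁻¹ := by
    have := Real.mul_self_sqrt hx0.le
    have h0 : √x ≠ 0 := (Real.sqrt_pos.2 hx0).ne'
    field_simp
    nlinarith
  obtain ⟨ht1, ht2⟩ := integrableOn_tail hx0 hx
  have b1 : |∫ t in Set.Ioi x, sumErr a κ t * (t ^ 2)⁻¹| ≤
      C * (2 * ((√x)⁻¹ * (3 + Real.log x))) := by
    rw [← e5, ← ht2, ← integral_const_mul, ← Real.norm_eq_abs]
    refine norm_integral_le_of_norm_le (ht1.const_mul C) ?_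
    filter_upwards [ae_restrict_mem measurableSet_Ioi] with t ht
    rw [norm_mul, Real.norm_eq_abs, Real.norm_of_nonneg (by positivity), ← mul_assoc]
    exact mul_le_mul_of_nonneg_right (hC t (hx.trans (le_of_lt ht))) (by positivity)
  have b2 : |x⁻¹ * sumErr a κ x| ≤ C * ((√x)⁻¹ * (1 + Real.log x)) := by
    rw [abs_mul, abs_of_pos (inv_pos.2 hx0), ← e6, mul_assoc, mul_left_comm]
    exact mul_le_mul_of_nonneg_left (hC x hx) (by positivity)
  rw [e4]
  refine (abs_sub _ _).trans ((add_le_add b2 b1).trans ?_)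
  rw [div_eq_inv_mul]
  have : 0 ≤ C * (√x)⁻¹ := by positivity
  nlinarith [mul_nonneg this hlog]

/-- The Dirichlet series of `a` minus its polar part. -/
noncomputable def polarRem (a : ℕ → ℝ) (κ : ℝ) (s : ℂ) : ℂ :=
  κ + s * mellin ((Set.Ioi (1 : ℝ)).indicator fun t => (sumErr a κ t : ℂ)) (-s)

theorem polarRem_one (a : ℕ → ℝ) (κ : ℝ) : polarRem a κ 1 = polarConst a κ := by
  rw [polarRem, polarConst, mellin, one_mul, Complex.ofReal_add, ← integral_complex_ofReal]
  congr 1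
  have : ∀ t : ℝ, (t : ℂ) ^ (-1 - 1 : ℂ) • (Set.Ioi (1 : ℝ)).indicator
      (fun t => (sumErr a κ t : ℂ)) t = (Set.Ioi (1 : ℝ)).indicator
      (fun t => ((sumErr a κ t * (t ^ 2)⁻¹ : ℝ) : ℂ)) t := by
    intro t
    by_cases ht : t ∈ Set.Ioi (1 : ℝ)
    · rw [Set.indicator_of_mem ht, Set.indicator_of_mem ht]
      rw [show (-1 - 1 : ℂ) = -((2 : ℕ) : ℂ) by norm_num, Complex.cpow_neg, Complex.cpow_natCast]
      push_cast
      rw [smul_eq_mul, mul_comm]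
    · rw [Set.indicator_of_notMem ht, Set.indicator_of_notMem ht, smul_zero]
  simp only [this]
  rw [MeasureTheory.setIntegral_indicator measurableSet_Ioi,
    Set.inter_eq_self_of_subset_right (Set.Ioi_subset_Ioi zero_le_one)]

open MeasureTheory in
-- Growth hypotheses for the Mellin transform. The logarithm in the error is absorbed by weakening
-- it to `t^(3/4)`, and the cut-off below `1` makes any exponent admissible at `0`. Hence the
-- transform at `-s` is holomorphic for `Re s > 3/4`.
theorem LinearSum.mellin_facts {a : ℕ → ℝ} {κ : ℝ} (h : LinearSum a κ) :
    LocallyIntegrableOn ((Set.Ioi (1 : ℝ)).indicator fun t => (sumErr a κ t : ℂ)) (Set.Ioi 0) ∧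
    ((Set.Ioi (1 : ℝ)).indicator fun t => (sumErr a κ t : ℂ)) =O[atTop]
      (fun t : ℝ => t ^ (-(-(3 / 4)) : ℝ)) ∧
    ∀ b : ℝ, ((Set.Ioi (1 : ℝ)).indicator fun t => (sumErr a κ t : ℂ)) =O[𝓝[>] 0]
      (fun t : ℝ => t ^ (-b)) := by
  obtain ⟨C, hC0, hC⟩ := h.exists_nonneg
  have hb : ∀ t, ‖(Set.Ioi (1 : ℝ)).indicator (fun t => (sumErr a κ t : ℂ)) t‖ ≤
      ‖C * (5 * t ^ (3 / 4 : ℝ))‖ := by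
    intro t
    by_cases ht : t ∈ Set.Ioi (1 : ℝ)
    · rw [Set.indicator_of_mem ht, Complex.norm_real]
      refine (hC t (le_of_lt ht)).trans ((mul_le_mul_of_nonneg_left
        (sqrt_mul_one_add_log_le (le_of_lt ht)) hC0).trans (Real.le_norm_self _))
    · rw [Set.indicator_of_notMem ht, norm_zero]; positivity
  refine ⟨?_, ?_, fun b => ?_⟩
  · refine (LocallyIntegrable.mono (f := fun t : ℝ => C * (5 * t ^ (3 / 4 : ℝ)))
      (Continuous.locallyIntegrable ?_) ?_ (Eventually.of_forall hb)).locallyIntegrableOn _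
    · have := Real.continuous_rpow_const (show (0 : ℝ) ≤ 3 / 4 by norm_num)
      fun_prop
    · exact ((Complex.measurable_ofReal.comp (measurable_sumErr a κ)).indicator
        measurableSet_Ioi).aestronglyMeasurable
  · refine IsBigO.of_bound (C * 5) ?_
    filter_upwards with t
    refine (hb t).trans (le_of_eq ?_)
    rw [neg_neg, ← mul_assoc, norm_mul, Real.norm_of_nonneg (by positivity : 0 ≤ C * 5)]
  · refine (isBigO_zero _ _).congr' ?_ EventuallyEq.rfl
    filter_upwards [mem_nhdsWithin_of_mem_nhds (Iio_mem_nhds (zero_lt_one' ℝ))] with t ht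
    rw [Set.indicator_of_notMem (by simpa using le_of_lt ht)]

theorem LinearSum.analyticAt_polarRem {a : ℕ → ℝ} {κ : ℝ} (h : LinearSum a κ) :
    AnalyticAt ℂ (polarRem a κ) 1 := by
  obtain ⟨h1, h2, h3⟩ := h.mellin_facts
  have hU : IsOpen {s : ℂ | 3 / 4 < s.re} := isOpen_lt continuous_const Complex.continuous_re
  refine DifferentiableOn.analyticAt (s := {s : ℂ | 3 / 4 < s.re}) (fun s hs => ?_)
    (hU.mem_nhds (by norm_num : (3 / 4 : ℝ) < (1 : ℂ).re))
  have hd := mellin_differentiableAt_of_isBigO_rpow (s := -s) h1 h2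
    (by have : 3 / 4 < s.re := hs
        rw [Complex.neg_re]; linarith) (h3 (-s.re - 1)) (by rw [Complex.neg_re]; linarith)
  unfold polarRem
  exact ((differentiableAt_const _).add (differentiableAt_id.mul
    (hd.comp s differentiableAt_id.neg))).differentiableWithinAt

theorem LinearSum.isBigO {a : ℕ → ℝ} {κ : ℝ} (h : LinearSum a κ) :
    (fun n : ℕ => ∑ k ∈ Finset.Icc 1 n, a k) =O[atTop] fun n : ℕ => (n : ℝ) ^ (1 : ℝ) := by
  obtain ⟨C, hC0, hC⟩ := h.exists_nonneg
  refine IsBigO.of_bound (C * 5 + |κ|) ?_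
  filter_upwards [eventually_ge_atTop 1] with n hn
  have hn' : (1 : ℝ) ≤ n := by exact_mod_cast hn
  have h1 := hC n hn'
  have h2 := sqrt_mul_one_add_log_le hn'
  have h3 : (n : ℝ) ^ (3 / 4 : ℝ) ≤ (n : ℝ) ^ (1 : ℝ) :=
    Real.rpow_le_rpow_of_exponent_le hn' (by norm_num)
  rw [Real.rpow_one] at h3 ⊢
  rw [sumErr, Nat.floor_natCast] at h1
  rw [Real.norm_eq_abs, Real.norm_of_nonneg (by positivity)]
  have h4 := abs_sub_abs_le_abs_sub (∑ k ∈ Finset.Icc 1 n, a k) (κ * n)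
  rw [abs_mul, abs_of_nonneg (by positivity : (0 : ℝ) ≤ n)] at h4
  have h5 := mul_le_mul_of_nonneg_left (h2.trans (mul_le_mul_of_nonneg_left h3 (by norm_num))) hC0
  linarith

theorem LinearSum.lSeriesSummable {a : ℕ → ℝ} {κ : ℝ} (h : LinearSum a κ) (ha : ∀ n, 0 ≤ a n)
    {s : ℂ} (hs : 1 < s.re) : LSeriesSummable (fun n => (a n : ℂ)) s :=
  LSeriesSummable_of_sum_norm_bigO_and_nonneg h.isBigO ha zero_le_one hs

open MeasureTheory in
-- Insert `κ t + E(t)` for the partial sum in `s ∫ A(t) t^(-s-1) dt`: the linear part gives `κ s /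
-- (s - 1) = κ / (s - 1) + κ`.
theorem LinearSum.lSeries_eq {a : ℕ → ℝ} {κ : ℝ} (h : LinearSum a κ) (ha : ∀ n, 0 ≤ a n)
    {s : ℂ} (hs : 1 < s.re) : LSeries (fun n => (a n : ℂ)) s = κ / (s - 1) + polarRem a κ s := by
  obtain ⟨h1, h2, h3⟩ := h.mellin_facts
  rw [LSeries_eq_mul_integral_of_nonneg a zero_le_one hs h.isBigO ha, polarRem, mellin]
  have hc : IntegrableOn (fun t : ℝ => (t : ℂ) ^ (-s - 1) • (Set.Ioi (1 : ℝ)).indicator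
      (fun t => (sumErr a κ t : ℂ)) t) (Set.Ioi 0) :=
    mellinConvergent_of_isBigO_rpow (s := -s) h1 h2
    (by rw [Complex.neg_re]; linarith) (h3 (-s.re - 1)) (by rw [Complex.neg_re]; linarith)
  have hc' := hc.mono_set (Set.Ioi_subset_Ioi (zero_le_one' ℝ))
  have hre : (-s : ℂ).re < -1 := by rw [Complex.neg_re]; linarith
  have e1 : ∫ t in Set.Ioi (1 : ℝ), (∑ k ∈ Finset.Icc 1 ⌊t⌋₊, (a k : ℂ)) * (t : ℂ) ^ (-(s + 1)) =
      (∫ t in Set.Ioi (1 : ℝ), (t : ℂ) ^ (-s - 1) • (Set.Ioi (1 : ℝ)).indicator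
        (fun t => (sumErr a κ t : ℂ)) t) + ∫ t in Set.Ioi (1 : ℝ), κ * (t : ℂ) ^ (-s) := by
    rw [← integral_add hc' ((integrableOn_Ioi_cpow_of_lt hre one_pos).const_mul _)]
    refine setIntegral_congr_fun measurableSet_Ioi fun t ht => ?_
    have ht0 : (t : ℂ) ≠ 0 := by
      have : (0 : ℝ) < t := lt_trans one_pos ht
      exact_mod_cast this.ne'
    simp only [Set.indicator_of_mem ht, sumErr, smul_eq_mul]
    rw [show -(s + 1) = -s - 1 by ring, show (t : ℂ) ^ (-s) = t ^ (-s - 1) * t by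
      conv_lhs => rw [show -s = (-s - 1) + 1 by ring, Complex.cpow_add _ _ ht0, Complex.cpow_one]]
    push_cast
    ring
  have e2 : ∫ t in Set.Ioi (0 : ℝ), (t : ℂ) ^ (-s - 1) • (Set.Ioi (1 : ℝ)).indicator
        (fun t => (sumErr a κ t : ℂ)) t = ∫ t in Set.Ioi (1 : ℝ), (t : ℂ) ^ (-s - 1) •
        (Set.Ioi (1 : ℝ)).indicator (fun t => (sumErr a κ t : ℂ)) t := by
    refine setIntegral_eq_of_subset_of_forall_sdiff_eq_zero measurableSet_Ioi
      (Set.Ioi_subset_Ioi zero_le_one) fun t ht => ?_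
    rw [Set.indicator_of_notMem ht.2, smul_zero]
  rw [e1, e2, integral_const_mul, integral_Ioi_cpow_of_lt hre one_pos]
  have hs1 : s - 1 ≠ 0 := by
    intro h0
    rw [sub_eq_zero.1 h0] at hs; norm_num at hs
  have hs2 : -s + 1 ≠ 0 := by
    intro h0; apply hs1; linear_combination -h0
  rw [Complex.ofReal_one, Complex.one_cpow]
  have : (-1 : ℂ) / (-s + 1) = 1 / (s - 1) := by
    rw [div_eq_div_iff hs2 hs1]; ring
  rw [this]
  field_simp
  ring

/-! ### The hyperbola method for two sequences with linear partial sums. -/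

/-- Dirichlet's hyperbola method. -/
theorem hyperbola (f g : ℕ → ℝ) {x : ℝ} (hx : 0 ≤ x) :
    ∑ n ∈ Finset.Icc 1 ⌊x⌋₊, ∑ p ∈ n.divisorsAntidiagonal, f p.1 * g p.2 =
      ∑ m ∈ Finset.Icc 1 ⌊√x⌋₊, f m * ∑ n ∈ Finset.Icc 1 ⌊x / m⌋₊, g n +
      ∑ n ∈ Finset.Icc 1 ⌊√x⌋₊, g n * ∑ m ∈ Finset.Icc 1 ⌊x / n⌋₊, f m -
      (∑ m ∈ Finset.Icc 1 ⌊√x⌋₊, f m) * ∑ n ∈ Finset.Icc 1 ⌊√x⌋₊, g n := by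
  set N := ⌊x⌋₊ with hN
  set Y := ⌊√x⌋₊ with hY
  have hY1 : Y * Y ≤ N := by
    rw [hN, Nat.le_floor_iff hx]
    have := Nat.floor_le (Real.sqrt_nonneg x)
    push_cast
    calc (Y : ℝ) * Y ≤ √x * √x := mul_self_le_mul_self (by positivity) this
      _ = x := Real.mul_self_sqrt hx
  have hY2 : N < (Y + 1) * (Y + 1) := by
    rw [hN, Nat.floor_lt hx]
    have := Nat.lt_floor_add_one √x
    push_cast
    calc x = √x * √x := (Real.mul_self_sqrt hx).symm
      _ < _ := mul_self_lt_mul_self (Real.sqrt_nonneg x) this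
  have hfl : ∀ m : ℕ, ⌊x / m⌋₊ = N / m := fun m => Nat.floor_div_natCast x m
  simp only [hfl]
  let S := (Finset.Icc 1 N ×ˢ Finset.Icc 1 N).filter fun p => p.1 * p.2 ≤ N
  have hS : ∑ n ∈ Finset.Icc 1 N, ∑ p ∈ n.divisorsAntidiagonal, f p.1 * g p.2 =
      ∑ p ∈ S, f p.1 * g p.2 := by
    rw [← Finset.sum_fiberwise_of_maps_to (s := S) (t := Finset.Icc 1 N) (g := fun p => p.1 * p.2)]
    · refine Finset.sum_congr rfl fun n hn => Finset.sum_congr ?_ fun _ _ => rfl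
      ext ⟨i, j⟩
      simp only [S, Nat.mem_divisorsAntidiagonal, Finset.mem_filter, Finset.mem_product,
        Finset.mem_Icc] at hn ⊢
      constructor
      · rintro ⟨h1, h2⟩
        have hi : 0 < i := Nat.pos_of_ne_zero (by rintro rfl; simp at h1; omega)
        have hj : 0 < j := Nat.pos_of_ne_zero (by rintro rfl; simp at h1; omega)
        have := Nat.le_mul_of_pos_right i hj
        have := Nat.le_mul_of_pos_left j hi
        omega
      · rintro ⟨⟨⟨h1, h2⟩, h3⟩, h4⟩
        exact ⟨h4, by omega⟩
    · intro p hp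
      simp only [S, Finset.mem_filter, Finset.mem_product, Finset.mem_Icc] at hp ⊢
      exact ⟨Nat.mul_pos hp.1.1.1 hp.1.2.1, hp.2⟩
  have h1 : ∀ F : ℕ → ℕ → ℝ, ∑ p ∈ S with p.1 ≤ Y, F p.1 p.2 =
      ∑ m ∈ Finset.Icc 1 Y, ∑ n ∈ Finset.Icc 1 (N / m), F m n := by
    intro F
    rw [Finset.sum_sigma']
    refine Finset.sum_bij' (fun p _ => ⟨p.1, p.2⟩) (fun q _ => (q.1, q.2)) ?_ ?_ ?_ ?_ ?_
    · rintro ⟨i, j⟩ h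
      simp only [S, Finset.mem_filter, Finset.mem_product, Finset.mem_Icc, Finset.mem_sigma] at h ⊢
      exact ⟨⟨h.1.1.1.1, h.2⟩, h.1.1.2.1,
        (Nat.le_div_iff_mul_le h.1.1.1.1).2 (by rw [mul_comm]; exact h.1.2)⟩
    · rintro ⟨i, j⟩ h
      simp only [S, Finset.mem_filter, Finset.mem_product, Finset.mem_Icc, Finset.mem_sigma] at h ⊢
      have h2 := (Nat.le_div_iff_mul_le h.1.1).1 h.2.2
      have h3 := Nat.le_mul_of_pos_right i h.2.1
      have h4 := Nat.le_mul_of_pos_right j h.1.1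
      rw [mul_comm] at h3
      exact ⟨⟨⟨⟨h.1.1, h3.trans h2⟩, h.2.1, h4.trans h2⟩, by rw [mul_comm]; exact h2⟩, h.1.2⟩
    · intros; rfl
    · intros; rfl
    · intros; rfl
  have h2 : ∑ p ∈ S with p.2 ≤ Y, f p.1 * g p.2 = ∑ p ∈ S with p.1 ≤ Y, f p.2 * g p.1 := by
    refine Finset.sum_bij' (fun p _ => (p.2, p.1)) (fun q _ => (q.2, q.1)) ?_ ?_ ?_ ?_ ?_
    · rintro ⟨i, j⟩ h
      simp only [S, Finset.mem_filter, Finset.mem_product, Finset.mem_Icc] at h ⊢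
      exact ⟨⟨h.1.1.symm, by rw [mul_comm]; exact h.1.2⟩, h.2⟩
    · rintro ⟨i, j⟩ h
      simp only [S, Finset.mem_filter, Finset.mem_product, Finset.mem_Icc] at h ⊢
      exact ⟨⟨h.1.1.symm, by rw [mul_comm]; exact h.1.2⟩, h.2⟩
    · intros; rfl
    · intros; rfl
    · intros; rfl
  -- A pair under the hyperbola cannot have both entries above `√x`, so the pairs with large first
  -- entry are those with small second entry minus the square `[1, Y]²`.
  have h3 : S.filter (fun p => ¬ p.1 ≤ Y) ⊆ S.filter (fun p => p.2 ≤ Y) := by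
    rintro ⟨i, j⟩ h
    simp only [S, Finset.mem_filter, Finset.mem_product, Finset.mem_Icc] at h ⊢
    refine ⟨h.1, ?_⟩
    by_contra hj
    have : (Y + 1) * (Y + 1) ≤ i * j := Nat.mul_le_mul (by omega) (by omega)
    omega
  have h4 : S.filter (fun p => p.2 ≤ Y) \ S.filter (fun p => ¬ p.1 ≤ Y) =
      Finset.Icc 1 Y ×ˢ Finset.Icc 1 Y := by
    ext ⟨i, j⟩
    simp only [S, Finset.mem_sdiff, Finset.mem_filter, Finset.mem_product, Finset.mem_Icc]
    constructor
    · rintro ⟨⟨h5, h6⟩, h7⟩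
      have : i ≤ Y := by by_contra h; exact h7 ⟨h5, h⟩
      omega
    · rintro ⟨⟨h5, h6⟩, h7, h8⟩
      have h9 : i * j ≤ Y * Y := Nat.mul_le_mul h6 h8
      have h10 : Y ≤ Y * Y := Nat.le_mul_self Y
      refine ⟨⟨⟨⟨⟨h5, ?_⟩, h7, ?_⟩, ?_⟩, h8⟩, fun h => h.2 h6⟩ <;> omega
  rw [hS, ← Finset.sum_filter_add_sum_filter_not S (fun p => p.1 ≤ Y), h1 fun m n => f m * g n]
  have h5 := Finset.sum_sdiff (f := fun p : ℕ × ℕ => f p.1 * g p.2) h3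
  rw [h4, h2, h1 fun m n => f n * g m] at h5
  rw [Finset.sum_product, ← Finset.sum_mul_sum] at h5
  simp only [Finset.mul_sum]
  simp only [Finset.mul_sum] at h5
  rw [← Finset.mul_sum] at h5 ⊢
  simp only [mul_comm (f _) (g _)] at h5 ⊢
  linarith

theorem sum_div_sqrt_le {a : ℕ → ℝ} {K : ℝ} (ha : ∀ n, 0 ≤ a n)
    (h : ∀ n : ℕ, ∑ k ∈ Finset.Icc 1 n, a k ≤ K * n) (M : ℕ) :
    ∑ k ∈ Finset.Icc 1 M, a k / √k ≤ 2 * K * √M := by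
  -- The boundary term of the partial summation is kept so that the induction closes.
  have key : ∑ k ∈ Finset.Icc 1 M, a k / √k ≤ K * √M + (∑ k ∈ Finset.Icc 1 M, a k) / √M := by
    induction M with
    | zero => simp
    | succ M ih =>
      rw [Finset.sum_Icc_succ_top (by omega), Finset.sum_Icc_succ_top (by omega), add_div]
      set S := ∑ k ∈ Finset.Icc 1 M, a k with hS
      have hS0 : 0 ≤ S := Finset.sum_nonneg fun k _ => ha k
      have hSK : S ≤ K * M := h M
      rcases Nat.eq_zero_or_pos M with rfl | hM
      · have : 0 ≤ K := by
          have := h 1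
          simp at this
          exact (ha 1).trans this
        simp [hS]; positivity
      have hp : 0 < √(M : ℝ) := Real.sqrt_pos.2 (by positivity)
      have hq : 0 < √((M + 1 : ℕ) : ℝ) := Real.sqrt_pos.2 (by positivity)
      have hpq : √(M : ℝ) ≤ √((M + 1 : ℕ) : ℝ) := Real.sqrt_le_sqrt (by push_cast; linarith)
      set p := √(M : ℝ)
      set q := √((M + 1 : ℕ) : ℝ)
      have hM2 : (M : ℝ) = p * p := (Real.mul_self_sqrt (by positivity)).symm
      have e : S / p - S / q ≤ K * q - K * p := by
        have hK : 0 ≤ K := by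
          have : 0 ≤ K * M := hS0.trans hSK
          have hM' : (0 : ℝ) < M := by exact_mod_cast hM
          exact nonneg_of_mul_nonneg_left this hM'
        have e1 : S / p - S / q = S * ((q - p) / (p * q)) := by field_simp
        rw [e1]
        calc S * ((q - p) / (p * q)) ≤ (K * (p * p)) * ((q - p) / (p * q)) :=
              mul_le_mul_of_nonneg_right (hM2 ▸ hSK) (div_nonneg (by linarith) (by positivity))
          _ = K * (q - p) * (p / q) := by field_simp
          _ ≤ K * (q - p) * 1 := mul_le_mul_of_nonneg_left ((div_le_one hq).2 hpq)
              (mul_nonneg hK (by linarith))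
          _ = _ := by ring
      linarith
  rcases Nat.eq_zero_or_pos M with rfl | hM
  · simp
  have hp : 0 < √(M : ℝ) := Real.sqrt_pos.2 (by positivity)
  have : (∑ k ∈ Finset.Icc 1 M, a k) / √M ≤ K * √M := by
    rw [div_le_iff₀ hp, mul_assoc, Real.mul_self_sqrt (by positivity)]
    exact h M
  linarith

theorem LinearSum.abs_sumErr_le {a : ℕ → ℝ} {κ : ℝ} (h : LinearSum a κ) :
    ∃ C : ℝ, 0 ≤ C ∧ (∀ x : ℝ, 1 ≤ x → |sumErr a κ x| ≤ C * (√x * (1 + Real.log x))) ∧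
      (∀ x : ℝ, 1 ≤ x → |sumErr a κ x| ≤ C * x) ∧
      ∀ n : ℕ, ∑ k ∈ Finset.Icc 1 n, a k ≤ (|κ| + C) * n := by
  obtain ⟨C, hC0, hC⟩ := h.exists_nonneg
  have h2 : ∀ x : ℝ, 1 ≤ x → |sumErr a κ x| ≤ 5 * C * x := by
    intro x hx
    have h2 := sqrt_mul_one_add_log_le hx
    have h3 : x ^ (3 / 4 : ℝ) ≤ x ^ (1 : ℝ) :=
      Real.rpow_le_rpow_of_exponent_le hx (by norm_num)
    rw [Real.rpow_one] at h3
    have h5 := mul_le_mul_of_nonneg_left (h2.trans (mul_le_mul_of_nonneg_left h3 (by norm_num))) hC0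
    have := hC x hx
    linarith
  refine ⟨5 * C, by positivity, fun x hx => (hC x hx).trans ?_, h2, fun n => ?_⟩
  · have := mul_nonneg hC0 (sqrt_mul_one_add_log_nonneg hx)
    linarith
  · rcases Nat.eq_zero_or_pos n with rfl | hn
    · simp
    have h4 := (abs_le.1 (h2 n (by exact_mod_cast hn))).2
    rw [sumErr, Nat.floor_natCast] at h4
    have : κ * n ≤ |κ| * n := mul_le_mul_of_nonneg_right (le_abs_self κ) (by positivity)
    linarith

/-- One leg of the hyperbola. The inner sums contribute `l x ∑ a m / m`, with `m ≤ √x`, which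
explains `log x / 2`. Their errors add up to `√x (1 + log x) ∑ a m / √m`, and the last sum is
`O(x^(1/4))`. -/
theorem hyperbola_half {a b : ℕ → ℝ} {κ l : ℝ} (ha : ∀ n, 0 ≤ a n) (hA : LinearSum a κ)
    (hB : LinearSum b l) : ∃ C : ℝ, 0 ≤ C ∧ ∀ x : ℝ, 1 ≤ x →
      |∑ m ∈ Finset.Icc 1 ⌊√x⌋₊, a m * ∑ n ∈ Finset.Icc 1 ⌊x / m⌋₊, b n -
        l * x * (κ * (Real.log x / 2) + polarConst a κ)| ≤ C * (√x * √√x * (1 + Real.log x)) := by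
  obtain ⟨C1, hC10, -, -, hC1⟩ := hA.abs_sumErr_le
  obtain ⟨C2, hC20, hC2⟩ := hB.exists_nonneg
  obtain ⟨C3, hC30, hC3⟩ := hA.sum_div
  refine ⟨|l| * C3 + C2 * (2 * (|κ| + C1)), by positivity, fun x hx => ?_⟩
  have hx0 : 0 < x := by linarith
  have hlog := Real.log_nonneg hx
  have hy1 : 1 ≤ √x := Real.one_le_sqrt.2 hx
  set y := √x with hy
  have hyy : y * y = x := Real.mul_self_sqrt hx0.le
  have hz : √y * √y = y := Real.mul_self_sqrt (by linarith)
  have hz0 : 0 < √y := Real.sqrt_pos.2 (by linarith)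
  have hlogy : Real.log y = Real.log x / 2 := Real.log_sqrt hx0.le
  have e1 : ∑ m ∈ Finset.Icc 1 ⌊y⌋₊, a m * ∑ n ∈ Finset.Icc 1 ⌊x / m⌋₊, b n =
      l * x * ∑ m ∈ Finset.Icc 1 ⌊y⌋₊, a m / m +
        ∑ m ∈ Finset.Icc 1 ⌊y⌋₊, a m * sumErr b l (x / m) := by
    rw [Finset.mul_sum, ← Finset.sum_add_distrib]
    refine Finset.sum_congr rfl fun m _ => ?_
    rw [sumErr]; ring
  have b1 : |∑ m ∈ Finset.Icc 1 ⌊y⌋₊, a m * sumErr b l (x / m)| ≤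
      C2 * (2 * (|κ| + C1)) * (y * √y * (1 + Real.log x)) := by
    have : ∀ m ∈ Finset.Icc 1 ⌊y⌋₊, |a m * sumErr b l (x / m)| ≤
        C2 * (y * (1 + Real.log x)) * (a m / √m) := by
      intro m hm
      rw [Finset.mem_Icc] at hm
      have hm1 : (1 : ℝ) ≤ m := by exact_mod_cast hm.1
      have hmy : (m : ℝ) ≤ y := (Nat.le_floor_iff (by linarith)).1 hm.2
      have hxm : 1 ≤ x / m := by rw [le_div_iff₀ (by linarith)]; nlinarith
      rw [abs_mul, abs_of_nonneg (ha m)]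
      have h1 := hC2 _ hxm
      have h2 : √(x / m) * (1 + Real.log (x / m)) ≤ y / √m * (1 + Real.log x) := by
        rw [Real.sqrt_div hx0.le]
        refine mul_le_mul_of_nonneg_left ?_ (by positivity)
        have := Real.log_le_log (by positivity) (div_le_self hx0.le hm1)
        linarith
      calc a m * |sumErr b l (x / m)| ≤ a m * (C2 * (y / √m * (1 + Real.log x))) :=
            mul_le_mul_of_nonneg_left (h1.trans (mul_le_mul_of_nonneg_left h2 hC20)) (ha m)
        _ = _ := by ring
    refine (Finset.abs_sum_le_sum_abs _ _).trans ((Finset.sum_le_sum this).trans ?_)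
    rw [← Finset.mul_sum]
    have h1 := sum_div_sqrt_le ha hC1 ⌊y⌋₊
    have h2 : √(⌊y⌋₊ : ℝ) ≤ √y := Real.sqrt_le_sqrt (Nat.floor_le (by linarith))
    have h3 : 2 * (|κ| + C1) * √(⌊y⌋₊ : ℝ) ≤ 2 * (|κ| + C1) * √y :=
      mul_le_mul_of_nonneg_left h2 (by positivity)
    calc C2 * (y * (1 + Real.log x)) * _ ≤ C2 * (y * (1 + Real.log x)) * (2 * (|κ| + C1) * √y) :=
          mul_le_mul_of_nonneg_left (h1.trans h3) (by positivity)
      _ = _ := by ring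
  have b2 := hC3 y hy1
  rw [hlogy] at b2
  have b3 : |l * x * ∑ m ∈ Finset.Icc 1 ⌊y⌋₊, a m / m -
      l * x * (κ * (Real.log x / 2) + polarConst a κ)| ≤
      |l| * C3 * (y * √y * (1 + Real.log x)) := by
    rw [← mul_sub, abs_mul, abs_mul, abs_of_pos hx0]
    calc |l| * x * _ ≤ |l| * x * (C3 * ((1 + Real.log x / 2) / √y)) :=
          mul_le_mul_of_nonneg_left b2 (by positivity)
      _ = |l| * C3 * (y * √y * (1 + Real.log x / 2)) := by
          have : x / √y = y * √y := by
            rw [div_eq_iff hz0.ne', ← hyy, mul_assoc, hz]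
          rw [← this]; ring
      _ ≤ _ := by
          refine mul_le_mul_of_nonneg_left (mul_le_mul_of_nonneg_left ?_ (by positivity))
            (by positivity)
          linarith
  rw [e1, show ∀ p q r : ℝ, p + q - r = (p - r) + q by intros; ring]
  refine (abs_add_le _ _).trans ?_
  rw [add_mul]
  exact add_le_add b3 b1

/-- Each leg supplies half of `κ l x log x`, and together they supply the linear terms with the two
polar constants. The subtracted square is `κ l x` up to error, which turns `log x` into `log x - 1`.
-/
theorem LinearSum.convolution {a b : ℕ → ℝ} {κ l : ℝ} (ha : ∀ n, 0 ≤ a n) (hb : ∀ n, 0 ≤ b n)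
    (hA : LinearSum a κ) (hB : LinearSum b l) : ∃ C : ℝ, 0 ≤ C ∧ ∀ x : ℝ, 1 ≤ x →
      |∑ n ∈ Finset.Icc 1 ⌊x⌋₊, ∑ p ∈ n.divisorsAntidiagonal, a p.1 * b p.2 -
        (κ * l * x * (Real.log x - 1) + (κ * polarConst b l + l * polarConst a κ) * x)| ≤
      C * (x ^ (3 / 4 : ℝ) * (1 + Real.log x)) := by
  obtain ⟨C1, hC10, hC1⟩ := hyperbola_half ha hA hB
  obtain ⟨C2, hC20, hC2⟩ := hyperbola_half hb hB hA
  obtain ⟨C3, hC30, hC3, hC3', -⟩ := hA.abs_sumErr_le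
  obtain ⟨C4, hC40, hC4, -, -⟩ := hB.abs_sumErr_le
  refine ⟨C1 + C2 + (|κ| * C4 + C3 * (C4 + |l|)), by positivity, fun x hx => ?_⟩
  have hx0 : 0 < x := by linarith
  have hlog := Real.log_nonneg hx
  have hy1 : 1 ≤ √x := Real.one_le_sqrt.2 hx
  have hyy : √x * √x = x := Real.mul_self_sqrt hx0.le
  have hW : x ^ (3 / 4 : ℝ) = √x * √√x := by
    rw [Real.sqrt_eq_rpow, Real.sqrt_eq_rpow, ← Real.rpow_mul hx0.le, ← Real.rpow_add hx0]
    norm_num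
  have h1 := hC1 x hx
  have h2 := hC2 x hx
  rw [hyperbola a b hx0.le, hW]
  have e3 : (∑ m ∈ Finset.Icc 1 ⌊√x⌋₊, a m) = κ * √x + sumErr a κ √x := by rw [sumErr]; ring
  have e4 : (∑ m ∈ Finset.Icc 1 ⌊√x⌋₊, b m) = l * √x + sumErr b l √x := by rw [sumErr]; ring
  rw [e3, e4]
  have h3 := hC3 _ hy1
  have h3' := hC3' _ hy1
  have h4 := hC4 _ hy1
  have hlogy : Real.log √x = Real.log x / 2 := Real.log_sqrt hx0.le
  have hle : √√x * (1 + Real.log √x) ≤ √√x * (1 + Real.log x) :=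
    mul_le_mul_of_nonneg_left (by rw [hlogy]; linarith) (Real.sqrt_nonneg _)
  set T1 := ∑ m ∈ Finset.Icc 1 ⌊√x⌋₊, a m * ∑ n ∈ Finset.Icc 1 ⌊x / m⌋₊, b n
  set T2 := ∑ n ∈ Finset.Icc 1 ⌊√x⌋₊, b n * ∑ m ∈ Finset.Icc 1 ⌊x / n⌋₊, a m
  set y := √x
  set w := √y * (1 + Real.log x)
  have h3w := h3.trans (mul_le_mul_of_nonneg_left hle hC30)
  have h4w := h4.trans (mul_le_mul_of_nonneg_left hle hC40)
  have hy0 : 0 ≤ y := by linarith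
  have hw0 : 0 ≤ w := by positivity
  have b1 : |κ * y * sumErr b l y| ≤ |κ| * C4 * (y * w) := by
    rw [abs_mul, abs_mul, abs_of_nonneg hy0]
    calc |κ| * y * _ ≤ |κ| * y * (C4 * w) := mul_le_mul_of_nonneg_left h4w (by positivity)
      _ = _ := by ring
  have b2 : |sumErr a κ y * (l * y)| ≤ C3 * |l| * (y * w) := by
    rw [abs_mul, abs_mul, abs_of_nonneg hy0]
    calc |sumErr a κ y| * (|l| * y) ≤ C3 * w * (|l| * y) :=
          mul_le_mul_of_nonneg_right h3w (by positivity)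
      _ = _ := by ring
  have b3 : |sumErr a κ y * sumErr b l y| ≤ C3 * C4 * (y * w) := by
    rw [abs_mul]
    calc |sumErr a κ y| * |sumErr b l y| ≤ (C3 * y) * (C4 * w) :=
          mul_le_mul h3' h4w (abs_nonneg _) (by positivity)
      _ = _ := by ring
  have key : T1 + T2 - (κ * y + sumErr a κ y) * (l * y + sumErr b l y) -
      (κ * l * x * (Real.log x - 1) + (κ * polarConst b l + l * polarConst a κ) * x) =
      (T1 - l * x * (κ * (Real.log x / 2) + polarConst a κ)) +
      (T2 - κ * x * (l * (Real.log x / 2) + polarConst b l)) -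
      (κ * y * sumErr b l y + sumErr a κ y * (l * y) + sumErr a κ y * sumErr b l y) := by
    have : (κ * y) * (l * y) = κ * l * x := by rw [← hyy]; ring
    linear_combination -this
  rw [key]
  have hyw : y * √y * (1 + Real.log x) = y * w := by simp only [w]; ring
  rw [hyw] at h1 h2 ⊢
  refine (abs_sub _ _).trans ((add_le_add (abs_add_le _ _) ((abs_add_le _ _).trans
    (add_le_add (abs_add_le _ _) le_rfl))).trans ?_)
  linarith

/-! ### Partial sums of `primCount`. -/

theorem LinearSum.of_sqrt_bound {a : ℕ → ℝ} {κ C : ℝ}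
    (h : ∀ x : ℝ, 1 ≤ x → |∑ n ∈ Finset.Icc 1 ⌊x⌋₊, a n - κ * x| ≤ C * √x) :
    LinearSum a κ := by
  refine ⟨|C|, fun x hx => (h x hx).trans ?_⟩
  have h1 := Real.log_nonneg hx
  have h2 := Real.sqrt_nonneg x
  calc C * √x ≤ |C| * √x := mul_le_mul_of_nonneg_right (le_abs_self C) h2
    _ ≤ |C| * (√x * (1 + Real.log x)) := by
      refine mul_le_mul_of_nonneg_left ?_ (abs_nonneg C)
      nlinarith [mul_nonneg h2 h1]

theorem trivFun_apply (n : ℕ) : trivFun n = if n % 3 = 0 then 0 else 1 := by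
  simp [trivFun, Nat.dvd_iff_mod_eq_zero]

theorem chiFun_apply (n : ℕ) : chiFun n = if n % 3 = 1 then 1 else if n % 3 = 2 then -1 else 0 :=
  quadraticChar_three n

theorem sum_trivFun (n : ℕ) : |∑ k ∈ Finset.Icc 1 n, (trivFun k : ℝ) - 2 / 3 * n| ≤ 1 := by
  have key : ∑ k ∈ Finset.Icc 1 n, (trivFun k : ℝ) =
      2 / 3 * n + (if n % 3 = 1 then 1 / 3 else if n % 3 = 2 then 2 / 3 else 0) := by
    induction n with
    | zero => simp
    | succ n ih =>
      rw [Finset.sum_Icc_succ_top (by omega), ih, trivFun_apply]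
      have : n % 3 < 3 := Nat.mod_lt _ (by norm_num)
      have h : (n + 1) % 3 = (n % 3 + 1) % 3 := by omega
      rw [h]
      push_cast
      interval_cases n % 3 <;> norm_num <;> ring
  rw [key, add_sub_cancel_left]
  split_ifs <;> rw [abs_of_nonneg] <;> norm_num

theorem sum_chiFun (n : ℕ) : ∑ k ∈ Finset.Icc 1 n, (chiFun k : ℝ) = if n % 3 = 1 then 1 else 0 := by
  induction n with
  | zero => simp
  | succ n ih =>
    rw [Finset.sum_Icc_succ_top (by omega), ih, chiFun_apply]
    have : n % 3 < 3 := Nat.mod_lt _ (by norm_num)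
    have h : (n + 1) % 3 = (n % 3 + 1) % 3 := by omega
    rw [h]
    interval_cases n % 3 <;> norm_num

theorem exists_sum_chiFun_div : ∃ l : ℝ, ∀ n : ℕ,
    |∑ k ∈ Finset.Icc 1 n, (chiFun k : ℝ) / k - l| ≤ 2 / (n + 1) := by
  let X : ℕ → ℝ := fun n => if n % 3 = 1 then 1 else 0
  -- Subtracting the boundary term of partial summation makes `u` increasing while `u n + 1 / (n +
  -- 1)` decreases; the limit is squeezed between them.
  let u : ℕ → ℝ := fun n => ∑ k ∈ Finset.Icc 1 n, (chiFun k : ℝ) / k - X n / (n + 1)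
  have hX : ∀ n, X (n + 1) = X n + chiFun (n + 1) := by
    intro n
    simp only [X]
    rw [← sum_chiFun, ← sum_chiFun, Finset.sum_Icc_succ_top (by omega)]
  have hX0 : ∀ n, 0 ≤ X n ∧ X n ≤ 1 := by
    intro n
    simp only [X]; split_ifs <;> norm_num
  have hu : ∀ n, u (n + 1) - u n = X (n + 1) * (1 / ((n : ℝ) + 1) - 1 / ((n : ℝ) + 2)) := by
    intro n
    simp only [u]
    rw [Finset.sum_Icc_succ_top (by omega)]
    have h := hX n
    have h' : (chiFun (n + 1) : ℝ) = X (n + 1) - X n := by linarith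
    rw [h']
    push_cast
    field_simp
    ring
  have hd : ∀ n : ℕ, 0 ≤ 1 / ((n : ℝ) + 1) - 1 / ((n : ℝ) + 2) := fun n => by
    rw [sub_nonneg]; exact one_div_le_one_div_of_le (by positivity) (by linarith)
  have hmono : Monotone u := monotone_nat_of_le_succ fun n => by
    have := mul_nonneg (hX0 (n + 1)).1 (hd n)
    have := hu n; linarith
  have hanti : Antitone fun n => u n + 1 / ((n : ℝ) + 1) := antitone_nat_of_succ_le fun n => by
    have h1 := mul_le_mul_of_nonneg_right (hX0 (n + 1)).2 (hd n)
    have h2 := hu n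
    push_cast
    have : (n : ℝ) + 1 + 1 = n + 2 := by ring
    rw [this]
    linarith
  have hle : ∀ m n, u m ≤ u n + 1 / ((n : ℝ) + 1) := by
    intro m n
    have h1 := hmono (le_max_left m n)
    have h2 := hanti (le_max_right m n)
    have h3 : (0 : ℝ) ≤ 1 / ((max m n : ℕ) + 1 : ℝ) := by positivity
    simp only at h2
    linarith
  have hbdd : BddAbove (Set.range u) := ⟨_, by rintro _ ⟨m, rfl⟩; exact hle m 0⟩
  refine ⟨⨆ n, u n, fun n => ?_⟩
  have h1 : u n ≤ ⨆ n, u n := le_ciSup hbdd n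
  have h2 : ⨆ n, u n ≤ u n + 1 / ((n : ℝ) + 1) := ciSup_le fun m => hle m n
  have h3 : ∑ k ∈ Finset.Icc 1 n, (chiFun k : ℝ) / k = u n + X n / (n + 1) := by simp [u]
  have h4 : X n / ((n : ℝ) + 1) ≤ 1 / ((n : ℝ) + 1) :=
    div_le_div_of_nonneg_right (hX0 n).2 (by positivity)
  have h5 : 0 ≤ X n / ((n : ℝ) + 1) := div_nonneg (hX0 n).1 (by positivity)
  have h6 : 2 / ((n : ℝ) + 1) = 1 / ((n : ℝ) + 1) + 1 / ((n : ℝ) + 1) := by ring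
  rw [h3, abs_le, h6]
  constructor <;> linarith

/-- Hyperbola method with bounded character sums. Only the leg `∑ χ(n) · (2/3) (x / n)` has a main
term; everything else is `O(√x)`. -/
theorem sum_trivFun_mul_chiFun : ∃ r C : ℝ, 0 ≤ C ∧ ∀ x : ℝ, 1 ≤ x →
    |∑ n ∈ Finset.Icc 1 ⌊x⌋₊, ((trivFun * chiFun) n : ℝ) - r * x| ≤ C * √x := by
  obtain ⟨l, hl⟩ := exists_sum_chiFun_div
  refine ⟨2 / 3 * l, 8, by norm_num, fun x hx => ?_⟩
  have hx0 : 0 < x := by linarith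
  have hy1 : 1 ≤ √x := Real.one_le_sqrt.2 hx
  have hyy : √x * √x = x := Real.mul_self_sqrt hx0.le
  have e : ∀ n, ((trivFun * chiFun) n : ℝ) =
      ∑ p ∈ n.divisorsAntidiagonal, (trivFun p.1 : ℝ) * (chiFun p.2 : ℝ) := by
    intro n; rw [ArithmeticFunction.mul_apply]; push_cast; rfl
  simp only [e]
  rw [hyperbola (fun n => (trivFun n : ℝ)) (fun n => (chiFun n : ℝ)) hx0.le]
  set y := √x
  set Y := ⌊y⌋₊
  have hYy : (Y : ℝ) ≤ y := Nat.floor_le (by linarith)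
  have hyY : y < Y + 1 := Nat.lt_floor_add_one y
  have hX : ∀ n : ℕ, |∑ k ∈ Finset.Icc 1 n, (chiFun k : ℝ)| ≤ 1 := by
    intro n; rw [sum_chiFun]; split_ifs <;> norm_num
  have hchi : ∀ n : ℕ, |(chiFun n : ℝ)| ≤ 1 := by
    intro n; rw [chiFun_apply]; split_ifs <;> norm_num
  have htriv : ∀ n : ℕ, |(trivFun n : ℝ)| ≤ 1 := by
    intro n; rw [trivFun_apply]; split_ifs <;> norm_num
  have hbound : ∀ (K : ℝ) (G : ℕ → ℝ), (∀ n, |G n| ≤ K) → |∑ n ∈ Finset.Icc 1 Y, G n| ≤ Y * K := by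
    intro K G hG
    refine (Finset.abs_sum_le_sum_abs _ _).trans ((Finset.sum_le_sum fun n _ => hG n).trans ?_)
    simp
  have hT : ∀ t : ℝ, 0 ≤ t → |∑ k ∈ Finset.Icc 1 ⌊t⌋₊, (trivFun k : ℝ) - 2 / 3 * t| ≤ 2 := by
    intro t ht
    have h1 := abs_le.1 (sum_trivFun ⌊t⌋₊)
    have h2 := Nat.floor_le ht
    have h3 := Nat.lt_floor_add_one t
    rw [abs_le]; constructor <;> linarith [h1.1, h1.2]
  have b1 : |∑ m ∈ Finset.Icc 1 Y, (trivFun m : ℝ) * ∑ n ∈ Finset.Icc 1 ⌊x / m⌋₊, (chiFun n : ℝ)| ≤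
      Y * 1 := hbound 1 _ fun n => by
    rw [abs_mul]; exact mul_le_one₀ (htriv n) (abs_nonneg _) (hX _)
  have b3 : |(∑ m ∈ Finset.Icc 1 Y, (trivFun m : ℝ)) * ∑ n ∈ Finset.Icc 1 Y, (chiFun n : ℝ)| ≤
      Y * 1 := by
    rw [abs_mul]
    exact mul_le_mul (by simpa using hbound 1 _ htriv) (hX _) (abs_nonneg _) (by positivity)
  have b2 : |∑ n ∈ Finset.Icc 1 Y, (chiFun n : ℝ) * ∑ m ∈ Finset.Icc 1 ⌊x / n⌋₊, (trivFun m : ℝ) -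
      2 / 3 * x * ∑ n ∈ Finset.Icc 1 Y, (chiFun n : ℝ) / n| ≤ Y * 2 := by
    rw [Finset.mul_sum, ← Finset.sum_sub_distrib]
    refine hbound 2 _ fun n => ?_
    have : (chiFun n : ℝ) * ∑ m ∈ Finset.Icc 1 ⌊x / n⌋₊, (trivFun m : ℝ) -
        2 / 3 * x * ((chiFun n : ℝ) / n) = (chiFun n : ℝ) *
        (∑ m ∈ Finset.Icc 1 ⌊x / n⌋₊, (trivFun m : ℝ) - 2 / 3 * (x / n)) := by ring
    rw [this, abs_mul]
    calc _ ≤ 1 * 2 := mul_le_mul (hchi n) (hT _ (by positivity)) (abs_nonneg _) zero_le_one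
      _ = 2 := one_mul 2
  have b4 : |2 / 3 * x * (∑ n ∈ Finset.Icc 1 Y, (chiFun n : ℝ) / n - l)| ≤ 4 / 3 * y := by
    rw [abs_mul, abs_of_pos (by positivity)]
    refine (mul_le_mul_of_nonneg_left (hl Y) (by positivity)).trans ?_
    have : 2 / ((Y : ℝ) + 1) ≤ 2 / y := div_le_div_of_nonneg_left (by norm_num) (by linarith) hyY.le
    refine (mul_le_mul_of_nonneg_left this (by positivity)).trans (le_of_eq ?_)
    rw [← hyy]
    field_simp
    norm_num
  rw [abs_le] at *
  constructor <;> linarith [b1.1, b1.2, b2.1, b2.2, b3.1, b3.2, b4.1, b4.2]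

/-- The arithmetic function supported on the squares with value `w d` at `d ^ 2`. -/
noncomputable def onSquares (w : ArithmeticFunction ℤ) : ArithmeticFunction ℤ := by
  classical exact ⟨fun m => if IsSquare m then w m.sqrt else 0, by simp⟩

theorem onSquares_mul_self (w : ArithmeticFunction ℤ) (d : ℕ) : onSquares w (d * d) = w d := by
  simp [onSquares]

theorem onSquares_of_not {w : ArithmeticFunction ℤ} {m : ℕ} (h : ¬ IsSquare m) :
    onSquares w m = 0 := by
  simp [onSquares, h]

theorem sum_onSquares (w : ArithmeticFunction ℤ) (G : ℕ → ℝ) (N : ℕ) :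
    ∑ m ∈ Finset.Icc 1 N, (onSquares w m : ℝ) * G m =
      ∑ d ∈ Finset.Icc 1 N.sqrt, (w d : ℝ) * G (d * d) := by
  symm
  refine Finset.sum_of_injOn (fun d => d * d) ?_ ?_ ?_ ?_
  · intro a _ b _ h
    exact Nat.mul_self_inj.1 h
  · intro d hd
    simp only [Finset.coe_Icc, Set.mem_Icc] at hd ⊢
    exact ⟨Nat.mul_pos hd.1 hd.1, Nat.le_sqrt.1 hd.2⟩
  · intro m hm hm'
    rw [onSquares_of_not, Int.cast_zero, zero_mul]
    rintro ⟨d, rfl⟩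
    apply hm'
    rw [Finset.mem_Icc] at hm
    refine ⟨d, ?_, rfl⟩
    simp only [Finset.coe_Icc, Set.mem_Icc]
    exact ⟨Nat.pos_of_ne_zero (by rintro rfl; simp at hm), Nat.le_sqrt.2 hm.2⟩
  · intro d _
    rw [onSquares_mul_self]

/-- `onSquares` replaces `s` by `2s` in the Dirichlet series, which respects products. -/
theorem onSquares_mul (v w : ArithmeticFunction ℤ) :
    onSquares v * onSquares w = onSquares (v * w) := by
  ext n
  rw [ArithmeticFunction.mul_apply]
  by_cases hn : IsSquare n
  · obtain ⟨k, rfl⟩ := hn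
    rw [onSquares_mul_self, ArithmeticFunction.mul_apply]
    symm
    refine Finset.sum_of_injOn (fun p => (p.1 * p.1, p.2 * p.2)) ?_ ?_ ?_ ?_
    · rintro ⟨a, b⟩ _ ⟨c, d⟩ _ h
      simp only [Prod.mk.injEq] at h
      rw [Nat.mul_self_inj.1 h.1, Nat.mul_self_inj.1 h.2]
    · rintro ⟨a, b⟩ h
      simp only [Finset.mem_coe, Nat.mem_divisorsAntidiagonal] at h ⊢
      refine ⟨by rw [← h.1]; ring, mul_ne_zero h.2 h.2⟩
    · rintro ⟨a, b⟩ h h'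
      by_cases ha : IsSquare a
      · by_cases hb : IsSquare b
        · exfalso
          obtain ⟨c, rfl⟩ := ha
          obtain ⟨d, rfl⟩ := hb
          apply h'
          rw [Nat.mem_divisorsAntidiagonal] at h
          refine ⟨(c, d), ?_, rfl⟩
          simp only [Finset.mem_coe, Nat.mem_divisorsAntidiagonal]
          refine ⟨Nat.mul_self_inj.1 (by rw [← h.1]; ring), ?_⟩
          rintro rfl; simp at h
        · rw [onSquares_of_not hb, mul_zero]
      · rw [onSquares_of_not ha, zero_mul]
    · rintro ⟨a, b⟩ _
      rw [onSquares_mul_self, onSquares_mul_self]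
  · rw [onSquares_of_not hn]
    refine Finset.sum_eq_zero ?_
    rintro ⟨a, b⟩ h
    rw [Nat.mem_divisorsAntidiagonal] at h
    by_cases ha : IsSquare a
    · by_cases hb : IsSquare b
      · exact absurd (h.1 ▸ ha.mul hb) hn
      · rw [onSquares_of_not hb, mul_zero]
    · rw [onSquares_of_not ha, zero_mul]

theorem sqFun_eq : sqFun = onSquares trivFun := by
  ext n
  by_cases hn : IsSquare n
  · obtain ⟨d, rfl⟩ := hn
    rw [onSquares_mul_self]
    by_cases h : 3 ∣ d
    · simp [sqFun, trivFun, h, h.mul_right d]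
    · simp [sqFun, trivFun, h, Nat.prime_three.dvd_mul]
  · rw [onSquares_of_not hn]
    simp [sqFun, hn]

/-- Pointwise multiplication by a completely multiplicative function distributes over convolution,
so it carries `zeta * moebius = 1` to this identity. -/
theorem trivFun_mul_inverse : trivFun * pmul trivFun moebius = 1 := by
  have h : trivFun * pmul trivFun moebius = pmul trivFun (zeta * moebius) := by
    ext n
    rw [pmul_apply, ArithmeticFunction.mul_apply, ArithmeticFunction.mul_apply, Finset.mul_sum]
    refine Finset.sum_congr rfl ?_
    rintro ⟨a, b⟩ h
    rw [Nat.mem_divisorsAntidiagonal] at h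
    have ha : a ≠ 0 := by rintro rfl; simp at h; omega
    simp only [pmul_apply, natCoe_apply, zeta_apply, if_neg ha]
    rw [← h.1]
    by_cases h1 : 3 ∣ a <;> by_cases h2 : 3 ∣ b <;> simp [trivFun, h1, h2, Nat.prime_three.dvd_mul]
  rw [h, coe_zeta_mul_moebius]
  ext n
  by_cases hn : n = 1
  · subst hn; rw [pmul_apply]; simp [trivFun]
  · rw [pmul_apply, one_apply_ne hn, mul_zero]

theorem onSquares_one : onSquares 1 = 1 := by
  ext n
  by_cases hn : IsSquare n
  · obtain ⟨d, rfl⟩ := hn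
    rw [onSquares_mul_self, one_apply, one_apply]
    simp
  · rw [onSquares_of_not hn, one_apply_ne]
    rintro rfl; exact hn IsSquare.one

theorem primFun_eq : primFun = onSquares (pmul trivFun moebius) * (trivFun * chiFun) := by
  rw [← primFun_mul_sqFun, sqFun_eq, mul_comm primFun, ← mul_assoc, onSquares_mul,
    mul_comm (pmul _ _), trivFun_mul_inverse, onSquares_one, one_mul]

theorem exists_sum_div_sq {w : ℕ → ℝ} (hw : ∀ n, |w n| ≤ 1) : ∃ σ : ℝ, ∀ n : ℕ,
    |∑ d ∈ Finset.Icc 1 n, w d / (d : ℝ) ^ 2 - σ| ≤ 2 / (n + 1) := by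
  have hb : ∀ d : ℕ, |w d / (d : ℝ) ^ 2| ≤ ((d : ℝ) ^ 2)⁻¹ := by
    intro d
    rw [abs_div, abs_of_nonneg (by positivity : (0 : ℝ) ≤ (d : ℝ) ^ 2), div_eq_mul_inv]
    exact mul_le_of_le_one_left (by positivity) (hw d)
  have hsum : Summable fun d : ℕ => w d / (d : ℝ) ^ 2 :=
    Summable.of_norm_bounded (Real.summable_nat_pow_inv.2 (by norm_num : 1 < 2)) hb
  refine ⟨∑' d : ℕ, w d / (d : ℝ) ^ 2, fun n => ?_⟩
  have h1 : ∀ N, ∑ d ∈ Finset.range N, w d / (d : ℝ) ^ 2 =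
      ∑ d ∈ Finset.Ico 1 N, w d / (d : ℝ) ^ 2 := by
    intro N
    rcases Nat.eq_zero_or_pos N with rfl | hN
    · simp
    rw [Finset.range_eq_Ico, Finset.sum_eq_sum_Ico_succ_bot hN]
    simp
  have h2 := hsum.hasSum.tendsto_sum_nat
  simp only [h1] at h2
  rw [abs_sub_comm]
  refine le_of_tendsto ((h2.sub_const _).abs) ?_
  filter_upwards [eventually_ge_atTop (n + 1)] with N hN
  have h3 : Finset.Icc 1 n = Finset.Ico 1 (n + 1) := by ext; simp
  rw [h3, ← Finset.sum_Ico_consecutive _ (by omega : 1 ≤ n + 1) hN, add_sub_cancel_left]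
  refine (Finset.abs_sum_le_sum_abs _ _).trans ((Finset.sum_le_sum fun d _ => hb d).trans ?_)
  have h4 : Finset.Ico (n + 1) N = Finset.Ioo n N := by ext; simp
  rw [h4]
  exact sum_Ioo_inv_sq_le n N

theorem sqrt_floor {x : ℝ} (hx : 0 ≤ x) : ⌊x⌋₊.sqrt = ⌊√x⌋₊ := by
  refine le_antisymm ?_ ?_
  · rw [Nat.le_floor_iff (by positivity)]
    refine Real.le_sqrt_of_sq_le ?_
    have h1 : ((⌊x⌋₊.sqrt ^ 2 : ℕ) : ℝ) ≤ ⌊x⌋₊ := by exact_mod_cast Nat.sqrt_le' _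
    push_cast at h1
    exact h1.trans (Nat.floor_le hx)
  · rw [Nat.le_sqrt, Nat.le_floor_iff hx]
    have := Nat.floor_le (Real.sqrt_nonneg x)
    push_cast
    calc _ ≤ √x * √x := mul_self_le_mul_self (by positivity) this
      _ = x := Real.mul_self_sqrt hx

/-- By `primFun_eq` the sum is `∑ w(d) S(x / d^2)`, where `S` is the summatory function of `trivFun
* chiFun`. The errors `√x / d` sum to `√x (1 + log x)`. The value of `κ` is not needed yet; it is
read off later from the pole. -/
theorem exists_linearSum_primCount : ∃ κ, LinearSum (fun n => (primCount n : ℝ)) κ := by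
  obtain ⟨r, C, hC0, hC⟩ := sum_trivFun_mul_chiFun
  set w : ArithmeticFunction ℤ := pmul trivFun moebius with hw
  have hw1 : ∀ n, |(w n : ℝ)| ≤ 1 := by
    intro n
    have h1 : |trivFun n| ≤ 1 := by rw [trivFun_apply]; split_ifs <;> norm_num
    have h2 : |moebius n| ≤ 1 := abs_moebius_le_one
    rw [hw, pmul_apply]
    rw [← Int.cast_abs, abs_mul]
    exact_mod_cast mul_le_one₀ h1 (abs_nonneg _) h2
  obtain ⟨σ, hσ⟩ := exists_sum_div_sq hw1
  refine ⟨r * σ, C + 2 * |r|, fun x hx => ?_⟩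
  have hx0 : 0 < x := by linarith
  have hlog := Real.log_nonneg hx
  have hy1 : 1 ≤ √x := Real.one_le_sqrt.2 hx
  have hyy : √x * √x = x := Real.mul_self_sqrt hx0.le
  have e1 : ∑ n ∈ Finset.Icc 1 ⌊x⌋₊, (primCount n : ℝ) =
      ∑ m ∈ Finset.Icc 1 ⌊x⌋₊, (onSquares w m : ℝ) *
        ∑ n ∈ Finset.Icc 1 ⌊x / m⌋₊, ((trivFun * chiFun) n : ℝ) := by
    have h1 : ∀ n, (primCount n : ℝ) = (((onSquares w * (trivFun * chiFun)) n : ℤ) : ℝ) := by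
      intro n; rw [hw, ← primFun_eq]; simp [primFun]
    simp only [h1, ← Int.cast_sum]
    have h2 := sum_Ioc_mul_eq_sum_sum (onSquares w) (trivFun * chiFun) ⌊x⌋₊
    simp only [← Finset.Icc_add_one_left_eq_Ioc, zero_add] at h2
    rw [h2]
    push_cast
    refine Finset.sum_congr rfl fun m _ => ?_
    rw [Nat.floor_div_natCast]
  have e2 : ⌊x⌋₊.sqrt = ⌊√x⌋₊ := sqrt_floor hx0.le
  rw [e1, sum_onSquares w (fun m => ∑ n ∈ Finset.Icc 1 ⌊x / m⌋₊, ((trivFun * chiFun) n : ℝ)), e2]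
  set y := √x
  set Y := ⌊y⌋₊
  have hyY : y < Y + 1 := Nat.lt_floor_add_one y
  have hYy : (Y : ℝ) ≤ y := Nat.floor_le (by linarith)
  have b1 : |∑ d ∈ Finset.Icc 1 Y, (w d : ℝ) *
      ∑ n ∈ Finset.Icc 1 ⌊x / ((d * d : ℕ) : ℝ)⌋₊, ((trivFun * chiFun) n : ℝ) -
      r * x * ∑ d ∈ Finset.Icc 1 Y, (w d : ℝ) / (d : ℝ) ^ 2| ≤ C * y * (1 + Real.log x) := by
    rw [Finset.mul_sum, ← Finset.sum_sub_distrib]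
    have hd : ∀ d ∈ Finset.Icc 1 Y, |(w d : ℝ) *
        ∑ n ∈ Finset.Icc 1 ⌊x / ((d * d : ℕ) : ℝ)⌋₊, ((trivFun * chiFun) n : ℝ) -
        r * x * ((w d : ℝ) / (d : ℝ) ^ 2)| ≤ C * y * (d : ℝ)⁻¹ := by
      intro d hd
      rw [Finset.mem_Icc] at hd
      have hd1 : (1 : ℝ) ≤ d := by exact_mod_cast hd.1
      have hdy : (d : ℝ) ≤ y := le_trans (by exact_mod_cast hd.2) hYy
      have hxd : 1 ≤ x / ((d * d : ℕ) : ℝ) := by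
        rw [le_div_iff₀ (by push_cast; positivity), one_mul, ← hyy]
        push_cast
        exact mul_self_le_mul_self (by linarith) hdy
      have h1 := hC _ hxd
      have h2 : √(x / ((d * d : ℕ) : ℝ)) = y * (d : ℝ)⁻¹ := by
        rw [Real.sqrt_div hx0.le]
        push_cast
        rw [Real.sqrt_mul_self (by positivity), div_eq_mul_inv]
      rw [h2, ← mul_assoc] at h1
      have h3 : ∀ S : ℝ, (w d : ℝ) * S - r * x * ((w d : ℝ) / (d : ℝ) ^ 2) =
          (w d : ℝ) * (S - r * (x / ((d * d : ℕ) : ℝ))) := by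
        intro S; push_cast; ring
      rw [h3, abs_mul]
      calc _ ≤ 1 * _ := mul_le_mul (hw1 d) h1 (abs_nonneg _) zero_le_one
        _ = _ := one_mul _
    refine (Finset.abs_sum_le_sum_abs _ _).trans ((Finset.sum_le_sum hd).trans ?_)
    rw [← Finset.mul_sum]
    refine mul_le_mul_of_nonneg_left ?_ (by positivity)
    have h1 := harmonic_le_one_add_log Y
    rw [harmonic_eq_sum_Icc] at h1
    push_cast at h1
    refine h1.trans ?_
    have hY1 : (1 : ℝ) ≤ Y := by exact_mod_cast (Nat.one_le_floor_iff y).2 hy1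
    have := Real.log_le_log (by linarith) (hYy.trans (show y ≤ x by nlinarith))
    linarith
  have b2 : |r * x * (∑ d ∈ Finset.Icc 1 Y, (w d : ℝ) / (d : ℝ) ^ 2 - σ)| ≤ 2 * |r| * y := by
    rw [abs_mul, abs_mul, abs_of_pos hx0]
    refine (mul_le_mul_of_nonneg_left (hσ Y) (by positivity)).trans ?_
    have : 2 / ((Y : ℝ) + 1) ≤ 2 / y := div_le_div_of_nonneg_left (by norm_num) (by linarith) hyY.le
    refine (mul_le_mul_of_nonneg_left this (by positivity)).trans (le_of_eq ?_)
    rw [← hyy]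
    field_simp
  have b3 : 2 * |r| * y ≤ 2 * |r| * y * (1 + Real.log x) := by
    have : 0 ≤ 2 * |r| * y := by positivity
    nlinarith
  have e3 : (C + 2 * |r|) * (y * (1 + Real.log x)) =
      C * y * (1 + Real.log x) + 2 * |r| * y * (1 + Real.log x) := by ring
  rw [e3]
  rw [abs_le] at *
  constructor <;> linarith [b1.1, b1.2, b2.1, b2.2]

/-! ### Partial sums of `shapeCount`. -/

/-- The range `t ≥ 1/2` is required because the estimate is used at `√(x / 3)` with `x ≥ 1`. When
the floor is `0`, numerical bounds on Euler's constant suffice. -/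
theorem harmonic_floor_bound {t : ℝ} (ht : 1 / 2 ≤ t) :
    |∑ k ∈ Finset.Icc 1 ⌊t⌋₊, (1 : ℝ) / k - Real.log t - Real.eulerMascheroniConstant| ≤ 2 / t := by
  have ht0 : 0 < t := by linarith
  set n := ⌊t⌋₊ with hn
  have hnt : (n : ℝ) ≤ t := Nat.floor_le ht0.le
  have htn : t < n + 1 := Nat.lt_floor_add_one t
  have hH : ∑ k ∈ Finset.Icc 1 n, (1 : ℝ) / k = (harmonic n : ℝ) := by
    rw [harmonic_eq_sum_Icc]; push_cast; simp only [one_div]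
  rw [hH]
  rcases Nat.eq_zero_or_pos n with h0 | hpos
  · rw [h0, Nat.cast_zero, zero_add] at htn
    rw [h0, harmonic_zero, Rat.cast_zero, zero_sub]
    have h1 := Real.one_half_lt_eulerMascheroniConstant
    have h2 := Real.eulerMascheroniConstant_lt_two_thirds
    have h3 : Real.log t ≤ 0 := Real.log_nonpos ht0.le htn.le
    have h4 := Real.one_sub_inv_le_log_of_pos ht0
    have h5 : t⁻¹ ≤ 2 := by rw [inv_le_comm₀ ht0 (by norm_num)]; linarith
    have h6 : 2 ≤ 2 / t := by rw [le_div_iff₀ ht0]; linarith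
    rw [abs_le]; constructor <;> linarith
  · have hn1 : (1 : ℝ) ≤ n := by exact_mod_cast hpos
    have h1 := Real.eulerMascheroniSeq_lt_eulerMascheroniConstant n
    have h2 := Real.eulerMascheroniConstant_lt_eulerMascheroniSeq' n
    rw [Real.eulerMascheroniSeq] at h1
    rw [Real.eulerMascheroniSeq', if_neg hpos.ne'] at h2
    have h3 : Real.log (n + 1) - Real.log t ≤ 1 / t := by
      rw [← Real.log_div (by positivity) ht0.ne']
      refine (Real.log_le_sub_one_of_pos (by positivity)).trans ?_
      rw [div_sub_one ht0.ne']
      exact div_le_div_of_nonneg_right (by linarith) ht0.le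
    have h4 : -(2 / t) ≤ Real.log n - Real.log t := by
      rw [← Real.log_div (by positivity) ht0.ne']
      refine le_trans ?_ (Real.one_sub_inv_le_log_of_pos (by positivity))
      rw [inv_div, one_sub_div (by positivity), ← neg_div, div_le_div_iff₀ ht0 (by positivity)]
      nlinarith
    have h5 : 1 / t ≤ 2 / t := div_le_div_of_nonneg_right (by norm_num) ht0.le
    rw [abs_le]; constructor <;> linarith

/-- For fixed `b`, the constraints on `j ≥ 1` are `j < b` and `2j + b ≤ N / b`. -/
theorem sum_card_rhombPairs (N : ℕ) : ∑ m ∈ Finset.Icc 1 N, (rhombPairs m).card =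
    ∑ b ∈ Finset.Icc 1 N.sqrt, min (b - 1) ((N / b - b) / 2) := by
  have hdisj : ∀ m ∈ Finset.Icc 1 N, ∀ m' ∈ Finset.Icc 1 N, m ≠ m' →
      Disjoint (rhombPairs m) (rhombPairs m') := by
    intro m _ m' _ hne
    rw [Finset.disjoint_left]
    intro q h h'
    rw [mem_rhombPairs] at h h'
    exact hne (h.2.symm.trans h'.2)
  rw [← Finset.card_biUnion hdisj]
  have : (Finset.Icc 1 N).biUnion rhombPairs = ((Finset.Icc 1 N.sqrt).sigma
      (fun b => Finset.Icc 1 (min (b - 1) ((N / b - b) / 2)))).map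
      (Equiv.sigmaEquivProd ℕ ℕ).toEmbedding := by
    ext ⟨b, j⟩
    simp only [Finset.mem_biUnion, mem_rhombPairs, Finset.mem_Icc, Finset.mem_map_equiv,
      Finset.mem_sigma, Equiv.sigmaEquivProd_symm_apply]
    constructor
    · rintro ⟨m, hm, ⟨h1, h2⟩, h3⟩
      have hb : 0 < b := by omega
      have h4 : 2 * j + b ≤ N / b := (Nat.le_div_iff_mul_le hb).2 (by rw [mul_comm, h3]; exact hm.2)
      have h5 : b * b ≤ N := by nlinarith
      exact ⟨⟨hb, Nat.le_sqrt.2 h5⟩, by omega, by omega⟩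
    · rintro ⟨⟨h1, h2⟩, h3, h4⟩
      have h5 : 2 * j + b ≤ N / b := by omega
      have h6 := (Nat.le_div_iff_mul_le h1).1 h5
      exact ⟨_, ⟨Nat.mul_pos h1 (by omega), by rw [mul_comm]; exact h6⟩, ⟨by omega, by omega⟩, rfl⟩
  rw [this, Finset.card_map, Finset.card_sigma]
  simp

theorem sum_card_hexPairs (N : ℕ) :
    ∑ m ∈ Finset.Icc 1 N, (hexPairs m).card ≤ 2 * N.sqrt := by
  have hdisj : ∀ m ∈ Finset.Icc 1 N, ∀ m' ∈ Finset.Icc 1 N, m ≠ m' →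
      Disjoint (hexPairs m) (hexPairs m') := by
    intro m _ m' _ hne
    rw [Finset.disjoint_left]
    intro q h h'
    rw [mem_hexPairs] at h h'
    exact hne (h.2.symm.trans h'.2)
  rw [← Finset.card_biUnion hdisj]
  have : (Finset.Icc 1 N).biUnion hexPairs ⊆
      (Finset.Icc 1 N.sqrt).image (fun b => (b, 0)) ∪
        (Finset.Icc 1 N.sqrt).image fun b => (b, b) := by
    rintro ⟨b, j⟩ h
    simp only [Finset.mem_biUnion, mem_hexPairs, Finset.mem_Icc] at h
    obtain ⟨m, hm, ⟨h1, h2⟩, h3⟩ := h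
    have h5 : b * b ≤ N := by nlinarith
    have h6 := Nat.le_sqrt.2 h5
    simp only [Finset.mem_union, Finset.mem_image, Finset.mem_Icc, Prod.mk.injEq]
    rcases h2 with rfl | rfl
    · exact Or.inl ⟨b, ⟨h1, h6⟩, rfl, rfl⟩
    · exact Or.inr ⟨j, ⟨h1, h6⟩, rfl, rfl⟩
  refine (Finset.card_le_card this).trans ((Finset.card_union_le _ _).trans ?_)
  have h1 := Finset.card_image_le (s := Finset.Icc 1 N.sqrt) (f := fun b => (b, 0))
  have h2 := Finset.card_image_le (s := Finset.Icc 1 N.sqrt) (f := fun b => (b, b))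
  rw [Nat.card_Icc] at h1 h2
  omega

theorem sum_Icc_natCast (n : ℕ) : ∑ b ∈ Finset.Icc 1 n, (b : ℝ) = (n : ℝ) * (n + 1) / 2 := by
  induction n with
  | zero => simp
  | succ n ih =>
    rw [Finset.sum_Icc_succ_top (by omega), ih]
    push_cast; ring

theorem floor_mul_succ_bound {t : ℝ} (ht : 0 ≤ t) :
    |(⌊t⌋₊ : ℝ) * (⌊t⌋₊ + 1) - t * t| ≤ t := by
  have h1 := Nat.floor_le ht
  have h2 := Nat.lt_floor_add_one t
  have h0 : (0 : ℝ) ≤ ⌊t⌋₊ := by positivity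
  rw [abs_le]
  constructor
  · rcases le_or_gt t 1 with h | h <;> nlinarith
  · nlinarith

/-- The minimum changes branch where `b = (x / b - b) / 2`, that is at `b = √(x / 3)`. -/
theorem min_bound {x : ℝ} (hx : 0 ≤ x) {b : ℕ} (hb : 1 ≤ b) (hbx : (b : ℝ) ≤ √x) :
    |((min (b - 1) ((⌊x⌋₊ / b - b) / 2) : ℕ) : ℝ) -
      (if b ≤ ⌊√(x / 3)⌋₊ then (b : ℝ) else (x / b - b) / 2)| ≤ 1 := by
  have hb0 : (0 : ℝ) < b := by exact_mod_cast hb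
  have hbb : (b : ℝ) * b ≤ x := by
    have := mul_self_le_mul_self hb0.le hbx
    rwa [Real.mul_self_sqrt hx] at this
  rw [← Nat.floor_div_natCast]
  set q := ⌊x / b⌋₊ with hq
  have hq1 : (q : ℝ) ≤ x / b := Nat.floor_le (by positivity)
  have hq2 : x / b < q + 1 := Nat.lt_floor_add_one _
  have hbq : b ≤ q := by
    rw [hq, Nat.le_floor_iff (by positivity), le_div_iff₀ hb0]; exact hbb
  set r := (q - b) / 2 with hr
  have hr1 : (2 * r : ℝ) ≤ q - b := by
    have : 2 * r + b ≤ q := by omega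
    have : ((2 * r + b : ℕ) : ℝ) ≤ q := by exact_mod_cast this
    push_cast at this; linarith
  have hr2 : (q : ℝ) - b - 1 ≤ 2 * r := by
    have : q ≤ 2 * r + b + 1 := by omega
    have : (q : ℝ) ≤ ((2 * r + b + 1 : ℕ) : ℝ) := by exact_mod_cast this
    push_cast at this; linarith
  have hmin : ((min (b - 1) r : ℕ) : ℝ) = min ((b : ℝ) - 1) r := by
    rw [Nat.cast_min, Nat.cast_sub hb, Nat.cast_one]
  rw [hmin]
  have hiff : b ≤ ⌊√(x / 3)⌋₊ ↔ (b : ℝ) ≤ (x / b - b) / 2 := by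
    rw [Nat.le_floor_iff (by positivity), Real.le_sqrt (by positivity) (by positivity),
      le_div_iff₀ (by norm_num), le_div_iff₀ (by norm_num), le_sub_iff_add_le, le_div_iff₀ hb0]
    constructor <;> intro h <;> nlinarith
  split_ifs with h
  · rw [hiff] at h
    rw [abs_le]
    constructor
    · rcases min_cases ((b : ℝ) - 1) (r : ℝ) with h1 | h1 <;> linarith
    · have := min_le_left ((b : ℝ) - 1) r
      linarith
  · rw [hiff, not_le] at h
    rw [abs_le]
    constructor
    · rcases min_cases ((b : ℝ) - 1) (r : ℝ) with h1 | h1 <;> linarith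
    · have := min_le_right ((b : ℝ) - 1) r
      linarith

/-- With `y = √x` and `z = √(x / 3)` the quadratic terms `3 z^2 / 4` and `y^2 / 4` cancel. The
harmonic sums leave `(x / 2)(log y - log z) = x log 3 / 4`, Euler's constant dropping out. -/
theorem sum_rhomb_bound {x : ℝ} (hx : 1 ≤ x) :
    |∑ m ∈ Finset.Icc 1 ⌊x⌋₊, ((rhombPairs m).card : ℝ) - Real.log 3 / 4 * x| ≤ 6 * √x := by
  have hx0 : 0 < x := by linarith
  have e1 : ∑ m ∈ Finset.Icc 1 ⌊x⌋₊, ((rhombPairs m).card : ℝ) =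
      ∑ b ∈ Finset.Icc 1 ⌊√x⌋₊, ((min (b - 1) ((⌊x⌋₊ / b - b) / 2) : ℕ) : ℝ) := by
    rw [← sqrt_floor hx0.le]
    exact_mod_cast sum_card_rhombPairs ⌊x⌋₊
  rw [e1]
  set y := √x with hy
  set z := √(x / 3) with hz
  have hyy : y * y = x := Real.mul_self_sqrt hx0.le
  have hzz : z * z = x / 3 := Real.mul_self_sqrt (by positivity)
  have hy1 : 1 ≤ y := Real.one_le_sqrt.2 hx
  have hz0 : 0 ≤ z := Real.sqrt_nonneg _
  have hz1 : 1 / 2 ≤ z := by nlinarith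
  have hzy : z ≤ y := Real.sqrt_le_sqrt (by linarith)
  have hYy : (⌊y⌋₊ : ℝ) ≤ y := Nat.floor_le (by linarith)
  have hBY : ⌊z⌋₊ ≤ ⌊y⌋₊ := Nat.floor_le_floor hzy
  have b1 : |∑ b ∈ Finset.Icc 1 ⌊y⌋₊, ((min (b - 1) ((⌊x⌋₊ / b - b) / 2) : ℕ) : ℝ) -
      ∑ b ∈ Finset.Icc 1 ⌊y⌋₊, (if b ≤ ⌊z⌋₊ then (b : ℝ) else (x / b - b) / 2)| ≤ y := by
    rw [← Finset.sum_sub_distrib]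
    refine (Finset.abs_sum_le_sum_abs _ _).trans ((Finset.sum_le_sum (g := fun _ => (1 : ℝ))
      fun b hb => ?_).trans ?_)
    · rw [Finset.mem_Icc] at hb
      exact min_bound hx0.le hb.1 (le_trans (by exact_mod_cast hb.2) hYy)
    · simpa using hYy
  have e2 : ∑ b ∈ Finset.Icc 1 ⌊y⌋₊, (if b ≤ ⌊z⌋₊ then (b : ℝ) else (x / b - b) / 2) =
      3 / 2 * ∑ b ∈ Finset.Icc 1 ⌊z⌋₊, (b : ℝ) - 1 / 2 * ∑ b ∈ Finset.Icc 1 ⌊y⌋₊, (b : ℝ) +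
      x / 2 * (∑ b ∈ Finset.Icc 1 ⌊y⌋₊, (1 : ℝ) / b - ∑ b ∈ Finset.Icc 1 ⌊z⌋₊, (1 : ℝ) / b) := by
    have h : ∀ G : ℕ → ℝ, ∑ b ∈ Finset.Icc 1 ⌊z⌋₊, G b =
        ∑ b ∈ Finset.Icc 1 ⌊y⌋₊, if b ≤ ⌊z⌋₊ then G b else 0 := by
      intro G
      rw [← Finset.sum_filter]
      refine Finset.sum_congr ?_ fun _ _ => rfl
      ext b
      simp only [Finset.mem_filter, Finset.mem_Icc]
      omega
    rw [h, h, ← Finset.sum_sub_distrib, Finset.mul_sum, Finset.mul_sum, Finset.mul_sum,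
      ← Finset.sum_sub_distrib, ← Finset.sum_add_distrib]
    refine Finset.sum_congr rfl fun b _ => ?_
    split_ifs <;> ring
  have b2 := harmonic_floor_bound (show 1 / 2 ≤ y by linarith)
  have b3 := harmonic_floor_bound hz1
  have b4 := floor_mul_succ_bound (show 0 ≤ y by linarith)
  have b5 := floor_mul_succ_bound hz0
  rw [hyy] at b4
  rw [hzz] at b5
  have hlog : Real.log y - Real.log z = Real.log 3 / 2 := by
    rw [hy, hz, Real.log_sqrt hx0.le, Real.log_sqrt (by positivity),
      Real.log_div hx0.ne' (by norm_num)]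
    ring
  rw [sum_Icc_natCast, sum_Icc_natCast] at e2
  set Hy := ∑ b ∈ Finset.Icc 1 ⌊y⌋₊, (1 : ℝ) / b
  set Hz := ∑ b ∈ Finset.Icc 1 ⌊z⌋₊, (1 : ℝ) / b
  have b6 : |x / 2 * (Hy - Hz) - x / 2 * (Real.log 3 / 2)| ≤ x / 2 * (2 / y + 2 / z) := by
    rw [← mul_sub, abs_mul, abs_of_pos (by positivity)]
    refine mul_le_mul_of_nonneg_left ?_ (by positivity)
    rw [abs_le] at *
    constructor <;> linarith [b2.1, b2.2, b3.1, b3.2]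
  have b7 : x / 2 * (2 / y + 2 / z) ≤ 3 * y + y := by
    have h1 : x / 2 * (2 / y) = y := by
      rw [← hyy]; field_simp
    have h2 : x / 2 * (2 / z) = 3 * z := by
      have : x = 3 * (z * z) := by rw [hzz]; ring
      rw [this]
      have : z ≠ 0 := by positivity
      field_simp
    rw [mul_add, h1, h2]
    linarith
  rw [e2] at b1
  rw [abs_le] at *
  constructor <;> linarith [b1.1, b1.2, b4.1, b4.2, b5.1, b5.2, b6.1, b6.2]

theorem linearSum_shapeCount :
    LinearSum (fun n => (shapeCount n : ℝ)) (3 * Real.log 3 / 4) := by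
  -- `20 = 3 · 6 + 2`: three times the rhombic error plus the hexagonal pairs.
  refine LinearSum.of_sqrt_bound (C := 20) fun x hx => ?_
  have h1 := sum_rhomb_bound hx
  have h2 : ∑ m ∈ Finset.Icc 1 ⌊x⌋₊, ((hexPairs m).card : ℝ) ≤ 2 * √x := by
    have h : ((∑ m ∈ Finset.Icc 1 ⌊x⌋₊, (hexPairs m).card : ℕ) : ℝ) ≤
        ((2 * ⌊x⌋₊.sqrt : ℕ) : ℝ) := by exact_mod_cast sum_card_hexPairs ⌊x⌋₊
    rw [sqrt_floor (by linarith)] at h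
    push_cast at h
    linarith [Nat.floor_le (Real.sqrt_nonneg x)]
  have h3 : 0 ≤ ∑ m ∈ Finset.Icc 1 ⌊x⌋₊, ((hexPairs m).card : ℝ) :=
    Finset.sum_nonneg fun _ _ => by positivity
  have e : ∑ n ∈ Finset.Icc 1 ⌊x⌋₊, (shapeCount n : ℝ) =
      3 * ∑ m ∈ Finset.Icc 1 ⌊x⌋₊, ((rhombPairs m).card : ℝ) +
      ∑ m ∈ Finset.Icc 1 ⌊x⌋₊, ((hexPairs m).card : ℝ) := by
    rw [Finset.mul_sum, ← Finset.sum_add_distrib]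
    refine Finset.sum_congr rfl fun m _ => ?_
    rw [shapeCount]; push_cast; ring
  rw [e]
  rw [abs_le] at *
  constructor <;> linarith [h1.1, h1.2, Real.sqrt_nonneg x]

/-! ### The Dirichlet series of `shapeCount` near `s = 1`. -/

/-- Tonelli for the indicator of `q ∈ Q m`: grouping a nonnegative series over pairs by the value of
`φ`. -/
theorem tsum_card_mul {ι : Type*} [DecidableEq ι] (Q : ℕ → Finset ι) (R : ι → Prop)
    [DecidablePred R] (φ : ι → ℕ) (hQ : ∀ m q, q ∈ Q m ↔ R q ∧ φ q = m) {f : ℕ → ℝ}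
    (hf : ∀ m, 0 ≤ f m) (hs : Summable fun m => ((Q m).card : ℝ) * f m) :
    Summable (fun q => if R q then f (φ q) else 0) ∧
      ∑' m, ((Q m).card : ℝ) * f m = ∑' q, if R q then f (φ q) else 0 := by
  let F : ℕ × ι → ℝ := fun p => if p.2 ∈ Q p.1 then f p.1 else 0
  have h1 : ∀ m, HasSum (fun q => F (m, q)) (((Q m).card : ℝ) * f m) := by
    intro m
    have : ∑ q ∈ Q m, F (m, q) = ((Q m).card : ℝ) * f m := by
      rw [Finset.sum_congr rfl fun q hq => (if_pos hq : F (m, q) = f m), Finset.sum_const,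
        nsmul_eq_mul]
    rw [← this]
    exact hasSum_sum_of_ne_finset_zero fun q hq => if_neg hq
  have h2 : ∀ q, HasSum (fun m => F (m, q)) (if R q then f (φ q) else 0) := by
    intro q
    have e : (if R q then f (φ q) else 0) = F (φ q, q) := by
      simp only [F, hQ, and_true]
    rw [e]
    refine hasSum_single _ fun m hm => if_neg ?_
    rw [hQ]
    exact fun h => hm h.2.symm
  have hF0 : 0 ≤ F := fun p => by
    simp only [F]; split_ifs
    · exact hf _
    · exact le_rfl
  have hF : Summable F := by
    rw [summable_prod_of_nonneg hF0]
    refine ⟨fun m => (h1 m).summable, ?_⟩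
    simpa only [(h1 _).tsum_eq] using hs
  have h3 := hF.prod_symm.prod
  have h4 := Summable.tsum_comm (f := fun m q => F (m, q)) hF
  simp only [Prod.swap, (h1 _).tsum_eq, (h2 _).tsum_eq] at h3 h4
  exact ⟨h3, h4.symm ▸ rfl⟩

/-- The inner sum of the Dirichlet series of rhombic shapes. -/
noncomputable def rhombInner (s : ℝ) (b : ℕ) : ℝ :=
  ∑ j ∈ Finset.Ioo 0 b, ((2 * j + b : ℕ) : ℝ) ^ (-s)

/-- Sum over the pairs `(b, j)` instead of over `m`. The hexagonal pairs `(b, 0)` and `(b, b)` have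
products `b^2` and `3 b^2`. -/
theorem tsum_shapeCount {s : ℝ} (hs : 1 < s) :
    Summable (fun b : ℕ => (b : ℝ) ^ (-s) * rhombInner s b) ∧
    ∑' m, (shapeCount m : ℝ) * (m : ℝ) ^ (-s) =
      3 * ∑' b : ℕ, (b : ℝ) ^ (-s) * rhombInner s b +
      (1 + (3 : ℝ) ^ (-s)) * ∑' b : ℕ, (b : ℝ) ^ (-(2 * s)) := by
  have hf : ∀ m : ℕ, 0 ≤ (m : ℝ) ^ (-s) := fun m => by positivity
  have hS : Summable fun m => (shapeCount m : ℝ) * (m : ℝ) ^ (-s) := by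
    have h := linearSum_shapeCount.lSeriesSummable (fun n => by positivity)
      (show 1 < (s : ℂ).re by simpa using hs)
    rw [LSeriesSummable] at h
    have h' := h.norm
    refine h'.congr fun m => ?_
    rw [LSeries.norm_term_eq]
    rcases Nat.eq_zero_or_pos m with rfl | hm
    · simp [Real.zero_rpow (show -s ≠ 0 by linarith)]
    · rw [if_neg hm.ne', Complex.ofReal_re, Real.rpow_neg (by positivity), div_eq_mul_inv]
      simp
  have hS1 : Summable fun m => ((rhombPairs m).card : ℝ) * (m : ℝ) ^ (-s) := by
    refine hS.of_nonneg_of_le (fun m => by positivity) fun m => ?_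
    refine mul_le_mul_of_nonneg_right ?_ (hf m)
    rw [shapeCount]; push_cast
    nlinarith [Nat.cast_nonneg (α := ℝ) (rhombPairs m).card,
      Nat.cast_nonneg (α := ℝ) (hexPairs m).card]
  have hS2 : Summable fun m => ((hexPairs m).card : ℝ) * (m : ℝ) ^ (-s) := by
    refine hS.of_nonneg_of_le (fun m => by positivity) fun m => ?_
    refine mul_le_mul_of_nonneg_right ?_ (hf m)
    rw [shapeCount]; push_cast
    nlinarith [Nat.cast_nonneg (α := ℝ) (rhombPairs m).card,
      Nat.cast_nonneg (α := ℝ) (hexPairs m).card]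
  obtain ⟨a1, a2⟩ := tsum_card_mul rhombPairs (fun q => 0 < q.2 ∧ q.2 < q.1)
    (fun q => q.1 * (2 * q.2 + q.1)) (fun _ _ => mem_rhombPairs) hf hS1
  obtain ⟨b1, b2⟩ := tsum_card_mul hexPairs (fun q => 0 < q.1 ∧ (q.2 = 0 ∨ q.2 = q.1))
    (fun q => q.1 * (2 * q.2 + q.1)) (fun _ _ => mem_hexPairs) hf hS2
  have c1 : ∀ b : ℕ, ∑' j : ℕ, (if 0 < j ∧ j < b then ((b * (2 * j + b) : ℕ) : ℝ) ^ (-s) else 0) =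
      (b : ℝ) ^ (-s) * rhombInner s b := by
    intro b
    rw [tsum_eq_sum (s := Finset.Ioo 0 b), rhombInner, Finset.mul_sum]
    · refine Finset.sum_congr rfl fun j hj => ?_
      rw [Finset.mem_Ioo] at hj
      rw [if_pos hj, Nat.cast_mul, Real.mul_rpow (by positivity) (by positivity)]
    · intro j hj
      rw [Finset.mem_Ioo] at hj
      exact if_neg hj
  have c2 : ∀ b : ℕ, ∑' j : ℕ, (if 0 < b ∧ (j = 0 ∨ j = b) then
      ((b * (2 * j + b) : ℕ) : ℝ) ^ (-s) else 0) =
      (1 + (3 : ℝ) ^ (-s)) * (b : ℝ) ^ (-(2 * s)) := by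
    intro b
    rcases Nat.eq_zero_or_pos b with rfl | hb
    · simp [Real.zero_rpow (show -(2 * s) ≠ 0 by linarith)]
    rw [tsum_eq_sum (s := {0, b})]
    · rw [Finset.sum_pair hb.ne, if_pos ⟨hb, Or.inl rfl⟩, if_pos ⟨hb, Or.inr rfl⟩]
      have e1 : ((b * (2 * 0 + b) : ℕ) : ℝ) = (b : ℝ) ^ (2 : ℝ) := by push_cast; norm_num; ring
      have e2 : ((b * (2 * b + b) : ℕ) : ℝ) = 3 * (b : ℝ) ^ (2 : ℝ) := by push_cast; norm_num; ring
      rw [e1, e2, Real.mul_rpow (by norm_num) (by positivity), ← Real.rpow_mul (by positivity)]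
      ring_nf
    · intro j hj
      simp only [Finset.mem_insert, Finset.mem_singleton] at hj
      exact if_neg fun h => hj h.2
  have d1 := a1.prod
  have d2 := a1.tsum_prod
  have d4 := b1.tsum_prod
  simp only [c1] at d1 d2
  simp only [c2] at d4
  refine ⟨d1, ?_⟩
  rw [← d2, ← tsum_mul_left (a := 1 + (3 : ℝ) ^ (-s)), ← d4, ← a2, ← b2, ← tsum_mul_left,
    ← (hS1.mul_left 3).tsum_add hS2]
  refine tsum_congr fun m => ?_
  rw [shapeCount]; push_cast; ring

/-- The difference quotient `(1 - 3 ^ (1 - s)) / (2 (s - 1))`. -/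
noncomputable def halfQuot (s : ℝ) : ℝ := (1 - (3 : ℝ) ^ (1 - s)) / (2 * (s - 1))

/-- The defect of the Riemann sum `rhombInner`. -/
noncomputable def rhombDefect (s : ℝ) (b : ℕ) : ℝ :=
  (b : ℝ) ^ (1 - s) * halfQuot s - rhombInner s b

theorem integral_rpow_affine {s : ℝ} (hs : 1 < s) {b : ℕ} (hb : 0 < b) :
    ∫ t in (0 : ℝ)..(0 + b : ℝ), ((b : ℝ) + 2 * t) ^ (-s) = (b : ℝ) ^ (1 - s) * halfQuot s := by
  have hb' : (0 : ℝ) < b := by exact_mod_cast hb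
  have hd : ∀ t ∈ Set.uIcc (0 : ℝ) (0 + b), HasDerivAt
      (fun t : ℝ => -((b : ℝ) + 2 * t) ^ (1 - s) / (2 * (s - 1))) (((b : ℝ) + 2 * t) ^ (-s)) t := by
    intro t ht
    rw [Set.uIcc_of_le (by linarith), Set.mem_Icc] at ht
    have h0 : (0 : ℝ) < b + 2 * t := by linarith
    have h1 : HasDerivAt (fun t : ℝ => (b : ℝ) + 2 * t) 2 t := by
      simpa using ((hasDerivAt_id t).const_mul 2).const_add (b : ℝ)
    have h2 := ((h1.rpow_const (p := 1 - s) (Or.inl h0.ne')).neg).div_const (2 * (s - 1))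
    refine h2.congr_deriv ?_
    rw [show 1 - s - 1 = -s by ring]
    have : s - 1 ≠ 0 := by linarith
    field_simp
    ring
  have hint : IntervalIntegrable (fun t : ℝ => ((b : ℝ) + 2 * t) ^ (-s)) MeasureTheory.volume 0
      (0 + b) := by
    refine ContinuousOn.intervalIntegrable fun t ht => ContinuousAt.continuousWithinAt ?_
    rw [Set.uIcc_of_le (by linarith), Set.mem_Icc] at ht
    have h0 : (b : ℝ) + 2 * t ≠ 0 := by linarith
    exact ContinuousAt.rpow_const (by fun_prop) (Or.inl h0)
  rw [intervalIntegral.integral_eq_sub_of_hasDerivAt hd hint, halfQuot,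
    show (b : ℝ) + 2 * (0 + b) = 3 * b by ring, Real.mul_rpow (by norm_num) hb'.le, mul_zero,
    add_zero]
  ring

/-- The integrand decreases on `[0, b]`. The right Riemann sum is at least `rhombInner`, and the
left one is `rhombInner` plus the term `b^(-s)` at `0`. -/
theorem rhombDefect_bound {s : ℝ} (hs : 1 < s) {b : ℕ} (hb : 0 < b) :
    0 ≤ rhombDefect s b ∧ rhombDefect s b ≤ (b : ℝ) ^ (-s) := by
  have hb' : (0 : ℝ) < b := by exact_mod_cast hb
  have hanti : AntitoneOn (fun t : ℝ => ((b : ℝ) + 2 * t) ^ (-s)) (Set.Icc 0 (0 + b)) := by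
    intro t ht u hu htu
    rw [Set.mem_Icc] at ht
    exact Real.rpow_le_rpow_of_nonpos (by linarith) (by linarith) (by linarith)
  have h1 := hanti.sum_le_integral
  have h2 := hanti.integral_le_sum
  rw [integral_rpow_affine hs hb] at h1 h2
  have hr : Finset.range b = insert 0 (Finset.Ioo 0 b) := by
    ext j; simp only [Finset.mem_range, Finset.mem_insert, Finset.mem_Ioo]; omega
  have e2 : ∑ i ∈ Finset.range b, ((b : ℝ) + 2 * (0 + (i : ℝ))) ^ (-s) =
      (b : ℝ) ^ (-s) + rhombInner s b := by
    rw [hr, Finset.sum_insert (by simp), rhombInner]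
    congr 1
    · simp
    · refine Finset.sum_congr rfl fun j _ => ?_
      push_cast; ring_nf
  have e1 : rhombInner s b ≤
      ∑ i ∈ Finset.range b, ((b : ℝ) + 2 * (0 + ((i + 1 : ℕ) : ℝ))) ^ (-s) := by
    have hi : Finset.Ioo 0 b = (Finset.range (b - 1)).image (fun i => i + 1) := by
      ext j; simp only [Finset.mem_image, Finset.mem_range, Finset.mem_Ioo]
      constructor
      · intro h; exact ⟨j - 1, by omega, by omega⟩
      · rintro ⟨i, hi, rfl⟩; omega
    rw [rhombInner, hi, Finset.sum_image (by intro x _ y _ h; simpa using h)]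
    have : ∑ i ∈ Finset.range (b - 1), ((2 * (i + 1) + b : ℕ) : ℝ) ^ (-s) =
        ∑ i ∈ Finset.range (b - 1), ((b : ℝ) + 2 * (0 + ((i + 1 : ℕ) : ℝ))) ^ (-s) := by
      refine Finset.sum_congr rfl fun j _ => ?_
      push_cast; ring_nf
    rw [this]
    refine Finset.sum_le_sum_of_subset_of_nonneg ?_ fun i _ _ => by positivity
    intro i; simp only [Finset.mem_range]; omega
  rw [rhombDefect]
  constructor <;> linarith

theorem tendsto_halfQuot : Tendsto halfQuot (𝓝[>] 1) (𝓝 (Real.log 3 / 2)) := by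
  have h : HasDerivAt (fun s : ℝ => (3 : ℝ) ^ (1 - s)) (-Real.log 3) 1 := by
    have h1 : HasDerivAt (fun s : ℝ => 1 - s) (-1) 1 := by
      simpa using (hasDerivAt_id (1 : ℝ)).const_sub 1
    simpa using h1.const_rpow (show (0 : ℝ) < 3 by norm_num)
  have h2 := (hasDerivAt_iff_tendsto_slope.1 h).mono_left
    (nhdsWithin_mono 1 (fun x hx => ne_of_gt hx : Set.Ioi (1 : ℝ) ⊆ {1}ᶜ))
  have h3 := (h2.const_mul (-(1 / 2)))
  rw [show -(1 / 2) * -Real.log 3 = Real.log 3 / 2 by ring] at h3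
  refine h3.congr' ?_
  filter_upwards [self_mem_nhdsWithin] with s hs
  have : s - 1 ≠ 0 := sub_ne_zero.2 (ne_of_gt hs)
  rw [slope_def_field, halfQuot]
  norm_num
  field_simp
  ring

/-- The limit of `rhombDefect s b` at `s = 1`. -/
noncomputable def rhombDefectOne (b : ℕ) : ℝ :=
  Real.log 3 / 2 - ∑ j ∈ Finset.Ioo 0 b, ((2 * j + b : ℕ) : ℝ)⁻¹

theorem tendsto_rhombDefect {b : ℕ} (hb : 0 < b) :
    Tendsto (fun s => rhombDefect s b) (𝓝[>] 1) (𝓝 (rhombDefectOne b)) := by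
  have hb' : (b : ℝ) ≠ 0 := by exact_mod_cast hb.ne'
  have h1 : Tendsto (fun s : ℝ => (b : ℝ) ^ (1 - s)) (𝓝[>] 1) (𝓝 1) := by
    have : Continuous fun s : ℝ => (b : ℝ) ^ (1 - s) :=
      continuous_const.rpow (by fun_prop) fun s => Or.inl hb'
    have h := this.tendsto 1
    simp only [sub_self, Real.rpow_zero] at h
    exact h.mono_left nhdsWithin_le_nhds
  have h2 : Tendsto (fun s : ℝ => rhombInner s b) (𝓝[>] 1)
      (𝓝 (∑ j ∈ Finset.Ioo 0 b, ((2 * j + b : ℕ) : ℝ)⁻¹)) := by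
    refine tendsto_finsetSum _ fun j _ => ?_
    have h0 : ((2 * j + b : ℕ) : ℝ) ≠ 0 := by exact_mod_cast (by omega : 2 * j + b ≠ 0)
    have : Continuous fun s : ℝ => ((2 * j + b : ℕ) : ℝ) ^ (-s) :=
      continuous_const.rpow (by fun_prop) fun s => Or.inl h0
    have h := this.tendsto 1
    rw [Real.rpow_neg_one] at h
    exact h.mono_left nhdsWithin_le_nhds
  have := (h1.mul tendsto_halfQuot).sub h2
  rw [one_mul] at this
  exact this

theorem rhombDefectOne_bound {b : ℕ} (hb : 0 < b) :
    0 ≤ rhombDefectOne b ∧ rhombDefectOne b ≤ (b : ℝ)⁻¹ := by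
  have hb' : (b : ℝ) ≠ 0 := by exact_mod_cast hb.ne'
  constructor
  · refine ge_of_tendsto (tendsto_rhombDefect hb) ?_
    filter_upwards [self_mem_nhdsWithin] with s hs using (rhombDefect_bound hs hb).1
  · have h : Tendsto (fun s : ℝ => (b : ℝ) ^ (-s)) (𝓝[>] 1) (𝓝 (b : ℝ)⁻¹) := by
      have : Continuous fun s : ℝ => (b : ℝ) ^ (-s) :=
        continuous_const.rpow (by fun_prop) fun s => Or.inl hb'
      have h := this.tendsto 1
      rw [Real.rpow_neg_one] at h
      exact h.mono_left nhdsWithin_le_nhds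
    refine le_of_tendsto_of_tendsto (tendsto_rhombDefect hb) h ?_
    filter_upwards [self_mem_nhdsWithin] with s hs using (rhombDefect_bound hs hb).2

/-- Dominated convergence: defect and weight are each at most `b^(-s) ≤ b^(-1)`, so `b^(-2)` is a
majorant. -/
theorem tendsto_tsum_rhombDefect :
    Tendsto (fun s : ℝ => ∑' b : ℕ, (b : ℝ) ^ (-s) * rhombDefect s b) (𝓝[>] 1)
      (𝓝 (∑' b : ℕ, (b : ℝ)⁻¹ * rhombDefectOne b)) := by
  refine tendsto_tsum_of_dominated_convergence (bound := fun b : ℕ => ((b : ℝ) ^ 2)⁻¹)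
    (Real.summable_nat_pow_inv.2 (by norm_num)) (fun b => ?_) ?_
  · rcases Nat.eq_zero_or_pos b with rfl | hb
    · refine tendsto_const_nhds.congr' ?_
      filter_upwards [self_mem_nhdsWithin] with s hs
      have : -s ≠ 0 := by have : (1 : ℝ) < s := hs; linarith
      simp [Real.zero_rpow this]
    · have hb' : (b : ℝ) ≠ 0 := by exact_mod_cast hb.ne'
      have : Continuous fun s : ℝ => (b : ℝ) ^ (-s) :=
        continuous_const.rpow (by fun_prop) fun s => Or.inl hb'
      have h := this.tendsto 1
      rw [Real.rpow_neg_one] at h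
      exact (h.mono_left nhdsWithin_le_nhds).mul (tendsto_rhombDefect hb)
  · filter_upwards [self_mem_nhdsWithin] with s hs b
    have hs' : (1 : ℝ) < s := hs
    rcases Nat.eq_zero_or_pos b with rfl | hb
    · simp [Real.zero_rpow (show -s ≠ 0 by linarith)]
    · obtain ⟨h1, h2⟩ := rhombDefect_bound hs hb
      have hb1 : (1 : ℝ) ≤ b := by exact_mod_cast hb
      have h3 : (b : ℝ) ^ (-s) ≤ (b : ℝ)⁻¹ := by
        rw [← Real.rpow_neg_one]
        exact Real.rpow_le_rpow_of_exponent_le hb1 (by linarith)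
      rw [Real.norm_of_nonneg (by positivity), sq, mul_inv]
      exact mul_le_mul h3 (h2.trans h3) h1 (by positivity)

theorem summable_rhombDefectOne : Summable fun b : ℕ => (b : ℝ)⁻¹ * rhombDefectOne b := by
  refine (Real.summable_nat_pow_inv.2 (by norm_num : 1 < 2)).of_nonneg_of_le (fun b => ?_)
    fun b => ?_
  · rcases Nat.eq_zero_or_pos b with rfl | hb
    · simp
    · exact mul_nonneg (by positivity) (rhombDefectOne_bound hb).1
  · rcases Nat.eq_zero_or_pos b with rfl | hb
    · simp
    · rw [sq, mul_inv]
      exact mul_le_mul_of_nonneg_left (rhombDefectOne_bound hb).2 (by positivity)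

theorem rhombDefectOne_even (p : ℕ) :
    ((2 * p : ℕ) : ℝ)⁻¹ * rhombDefectOne (2 * p) = evenTerm p / 4 := by
  have : ∑ j ∈ Finset.Ioo 0 (2 * p), ((2 * j + 2 * p : ℕ) : ℝ)⁻¹ =
      (1 / 2) * ∑ q ∈ Finset.Ioo p (3 * p), 1 / (q : ℝ) := by
    rw [Finset.mul_sum]
    refine Finset.sum_bij' (fun j _ => j + p) (fun q _ => q - p) ?_ ?_ ?_ ?_ ?_
    · intro j hj; rw [Finset.mem_Ioo] at *; omega
    · intro j hj; rw [Finset.mem_Ioo] at *; omega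
    · intro j hj; omega
    · intro j hj; rw [Finset.mem_Ioo] at hj; omega
    · intro j hj
      rw [← mul_add]; push_cast
      rw [mul_inv]; ring
  rw [rhombDefectOne, this, evenTerm]
  push_cast
  rw [mul_inv]
  ring

/-- Substitute `l = j + k`, so that `2j + 2k + 1 = 2l + 1`. -/
theorem rhombDefectOne_odd (k : ℕ) :
    ((2 * k + 1 : ℕ) : ℝ)⁻¹ * rhombDefectOne (2 * k + 1) = oddTerm k / 4 := by
  have : ∑ j ∈ Finset.Ioo 0 (2 * k + 1), ((2 * j + (2 * k + 1) : ℕ) : ℝ)⁻¹ =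
      ∑ l ∈ Finset.Ioc k (3 * k), 1 / (2 * (l : ℝ) + 1) := by
    refine Finset.sum_bij' (fun j _ => j + k) (fun q _ => q - k) ?_ ?_ ?_ ?_ ?_
    · intro j hj; rw [Finset.mem_Ioo] at hj; rw [Finset.mem_Ioc]; omega
    · intro j hj; rw [Finset.mem_Ioc] at hj; rw [Finset.mem_Ioo]; omega
    · intro j hj; omega
    · intro j hj; rw [Finset.mem_Ioc] at hj; omega
    · intro j hj
      rw [← add_assoc, ← mul_add]; push_cast
      rw [one_div]
  rw [rhombDefectOne, this, oddTerm]
  push_cast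
  ring

theorem summable_evenTerm : Summable fun p : ℕ => evenTerm (p + 1) := by
  have h := summable_rhombDefectOne.comp_injective
    (show Function.Injective fun p : ℕ => 2 * (p + 1) from fun a b h => by simpa using h)
  refine (h.mul_left 4).congr fun p => ?_
  simp only [Function.comp]
  rw [rhombDefectOne_even]; ring

theorem summable_oddTerm : Summable oddTerm := by
  have h := summable_rhombDefectOne.comp_injective
    (show Function.Injective fun p : ℕ => 2 * p + 1 from fun a b h => by simpa using h)
  refine (h.mul_left 4).congr fun p => ?_
  simp only [Function.comp]
  rw [rhombDefectOne_odd]; ring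

theorem tsum_rhombDefectOne : ∑' b : ℕ, (b : ℝ)⁻¹ * rhombDefectOne b =
    (∑' p : ℕ, evenTerm (p + 1) + ∑' k : ℕ, oddTerm k) / 4 := by
  have h1 := summable_rhombDefectOne.comp_injective
    (show Function.Injective fun p : ℕ => 2 * p from fun a b h => by simpa using h)
  have h2 := summable_rhombDefectOne.comp_injective
    (show Function.Injective fun p : ℕ => 2 * p + 1 from fun a b h => by simpa using h)
  rw [← tsum_even_add_odd (f := fun b : ℕ => (b : ℝ)⁻¹ * rhombDefectOne b) h1 h2]
  simp only [rhombDefectOne_even, rhombDefectOne_odd]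
  have h3 : Summable fun p : ℕ => evenTerm p / 4 := h1.congr fun p => rhombDefectOne_even p
  -- The even term at `p = 0` vanishes because `1 / 0 = 0`, which accounts for the shift to `p + 1`.
  rw [h3.tsum_eq_zero_add, tsum_div_const, tsum_div_const]
  simp [evenTerm]
  ring

/-! ### Reading off polar parts along the real axis. -/

/-- Multiplying by `t - 1` and letting `t` tend to `1` identifies the residues; the constant terms
follow by cancelling the poles. -/
theorem polar_unique {κ κ' G G' : ℂ} {g h : ℝ → ℂ} (hg : Tendsto g (𝓝[>] 1) (𝓝 G))
    (hh : Tendsto h (𝓝[>] 1) (𝓝 G'))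
    (heq : ∀ t : ℝ, 1 < t → κ / ((t : ℂ) - 1) + g t = κ' / ((t : ℂ) - 1) + h t) :
    κ = κ' ∧ G = G' := by
  have hκ : κ = κ' := by
    have h1 : Tendsto (fun t : ℝ => ((t : ℂ) - 1) * (h t - g t)) (𝓝[>] 1) (𝓝 (0 * (G' - G))) := by
      refine Tendsto.mul ?_ (hh.sub hg)
      have : Continuous fun t : ℝ => (t : ℂ) - 1 := by fun_prop
      have h := this.tendsto 1
      simp only [Complex.ofReal_one, sub_self] at h
      exact h.mono_left nhdsWithin_le_nhds
    rw [zero_mul] at h1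
    have h2 : Tendsto (fun _ : ℝ => κ - κ') (𝓝[>] (1 : ℝ)) (𝓝 0) := by
      refine h1.congr' ?_
      filter_upwards [self_mem_nhdsWithin] with t ht
      have h0 : (t : ℂ) - 1 ≠ 0 := by
        rw [sub_ne_zero]; exact_mod_cast (ne_of_gt ht : t ≠ 1)
      have := heq t ht
      field_simp at this
      linear_combination -this
    exact sub_eq_zero.1 (tendsto_nhds_unique tendsto_const_nhds h2)
  refine ⟨hκ, tendsto_nhds_unique hg (hh.congr' ?_)⟩
  filter_upwards [self_mem_nhdsWithin] with t ht
  have := heq t ht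
  rw [hκ] at this
  exact (add_left_cancel this).symm

theorem tendsto_ofReal_nhdsGT : Tendsto (fun t : ℝ => (t : ℂ)) (𝓝[>] 1) (𝓝[≠] 1) := by
  refine tendsto_nhdsWithin_iff.2 ⟨?_, ?_⟩
  · have h := Complex.continuous_ofReal.tendsto 1
    rw [Complex.ofReal_one] at h
    exact h.mono_left nhdsWithin_le_nhds
  · filter_upwards [self_mem_nhdsWithin] with t ht
    rw [Set.mem_compl_iff, Set.mem_singleton_iff]
    exact_mod_cast (ne_of_gt ht : t ≠ 1)

theorem LinearSum.polar_eq {a : ℕ → ℝ} {κ : ℝ} (h : LinearSum a κ) (ha : ∀ n, 0 ≤ a n) {κ' G : ℂ}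
    {f : ℝ → ℂ} (hf : Tendsto f (𝓝[>] 1) (𝓝 G))
    (heq : ∀ t : ℝ, 1 < t → LSeries (fun n => (a n : ℂ)) t = κ' / ((t : ℂ) - 1) + f t) :
    (κ : ℂ) = κ' ∧ (polarConst a κ : ℂ) = G := by
  refine polar_unique (g := fun t : ℝ => polarRem a κ t) ?_ hf fun t ht => ?_
  · rw [← polarRem_one]
    exact h.analyticAt_polarRem.continuousAt.tendsto.comp
      (tendsto_ofReal_nhdsGT.mono_right nhdsWithin_le_nhds)
  · rw [← heq t ht, h.lSeries_eq ha (by simpa using ht)]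

theorem ofReal_tsum_rpow {u : ℝ} (hu : 1 < u) :
    ((∑' b : ℕ, (b : ℝ) ^ (-u) : ℝ) : ℂ) = riemannZeta u := by
  rw [zeta_eq_tsum_one_div_nat_cpow (by simpa using hu), Complex.ofReal_tsum]
  refine tsum_congr fun n => ?_
  rw [Complex.ofReal_cpow (by positivity), Complex.ofReal_neg, Complex.cpow_neg, one_div,
    Complex.ofReal_natCast]

/-- The integral `b^(1-s) halfQuot s`, weighted by `b^(-s)`, sums to `halfQuot s * ζ(2s - 1)`; this
isolates the pole from the convergent defect series. -/
theorem lSeries_shapeCount {s : ℝ} (hs : 1 < s) :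
    LSeries (fun n => ((shapeCount n : ℝ) : ℂ)) s =
      3 * (halfQuot s * riemannZeta (2 * s - 1) -
        (∑' b : ℕ, (b : ℝ) ^ (-s) * rhombDefect s b : ℝ)) +
      (1 + ((3 : ℝ) ^ (-s) : ℝ)) * riemannZeta (2 * s) := by
  obtain ⟨h1, h2⟩ := tsum_shapeCount hs
  have e1 : LSeries (fun n => ((shapeCount n : ℝ) : ℂ)) s =
      ((∑' m, (shapeCount m : ℝ) * (m : ℝ) ^ (-s) : ℝ) : ℂ) := by
    rw [LSeries, Complex.ofReal_tsum]
    refine tsum_congr fun m => ?_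
    rcases Nat.eq_zero_or_pos m with rfl | hm
    · simp [Real.zero_rpow (show -s ≠ 0 by linarith)]
    · rw [LSeries.term_of_ne_zero hm.ne', Complex.ofReal_mul, Complex.ofReal_cpow (by positivity),
        Complex.ofReal_neg, Complex.cpow_neg, div_eq_mul_inv, Complex.ofReal_natCast m]
  have hz : Summable fun b : ℕ => (b : ℝ) ^ (-(2 * s - 1)) := by
    rw [Real.summable_nat_rpow]; linarith
  have e3 : ∀ b : ℕ, (b : ℝ) ^ (-s) * rhombDefect s b =
      halfQuot s * (b : ℝ) ^ (-(2 * s - 1)) - (b : ℝ) ^ (-s) * rhombInner s b := by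
    intro b
    rcases Nat.eq_zero_or_pos b with rfl | hb
    · simp [Real.zero_rpow (show -s ≠ 0 by linarith),
        Real.zero_rpow (show 1 - 2 * s ≠ 0 by linarith)]
    · rw [rhombDefect, mul_sub, ← mul_assoc, ← Real.rpow_add (by exact_mod_cast hb),
        show -s + (1 - s) = -(2 * s - 1) by ring, mul_comm (halfQuot s)]
  have e2 : ∑' b : ℕ, (b : ℝ) ^ (-s) * rhombInner s b =
      halfQuot s * ∑' b : ℕ, (b : ℝ) ^ (-(2 * s - 1)) -
        ∑' b : ℕ, (b : ℝ) ^ (-s) * rhombDefect s b := by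
    simp only [e3]
    rw [(hz.mul_left _).tsum_sub h1, tsum_mul_left]
    ring
  have z1 := ofReal_tsum_rpow (show 1 < 2 * s - 1 by linarith)
  have z2 := ofReal_tsum_rpow (show 1 < 2 * s by linarith)
  push_cast at z1 z2
  rw [e1, h2, e2]
  push_cast
  rw [z1, z2]

/-- The next Taylor coefficient of `3^(1-s) = exp(-(s - 1) log 3)`; the cubic remainder of the
exponential gives a bound `O(s - 1)`. -/
theorem tendsto_halfQuot_slope :
    Tendsto (fun s => (halfQuot s - Real.log 3 / 2) / (s - 1)) (𝓝[>] 1)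
      (𝓝 (-(Real.log 3 ^ 2 / 4))) := by
  set L := Real.log 3 with hL
  have hL0 : 0 < L := Real.log_pos (by norm_num)
  rw [tendsto_iff_norm_sub_tendsto_zero]
  have hlim : Tendsto (fun s : ℝ => (s - 1) * L ^ 3) (𝓝[>] 1) (𝓝 0) := by
    have : Continuous fun s : ℝ => (s - 1) * L ^ 3 := by fun_prop
    have h := this.tendsto 1
    rw [sub_self, zero_mul] at h
    exact h.mono_left nhdsWithin_le_nhds
  refine squeeze_zero' (Eventually.of_forall fun _ => norm_nonneg _) ?_ hlim
  have hnear : ∀ᶠ s : ℝ in 𝓝[>] 1, s < 1 + 1 / L :=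
    mem_nhdsWithin_of_mem_nhds (Iio_mem_nhds (by linarith [one_div_pos.2 hL0]))
  filter_upwards [self_mem_nhdsWithin, hnear] with s hs hs2
  have hu : 0 < s - 1 := sub_pos.2 hs
  have hx : |-(s - 1) * L| ≤ 1 := by
    rw [abs_mul, abs_neg, abs_of_pos hu, abs_of_pos hL0, ← le_div_iff₀ hL0]
    linarith
  have hexp := Real.exp_bound hx (show 0 < 3 by norm_num)
  have h3 : (3 : ℝ) ^ (1 - s) = Real.exp (-(s - 1) * L) := by
    rw [Real.rpow_def_of_pos (by norm_num), ← hL]; ring_nf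
  rw [← h3] at hexp
  simp only [Finset.sum_range_succ, Finset.range_zero, Finset.sum_empty] at hexp
  norm_num [Nat.factorial] at hexp
  rw [abs_sub_comm 1 s, abs_of_pos hu, abs_of_pos hL0] at hexp
  have e : (halfQuot s - L / 2) / (s - 1) - -(L ^ 2 / 4) =
      -((3 : ℝ) ^ (1 - s) - (1 + (1 - s) * L + ((1 - s) * L) ^ 2 / 2)) / (2 * (s - 1) ^ 2) := by
    rw [halfQuot]
    field_simp
    ring
  rw [e, Real.norm_eq_abs, abs_div, abs_neg, abs_of_pos (show 0 < 2 * (s - 1) ^ 2 by positivity),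
    div_le_iff₀ (by positivity)]
  refine hexp.trans ?_
  have : 0 < ((s - 1) * L) ^ 3 := by positivity
  nlinarith

/-- With `t = log 3`, multiply `halfQuot s = t/2 - (t^2/4)(s - 1) + …` by `ζ(2s - 1) = 1 / (2(s -
1)) + γ + …`: the constant term is `γ t / 2 - t^2 / 8`. -/
theorem polarConst_shapeCount :
    (polarConst (fun n => (shapeCount n : ℝ)) (3 * Real.log 3 / 4) : ℂ) =
      3 * (Real.eulerMascheroniConstant * Real.log 3 / 2 - Real.log 3 ^ 2 / 8 -
        (((∑' p : ℕ, evenTerm (p + 1) : ℝ) : ℂ) + ((∑' k : ℕ, oddTerm k : ℝ) : ℂ)) / 4) +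
      4 / 3 * riemannZeta 2 := by
  have c : ∀ {f : ℝ → ℝ} {y : ℝ}, Tendsto f (𝓝[>] 1) (𝓝 y) →
      Tendsto (fun t => (f t : ℂ)) (𝓝[>] 1) (𝓝 (y : ℂ)) := fun h =>
    (Complex.continuous_ofReal.tendsto _).comp h
  have hz1 : Tendsto (fun t : ℝ => riemannZeta (2 * t - 1) - 1 / ((2 * t - 1 : ℂ) - 1)) (𝓝[>] 1)
      (𝓝 (Real.eulerMascheroniConstant : ℂ)) := by
    have h : Tendsto (fun t : ℝ => 2 * t - 1) (𝓝[>] 1) (𝓝[>] 1) := by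
      refine tendsto_nhdsWithin_iff.2 ⟨?_, ?_⟩
      · have : Continuous fun t : ℝ => 2 * t - 1 := by fun_prop
        have h := this.tendsto 1
        norm_num at h
        exact h.mono_left nhdsWithin_le_nhds
      · filter_upwards [self_mem_nhdsWithin] with t ht
        have : (1 : ℝ) < t := ht
        rw [Set.mem_Ioi]; linarith
    have := tendsto_riemannZeta_sub_one_div.comp (tendsto_ofReal_nhdsGT.comp h)
    refine this.congr fun t => ?_
    simp [Function.comp]
  have hz2 : Tendsto (fun t : ℝ => (1 + ((3 : ℝ) ^ (-t) : ℝ)) * riemannZeta (2 * t)) (𝓝[>] 1)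
      (𝓝 (4 / 3 * riemannZeta 2)) := by
    refine Tendsto.mul ?_ ?_
    · have : Continuous fun t : ℝ => (3 : ℝ) ^ (-t) :=
        continuous_const.rpow (by fun_prop) fun s => Or.inl (by norm_num)
      have h := this.tendsto 1
      rw [Real.rpow_neg_one] at h
      have h' := (c (h.mono_left nhdsWithin_le_nhds)).const_add 1
      convert h' using 2
      push_cast; norm_num
    · have h := (differentiableAt_riemannZeta (show (2 : ℂ) ≠ 1 by norm_num)).continuousAt.tendsto
      have h2 : Tendsto (fun t : ℝ => (2 * t : ℂ)) (𝓝[>] 1) (𝓝 2) := by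
        have : Continuous fun t : ℝ => (2 * t : ℂ) := by fun_prop
        have h := this.tendsto 1
        norm_num at h
        exact h.mono_left nhdsWithin_le_nhds
      exact h.comp h2
  have key := ((((c tendsto_halfQuot).mul hz1).add ((c tendsto_halfQuot_slope).div_const 2)).sub
    (c tendsto_tsum_rhombDefect)).const_mul 3 |>.add hz2
  rw [(linearSum_shapeCount.polar_eq (fun n => by positivity)
    (κ' := 3 * Real.log 3 / 4) key fun t ht => ?_).2, tsum_rhombDefectOne]
  · push_cast
    ring
  · rw [lSeries_shapeCount ht]
    have h0 : (t : ℂ) - 1 ≠ 0 := by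
      rw [sub_ne_zero]; exact_mod_cast (ne_of_gt ht : t ≠ 1)
    have h1 : (2 * t - 1 : ℂ) - 1 = 2 * (t - 1) := by ring
    rw [h1]
    push_cast
    field_simp
    ring

/-! ### The Dirichlet series of `primCount` near `s = 1`. -/

theorem chiFun_eq (n : ℕ) : ((chiFun n : ℤ) : ℂ) = chiNegThree n := by
  simp [chiFun, chiNegThree]

theorem trivFun_eq (n : ℕ) : ((trivFun n : ℤ) : ℂ) = (1 : DirichletCharacter ℂ 3) n := by
  by_cases h : 3 ∣ n
  · have : ¬ IsUnit (n : ZMod 3) := by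
      rw [ZMod.isUnit_iff_coprime, Nat.coprime_comm, Nat.prime_three.coprime_iff_not_dvd, not_not]
      exact h
    rw [MulChar.map_nonunit _ this]
    simp [trivFun, h]
  · have : IsUnit (n : ZMod 3) := by
      rw [ZMod.isUnit_iff_coprime, Nat.coprime_comm, Nat.prime_three.coprime_iff_not_dvd]
      exact h
    rw [MulChar.one_apply this]
    simp [trivFun, h]

theorem lSeries_trivFun {s : ℂ} (hs : 1 < s.re) :
    LSeries (fun n => ((trivFun n : ℤ) : ℂ)) s = (1 - (3 : ℂ) ^ (-s)) * riemannZeta s := by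
  have h1 : s ≠ 1 := by rintro rfl; simp at hs
  have := DirichletCharacter.LFunctionTrivChar_eq_mul_riemannZeta (N := 3) h1
  rw [DirichletCharacter.LFunctionTrivChar, DirichletCharacter.LFunction_eq_LSeries _ hs,
    Nat.Prime.primeFactors Nat.prime_three, Finset.prod_singleton] at this
  simp only [trivFun_eq]
  exact_mod_cast this

theorem lSeriesSummable_of_le_one {f : ArithmeticFunction ℤ} (hf : ∀ n, |f n| ≤ 1) {s : ℂ}
    (hs : 1 < s.re) : LSeriesSummable (fun n => ((f n : ℤ) : ℂ)) s := by
  refine LSeriesSummable_of_bounded_of_one_lt_re (m := 1) (fun n _ => ?_) hs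
  rw [Complex.norm_intCast]
  exact_mod_cast hf n

theorem abs_trivFun_le (n : ℕ) : |trivFun n| ≤ 1 := by
  rw [trivFun_apply]; split_ifs <;> norm_num

theorem abs_chiFun_le (n : ℕ) : |chiFun n| ≤ 1 := by
  rw [chiFun_apply]; split_ifs <;> norm_num

theorem abs_onSquares_le {w : ArithmeticFunction ℤ} (hw : ∀ n, |w n| ≤ 1) (n : ℕ) :
    |onSquares w n| ≤ 1 := by
  by_cases hn : IsSquare n
  · obtain ⟨d, rfl⟩ := hn
    rw [onSquares_mul_self]; exact hw d
  · rw [onSquares_of_not hn]; norm_num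

theorem lSeries_onSquares (w : ArithmeticFunction ℤ) (s : ℂ) :
    LSeries (fun n => ((onSquares w n : ℤ) : ℂ)) s =
      LSeries (fun n => ((w n : ℤ) : ℂ)) (2 * s) := by
  rw [LSeries, LSeries]
  have hinj : Function.Injective fun d : ℕ => d * d := fun a b h => Nat.mul_self_inj.1 h
  rw [← hinj.tsum_eq]
  · refine tsum_congr fun d => ?_
    rcases Nat.eq_zero_or_pos d with rfl | hd
    · simp
    · rw [LSeries.term_of_ne_zero hd.ne', LSeries.term_of_ne_zero (by positivity),
        onSquares_mul_self, Nat.cast_mul, ← Nat.cast_mul, Nat.cast_mul,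
        Complex.natCast_mul_natCast_cpow, two_mul, Complex.cpow_add _ _ (by exact_mod_cast hd.ne')]
  · intro n hn
    by_contra h
    apply hn
    rcases Nat.eq_zero_or_pos n with rfl | hn0
    · simp
    rw [LSeries.term_of_ne_zero hn0.ne', onSquares_of_not]
    · simp
    · rintro ⟨d, rfl⟩; exact h ⟨d, rfl⟩

/-- The quotient of the Dirichlet series of `primCount` by `ζ`. -/
noncomputable def primQuot (s : ℂ) : ℂ :=
  chiNegThree.LFunction s / ((1 + (3 : ℂ) ^ (-s)) * riemannZeta (2 * s))

theorem norm_three_cpow_lt {s : ℂ} (hs : 1 < s.re) : ‖(3 : ℂ) ^ (-s)‖ < 1 := by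
  have : (3 : ℂ) = ((3 : ℝ) : ℂ) := by norm_num
  rw [this, Complex.norm_cpow_eq_rpow_re_of_pos (by norm_num), Complex.neg_re]
  exact Real.rpow_lt_one_of_one_lt_of_neg (by norm_num) (by linarith)

/-- The L-series form of `primFun_mul_sqFun`. The factor `1 - 3^(-s)` of `trivFun` cancels against
`1 - 9^(-s) = (1 - 3^(-s))(1 + 3^(-s))` from the squares. -/
theorem lSeries_primCount {κ : ℝ} (h : LinearSum (fun n => (primCount n : ℝ)) κ) {s : ℂ}
    (hs : 1 < s.re) :
    LSeries (fun n => ((primCount n : ℝ) : ℂ)) s = riemannZeta s * primQuot s := by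
  have hs2 : 1 < (2 * s).re := by
    rw [show (2 : ℂ) = ((2 : ℝ) : ℂ) by norm_num, Complex.re_ofReal_mul]; linarith
  have hP : LSeriesSummable (fun n => ((primFun n : ℤ) : ℂ)) s := by
    have := h.lSeriesSummable (fun n => by positivity) hs
    simpa [primFun] using this
  have hS := lSeriesSummable_of_le_one (abs_onSquares_le abs_trivFun_le) hs
  have hT := lSeriesSummable_of_le_one abs_trivFun_le hs
  have hX := lSeriesSummable_of_le_one abs_chiFun_le hs
  have key : LSeries (fun n => ((primFun n : ℤ) : ℂ)) s *
      LSeries (fun n => ((onSquares trivFun n : ℤ) : ℂ)) s =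
      LSeries (fun n => ((trivFun n : ℤ) : ℂ)) s * LSeries (fun n => ((chiFun n : ℤ) : ℂ)) s := by
    have e1 := LSeries_mul' (f := (primFun : ArithmeticFunction ℂ))
      (g := ((onSquares trivFun : ArithmeticFunction ℤ) : ArithmeticFunction ℂ)) (s := s)
      (by simpa only [intCoe_apply] using hP) (by simpa only [intCoe_apply] using hS)
    have e2 := LSeries_mul' (f := (trivFun : ArithmeticFunction ℂ))
      (g := (chiFun : ArithmeticFunction ℂ)) (s := s)
      (by simpa only [intCoe_apply] using hT) (by simpa only [intCoe_apply] using hX)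
    rw [← intCoe_mul, ← sqFun_eq, primFun_mul_sqFun, intCoe_mul] at e1
    rw [e1] at e2
    simpa only [intCoe_apply, sqFun_eq] using e2
  rw [lSeries_onSquares, lSeries_trivFun hs, lSeries_trivFun hs2] at key
  simp only [chiFun_eq] at key
  rw [← DirichletCharacter.LFunction_eq_LSeries _ hs] at key
  have e : LSeries (fun n => ((primFun n : ℤ) : ℂ)) s =
      LSeries (fun n => ((primCount n : ℝ) : ℂ)) s := by
    simp [primFun]
  rw [e] at key
  have h9 : (3 : ℂ) ^ (-(2 * s)) = (3 : ℂ) ^ (-s) * (3 : ℂ) ^ (-s) := by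
    rw [← Complex.cpow_add _ _ (by norm_num)]; ring_nf
  have hn := norm_three_cpow_lt hs
  have h1 : 1 - (3 : ℂ) ^ (-s) ≠ 0 := by
    intro h0
    rw [← sub_eq_zero.1 h0] at hn; simp at hn
  have h2 : 1 + (3 : ℂ) ^ (-s) ≠ 0 := by
    intro h0
    rw [eq_neg_of_add_eq_zero_right h0] at hn; simp at hn
  have h3 := riemannZeta_ne_zero_of_one_lt_re hs2
  rw [primQuot, mul_div_assoc', eq_div_iff (mul_ne_zero h2 h3)]
  rw [h9] at key
  refine mul_left_cancel₀ h1 ?_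
  linear_combination key

theorem chiNegThree_ne_one : chiNegThree ≠ 1 := by
  intro h
  have h2 := chiNegThree_two
  rw [h, MulChar.one_apply (by decide)] at h2
  norm_num at h2

/-- Logarithmic differentiation. The summand `log 3 / 4` is `(3^(-1) log 3) / (1 + 3^(-1))`, from
the factor `1 + 3^(-s)` in the denominator. -/
theorem hasDerivAt_primQuot (hL : chiNegThree.LFunction 1 ≠ 0) :
    HasDerivAt primQuot (3 / 4 * (chiNegThree.LFunction 1 / riemannZeta 2) *
      (deriv chiNegThree.LFunction 1 / chiNegThree.LFunction 1 + Real.log 3 / 4 -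
        2 * (deriv riemannZeta 2 / riemannZeta 2))) 1 := by
  have hz0 : riemannZeta 2 ≠ 0 := riemannZeta_ne_zero_of_one_lt_re (by norm_num)
  have h1 : HasDerivAt chiNegThree.LFunction (deriv chiNegThree.LFunction 1) 1 :=
    (DirichletCharacter.differentiable_LFunction chiNegThree_ne_one 1).hasDerivAt
  have h2 : HasDerivAt (fun s : ℂ => riemannZeta (2 * s)) (deriv riemannZeta 2 * 2) 1 := by
    have hz : HasDerivAt riemannZeta (deriv riemannZeta 2) (2 * 1) := by
      rw [mul_one]
      exact (differentiableAt_riemannZeta (by norm_num)).hasDerivAt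
    exact hz.comp 1 (by simpa using (hasDerivAt_id (1 : ℂ)).const_mul 2)
  have h3 : HasDerivAt (fun s : ℂ => 1 + (3 : ℂ) ^ (-s)) ((3 : ℂ) ^ (-1 : ℂ) * Complex.log 3 * -1)
      1 := ((hasDerivAt_neg (1 : ℂ)).const_cpow (Or.inl (by norm_num))).const_add 1
  have h3' : (3 : ℂ) ^ (-1 : ℂ) = 1 / 3 := by rw [Complex.cpow_neg_one]; norm_num
  have hlog : Complex.log 3 = (Real.log 3 : ℂ) := by
    rw [Complex.ofReal_log (by norm_num)]; norm_num
  have h4 := h1.div (h3.mul h2) (by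
    simp only [Pi.mul_apply, mul_one, h3']
    exact mul_ne_zero (by norm_num) hz0)
  refine h4.congr_deriv ?_
  simp only [Pi.mul_apply, mul_one, h3', hlog]
  field_simp
  ring

theorem primCount_polar {κ : ℝ} (h : LinearSum (fun n => (primCount n : ℝ)) κ)
    (hL : chiNegThree.LFunction 1 ≠ 0) :
    (κ : ℂ) = 3 / 4 * (chiNegThree.LFunction 1 / riemannZeta 2) ∧
    (polarConst (fun n => (primCount n : ℝ)) κ : ℂ) =
      3 / 4 * (chiNegThree.LFunction 1 / riemannZeta 2) * (Real.eulerMascheroniConstant +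
        deriv chiNegThree.LFunction 1 / chiNegThree.LFunction 1 + Real.log 3 / 4 -
        2 * (deriv riemannZeta 2 / riemannZeta 2)) := by
  have hd := hasDerivAt_primQuot hL
  have hQ1 : primQuot 1 = 3 / 4 * (chiNegThree.LFunction 1 / riemannZeta 2) := by
    rw [primQuot, mul_one, Complex.cpow_neg_one]
    field_simp
    norm_num
  have h1 : Tendsto (fun t : ℝ => primQuot t) (𝓝[>] 1) (𝓝 (primQuot 1)) :=
    hd.continuousAt.tendsto.comp (tendsto_ofReal_nhdsGT.mono_right nhdsWithin_le_nhds)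
  have h2 := (hasDerivAt_iff_tendsto_slope.1 hd).comp tendsto_ofReal_nhdsGT
  have h3 := tendsto_riemannZeta_sub_one_div.comp tendsto_ofReal_nhdsGT
  have key := (h3.mul h1).add h2
  have := h.polar_eq (fun n => by positivity) (κ' := primQuot 1) key fun t ht => ?_
  · rw [this.1, this.2, hQ1]
    refine ⟨rfl, ?_⟩
    ring
  · rw [lSeries_primCount h (by simpa using ht)]
    have h0 : (t : ℂ) - 1 ≠ 0 := by
      rw [sub_ne_zero]; exact_mod_cast (ne_of_gt ht : t ≠ 1)
    simp only [Function.comp, slope_def_field]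
    field_simp
    ring

/-! ### Values of `L(1, χ₋₃)`, `L'(1, χ₋₃)` and `ζ'(2)`. -/

/-- The terms of `L(s, χ₋₃)`, grouped by period. -/
noncomputable def pairTerm (k : ℕ) (s : ℂ) : ℂ :=
  ((3 * k + 1 : ℕ) : ℂ) ^ (-s) - ((3 * k + 2 : ℕ) : ℂ) ^ (-s)

theorem hasDerivAt_pairTerm (k : ℕ) (s : ℂ) :
    HasDerivAt (pairTerm k) (((3 * k + 1 : ℕ) : ℂ) ^ (-s) * Complex.log (3 * k + 1 : ℕ) * -1 -
      ((3 * k + 2 : ℕ) : ℂ) ^ (-s) * Complex.log (3 * k + 2 : ℕ) * -1) s := by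
  have h : ∀ n : ℕ, n ≠ 0 → HasDerivAt (fun s : ℂ => (n : ℂ) ^ (-s))
      ((n : ℂ) ^ (-s) * Complex.log n * -1) s := fun n hn =>
    (hasDerivAt_neg s).const_cpow (Or.inl (by exact_mod_cast hn))
  exact (h _ (by omega)).sub (h _ (by omega))

/-- Mean value inequality for `t^(-w)` on `[3k + 1, 3k + 2]`. Pairing the terms yields a normally
convergent series around `1`, where the original series is not absolutely convergent. -/
theorem norm_pairTerm_le (k : ℕ) {w : ℂ} (hw : w ∈ Metric.ball (1 : ℂ) (1 / 2)) :
    ‖pairTerm k w‖ ≤ 3 / 2 * ((k : ℝ) + 1) ^ (-(3 / 2) : ℝ) * 2 := by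
  rw [Metric.mem_ball, dist_eq_norm] at hw
  have hre : 1 / 2 ≤ w.re := by
    have := (Complex.abs_re_le_norm (w - 1)).trans hw.le
    rw [Complex.sub_re, Complex.one_re, abs_le] at this
    linarith
  have hn : ‖w‖ ≤ 3 / 2 := by
    calc ‖w‖ = ‖(w - 1) + 1‖ := by ring_nf
      _ ≤ ‖w - 1‖ + ‖(1 : ℂ)‖ := norm_add_le _ _
      _ ≤ 3 / 2 := by rw [norm_one]; linarith
  have hw0 : w ≠ 0 := by rintro rfl; norm_num at hre
  have hd : ∀ t ∈ Set.Icc (3 * (k : ℝ) + 1) (3 * k + 2), HasDerivWithinAt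
      (fun t : ℝ => (t : ℂ) ^ (-w)) (-w * (t : ℂ) ^ (-w - 1))
      (Set.Icc (3 * (k : ℝ) + 1) (3 * k + 2)) t := by
    intro t ht
    have ht0 : t ≠ 0 := by
      have := ht.1
      have : (0 : ℝ) ≤ k := by positivity
      linarith
    exact (hasDerivAt_ofReal_cpow_const ht0 (neg_ne_zero.2 hw0)).hasDerivWithinAt
  have hb : ∀ t ∈ Set.Icc (3 * (k : ℝ) + 1) (3 * k + 2),
      ‖-w * (t : ℂ) ^ (-w - 1)‖ ≤ 3 / 2 * ((k : ℝ) + 1) ^ (-(3 / 2) : ℝ) * 2 := by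
    intro t ht
    have ht1 : (k : ℝ) + 1 / 2 ≤ t := by have := ht.1; have : (0 : ℝ) ≤ k := by positivity
                                         linarith
    have ht2 : 1 ≤ t := by have := ht.1; have : (0 : ℝ) ≤ k := by positivity
                           linarith
    have ht0 : 0 < t := by linarith
    rw [norm_mul, norm_neg, Complex.norm_cpow_eq_rpow_re_of_pos ht0, mul_assoc]
    refine mul_le_mul hn ?_ (by positivity) (by norm_num)
    have h1 : t ^ ((-w - 1).re) ≤ t ^ (-(3 / 2) : ℝ) := by
      refine Real.rpow_le_rpow_of_exponent_le ht2 ?_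
      rw [Complex.sub_re, Complex.neg_re, Complex.one_re]; linarith
    have h2 : (1 / 2 * ((k : ℝ) + 1)) ^ (-(3 / 2) : ℝ) ≤ ((k : ℝ) + 1) ^ (-(3 / 2) : ℝ) * 4 := by
      rw [Real.mul_rpow (by norm_num) (by positivity), mul_comm]
      refine mul_le_mul_of_nonneg_left ?_ (by positivity)
      rw [one_div, Real.inv_rpow (by norm_num), Real.rpow_neg (by norm_num), inv_inv]
      calc (2 : ℝ) ^ (3 / 2 : ℝ) ≤ 2 ^ (2 : ℝ) :=
            Real.rpow_le_rpow_of_exponent_le (by norm_num) (by norm_num)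
        _ = 4 := by norm_num
    have h3 : t ^ (-(3 / 2) : ℝ) ≤ ((k : ℝ) + 1) ^ (-(3 / 2) : ℝ) * 1 := by
      rw [mul_one]
      refine Real.rpow_le_rpow_of_nonpos (by positivity) ?_ (by norm_num)
      have := ht.1; have : (0 : ℝ) ≤ k := by positivity
      linarith
    refine h1.trans (h3.trans (mul_le_mul_of_nonneg_left (by norm_num) (by positivity)))
  have key := (convex_Icc (3 * (k : ℝ) + 1) (3 * k + 2)).norm_image_sub_le_of_norm_hasDerivWithin_le
    hd hb (x := 3 * (k : ℝ) + 2) (y := 3 * k + 1) ⟨by linarith, le_rfl⟩ ⟨le_rfl, by linarith⟩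
  have e : ‖(3 * (k : ℝ) + 1 - (3 * k + 2) : ℝ)‖ = 1 := by
    rw [show (3 * (k : ℝ) + 1 - (3 * k + 2) : ℝ) = -1 by ring]; norm_num
  rw [e, mul_one] at key
  rw [pairTerm]
  push_cast at key ⊢
  exact key

theorem summable_pair_bound :
    Summable fun k : ℕ => 3 / 2 * ((k : ℝ) + 1) ^ (-(3 / 2) : ℝ) * 2 := by
  have h : Summable fun k : ℕ => (k : ℝ) ^ (-(3 / 2) : ℝ) := by
    rw [Real.summable_nat_rpow]; norm_num
  have := ((summable_nat_add_iff 1).2 h)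
  simp only [Nat.cast_add, Nat.cast_one] at this
  exact (this.mul_left _).mul_right _

theorem lFunction_eq_tsum_of_re {s : ℂ} (hs : 1 < s.re) :
    chiNegThree.LFunction s = ∑' k, pairTerm k s := by
  have hX := lSeriesSummable_of_le_one abs_chiFun_le hs
  simp only [chiFun_eq] at hX
  have hs0 : s ≠ 0 := by rintro rfl; simp at hs; linarith
  rw [DirichletCharacter.LFunction_eq_LSeries _ hs, LSeries, Nat.sumByResidueClasses hX 3]
  have hu : (Finset.univ : Finset (ZMod 3)) = {0, 1, 2} := by decide
  have hc : ∀ (j : ZMod 3) (m : ℕ), chiNegThree ((j.val + 3 * m : ℕ) : ZMod 3) = chiNegThree j := by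
    intro j m
    congr 1
    push_cast
    rw [ZMod.natCast_val, ZMod.cast_id, show (3 : ZMod 3) = 0 by decide, zero_mul, add_zero]
  have hsj : ∀ j : ZMod 3, Summable fun m : ℕ => LSeries.term (fun n => chiNegThree n) s
      (j.val + 3 * m) := fun j =>
    hX.comp_injective (fun a b h => by simpa using h)
  have ht : ∀ (j : ZMod 3), j.val ≠ 0 → ∀ m : ℕ, LSeries.term (fun n => chiNegThree n) s
      (j.val + 3 * m) = chiNegThree j * ((3 * m + j.val : ℕ) : ℂ) ^ (-s) := by
    intro j hj m
    rw [LSeries.term_of_ne_zero (by omega), hc, Complex.cpow_neg, div_eq_mul_inv, add_comm]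
  rw [hu, Finset.sum_insert (by decide), Finset.sum_pair (by decide)]
  have h0 : ∑' m : ℕ, LSeries.term (fun n => chiNegThree n) s ((0 : ZMod 3).val + 3 * m) = 0 := by
    rw [← tsum_zero (α := ℂ) (β := ℕ)]
    refine tsum_congr fun m => ?_
    rcases Nat.eq_zero_or_pos m with rfl | hm
    · simp
    · rw [LSeries.term_of_ne_zero (by simp; omega), hc, chiNegThree_zero, zero_div]
  rw [h0, zero_add, ← (hsj 1).tsum_add (hsj 2)]
  refine tsum_congr fun m => ?_
  rw [ht 1 (by decide), ht 2 (by decide), chiNegThree_one, chiNegThree_two, pairTerm]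
  have e1 : (1 : ZMod 3).val = 1 := rfl
  have e2 : (2 : ZMod 3).val = 2 := rfl
  rw [e1, e2]
  ring

/-- Identity theorem: both sides are analytic on the ball and agree near `5/4`, inside the
half-plane of absolute convergence. -/
theorem lFunction_eqOn_ball : Set.EqOn chiNegThree.LFunction (fun s => ∑' k, pairTerm k s)
    (Metric.ball 1 (1 / 2)) := by
  have h1 : DifferentiableOn ℂ (fun s => ∑' k, pairTerm k s) (Metric.ball (1 : ℂ) (1 / 2)) :=
    Complex.differentiableOn_tsum_of_summable_norm summable_pair_bound
      (fun k s _ => (hasDerivAt_pairTerm k s).differentiableAt.differentiableWithinAt)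
      Metric.isOpen_ball fun k w hw => norm_pairTerm_le k hw
  have h2 : DifferentiableOn ℂ chiNegThree.LFunction (Metric.ball (1 : ℂ) (1 / 2)) :=
    (DirichletCharacter.differentiable_LFunction chiNegThree_ne_one).differentiableOn
  refine (h2.analyticOnNhd Metric.isOpen_ball).eqOn_of_preconnected_of_eventuallyEq
    (h1.analyticOnNhd Metric.isOpen_ball) (convex_ball _ _).isPreconnected
    (z₀ := (5 / 4 : ℂ)) ?_ ?_
  · rw [Metric.mem_ball, dist_eq_norm]; norm_num
  · have hU : IsOpen {s : ℂ | 1 < s.re} := isOpen_lt continuous_const Complex.continuous_re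
    filter_upwards [hU.mem_nhds (show (1 : ℝ) < (5 / 4 : ℂ).re by norm_num)] with s hs
    exact lFunction_eq_tsum_of_re hs

theorem lFunction_one_eq : HasSum (fun k : ℕ => 1 / (3 * (k : ℝ) + 1) - 1 / (3 * (k : ℝ) + 2))
    (chiNegThree.LFunction 1).re ∧ (chiNegThree.LFunction 1).im = 0 := by
  have hm : (1 : ℂ) ∈ Metric.ball (1 : ℂ) (1 / 2) := Metric.mem_ball_self (by norm_num)
  have h1 : HasSum (fun k => pairTerm k 1) (chiNegThree.LFunction 1) := by
    rw [lFunction_eqOn_ball hm]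
    exact (Summable.of_norm_bounded summable_pair_bound fun k => norm_pairTerm_le k hm).hasSum
  have e : ∀ k : ℕ, pairTerm k 1 = ((1 / (3 * (k : ℝ) + 1) - 1 / (3 * (k : ℝ) + 2) : ℝ) : ℂ) := by
    intro k
    rw [pairTerm, Complex.cpow_neg_one, Complex.cpow_neg_one]
    push_cast
    rw [one_div, one_div]
  simp only [e] at h1
  refine ⟨by simpa only [Complex.ofReal_re] using Complex.hasSum_re h1, ?_⟩
  have := Complex.hasSum_im h1
  simp only [Complex.ofReal_im] at this
  exact this.unique hasSum_zero

/-- Partial fractions of the cotangent at `1/3`: the partial sums of `π cot(π / 3) - 3` regroup into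
`3 (∑ (1/(3k+1) - 1/(3k+2)) - 1)` up to a vanishing term, and `cot(π / 3) = 1 / √3`. -/
theorem lFunction_one : chiNegThree.LFunction 1 = ((Real.pi / (3 * √3) : ℝ) : ℂ) := by
  obtain ⟨h1, h2⟩ := lFunction_one_eq
  have h3 := h1.tendsto_sum_nat
  have hx : (1 / 3 : ℂ) ∈ Complex.integerComplement := by
    rintro ⟨n, hn⟩
    have h : (n : ℂ) * 3 = 1 := by rw [hn]; norm_num
    have h' : n * 3 = 1 := by exact_mod_cast h
    omega
  have h4 := tendsto_logDeriv_euler_cot_sub hx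
  have hcot : Complex.cot (Real.pi * (1 / 3)) = ((1 / √3 : ℝ) : ℂ) := by
    have : (Real.pi * (1 / 3) : ℂ) = ((Real.pi / 3 : ℝ) : ℂ) := by push_cast; ring
    rw [this, ← Complex.ofReal_cot, Real.cot_eq_cos_div_sin, Real.cos_pi_div_three,
      Real.sin_pi_div_three]
    congr 1
    field_simp
  rw [hcot] at h4
  have e : ∀ n : ℕ, ∑ j ∈ Finset.range n, cotTerm (1 / 3) j =
      ((3 * (∑ k ∈ Finset.range n, (1 / (3 * (k : ℝ) + 1) - 1 / (3 * (k : ℝ) + 2)) - 1 +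
        1 / (3 * (n : ℝ) + 1)) : ℝ) : ℂ) := by
    intro n
    induction n with
    | zero => simp
    | succ n ih =>
      rw [Finset.sum_range_succ, Finset.sum_range_succ, ih, cotTerm]
      have a1 : (3 * (n : ℂ) + 1) ≠ 0 := by exact_mod_cast Nat.succ_ne_zero (3 * n)
      have a2 : (3 * (n : ℂ) + 2) ≠ 0 := by
        exact_mod_cast Nat.succ_ne_zero (3 * n + 1)
      have a4 : (3 * (n : ℂ) + 4) ≠ 0 := by
        exact_mod_cast Nat.succ_ne_zero (3 * n + 3)
      have b1 : (1 / 3 - (n + 1) : ℂ) = -(3 * n + 2) / 3 := by ring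
      have b2 : (1 / 3 + (n + 1) : ℂ) = (3 * n + 4) / 3 := by ring
      have b3 : (3 * ((n : ℂ) + 1) + 1) = 3 * n + 4 := by ring
      push_cast
      rw [b1, b2, b3]
      field_simp
      ring
  simp only [e] at h4
  have h5 : Tendsto (fun n : ℕ => 3 * (∑ k ∈ Finset.range n, (1 / (3 * (k : ℝ) + 1) -
      1 / (3 * (k : ℝ) + 2)) - 1 + 1 / (3 * (n : ℝ) + 1))) atTop
      (𝓝 (3 * ((chiNegThree.LFunction 1).re - 1 + 0))) := by
    refine ((h3.sub_const 1).add ?_).const_mul 3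
    have : Tendsto (fun n : ℕ => 3 * (n : ℝ) + 1) atTop atTop :=
      tendsto_atTop_add_const_right _ _ (tendsto_natCast_atTop_atTop.const_mul_atTop (by norm_num))
    simp only [one_div]
    exact this.inv_tendsto_atTop
  have h6 := (Complex.continuous_ofReal.tendsto _).comp h5
  have h7 := tendsto_nhds_unique h4 h6
  have h8 : (chiNegThree.LFunction 1).re = Real.pi / (3 * √3) := by
    have h9 : Real.pi * (1 / √3) - 3 = 3 * ((chiNegThree.LFunction 1).re - 1 + 0) := by
      have : ((Real.pi * (1 / √3) - 3 : ℝ) : ℂ) =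
          ((3 * ((chiNegThree.LFunction 1).re - 1 + 0) : ℝ) : ℂ) := by
        rw [← h7]; push_cast; norm_num
      exact_mod_cast this
    have h3 : √3 ≠ 0 := by positivity
    field_simp at h9 ⊢
    linarith
  rw [← h8]
  refine Complex.ext (by simp) (by simp [h2])

theorem lFunction_one_ne_zero : chiNegThree.LFunction 1 ≠ 0 := by
  rw [lFunction_one]
  exact_mod_cast (div_pos Real.pi_pos (by positivity)).ne'

theorem hasSum_deriv_lFunction : ∃ D : ℝ, deriv chiNegThree.LFunction 1 = (D : ℂ) ∧
    HasSum (fun k : ℕ => Real.log (3 * k + 2) / (3 * k + 2) - Real.log (3 * k + 1) / (3 * k + 1))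
      D := by
  have hm : (1 : ℂ) ∈ Metric.ball (1 : ℂ) (1 / 2) := Metric.mem_ball_self (by norm_num)
  have h1 := Complex.hasSum_deriv_of_summable_norm summable_pair_bound
      (fun k s _ => (hasDerivAt_pairTerm k s).differentiableAt.differentiableWithinAt)
      Metric.isOpen_ball (fun k w hw => norm_pairTerm_le k hw) hm
  have h2 : deriv (fun w => ∑' k, pairTerm k w) 1 = deriv chiNegThree.LFunction 1 := by
    refine Filter.EventuallyEq.deriv_eq ?_
    filter_upwards [Metric.isOpen_ball.mem_nhds hm] with s hs
    exact (lFunction_eqOn_ball hs).symm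
  rw [h2] at h1
  have e : ∀ k : ℕ, deriv (pairTerm k) 1 =
      ((Real.log (3 * k + 2) / (3 * k + 2) - Real.log (3 * k + 1) / (3 * k + 1) : ℝ) : ℂ) := by
    intro k
    rw [(hasDerivAt_pairTerm k 1).deriv, Complex.cpow_neg_one, Complex.cpow_neg_one,
      ← Complex.natCast_log, ← Complex.natCast_log]
    push_cast
    ring
  simp only [e] at h1
  refine ⟨(deriv chiNegThree.LFunction 1).re, ?_,
    by simpa only [Complex.ofReal_re] using Complex.hasSum_re h1⟩
  have := Complex.hasSum_im h1
  simp only [Complex.ofReal_im] at this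
  refine Complex.ext (by simp) (by simp [this.unique hasSum_zero])

theorem hasSum_deriv_zeta : ∃ S : ℝ, deriv riemannZeta 2 = ((-S : ℝ) : ℂ) ∧
    HasSum (fun n : ℕ => Real.log n / (n : ℝ) ^ 2) S := by
  have ha : LSeries.abscissaOfAbsConv (1 : ℕ → ℂ) < (2 : ℂ).re := by
    rw [LSeries.abscissaOfAbsConv_one]
    exact_mod_cast (by norm_num : (1 : ℝ) < 2)
  have h1 : deriv riemannZeta 2 = deriv (LSeries 1) 2 := by
    refine Filter.EventuallyEq.deriv_eq ?_
    have hU : IsOpen {s : ℂ | 1 < s.re} := isOpen_lt continuous_const Complex.continuous_re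
    filter_upwards [hU.mem_nhds (show (1 : ℝ) < (2 : ℂ).re by norm_num)] with s hs
    exact (LSeries_one_eq_riemannZeta hs).symm
  have hsum : LSeriesSummable (LSeries.logMul 1) 2 :=
    LSeriesSummable_logMul_of_lt_re ha
  have e : ∀ n : ℕ, LSeries.term (LSeries.logMul 1) 2 n = ((Real.log n / (n : ℝ) ^ 2 : ℝ) : ℂ) := by
    intro n
    rcases Nat.eq_zero_or_pos n with rfl | hn
    · simp
    · rw [LSeries.term_of_ne_zero hn.ne', LSeries.logMul, Pi.one_apply, mul_one]
      push_cast
      norm_num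
  have h2 := hsum.hasSum
  rw [funext e] at h2
  have h3 : Summable fun n : ℕ => Real.log n / (n : ℝ) ^ 2 := Complex.summable_ofReal.1 h2.summable
  refine ⟨_, ?_, h3.hasSum⟩
  rw [h1, LSeries_deriv ha, LSeries]
  simp only [e]
  rw [Complex.ofReal_neg, Complex.ofReal_tsum]

theorem leadCoeff_eq : leadCoeff = ((3 * √3 * Real.log 3 / (8 * Real.pi) : ℝ) : ℂ) := by
  rw [leadCoeff, lFunction_one, riemannZeta_two]
  have h3 : (√3 : ℝ) * √3 = 3 := Real.mul_self_sqrt (by norm_num)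
  have h0 : √3 ≠ 0 := by positivity
  have hp := Real.pi_ne_zero
  have : 3 * √3 * Real.log 3 / (8 * Real.pi) =
      9 * Real.log 3 / 16 * (Real.pi / (3 * √3) / (Real.pi ^ 2 / 6)) := by
    field_simp
    rw [sq √3, h3]; norm_num
  rw [this]
  push_cast
  ring

/-! ### The Laurent expansion of the product. -/

theorem AnalyticAt.dslope_self {f : ℂ → ℂ} {z : ℂ} (hf : AnalyticAt ℂ f z) :
    AnalyticAt ℂ (dslope f z) z := by
  obtain ⟨s, hs, hf'⟩ := hf.exists_mem_nhds_analyticOnNhd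
  exact ((Complex.differentiableOn_dslope hs).2 hf'.differentiableOn).analyticAt hs

/-- In a cross term `κ h(s) / (s - 1)` write `h(s) = h(1) + (s - 1) dslope h 1 s`; the second part
is analytic. -/
theorem LinearSum.exists_laurent {a b : ℕ → ℝ} {κ l : ℝ} (hA : LinearSum a κ)
    (hB : LinearSum b l) : ∃ g : ℂ → ℂ, AnalyticAt ℂ g 1 ∧ ∀ s : ℂ, s ≠ 1 →
      (κ / (s - 1) + polarRem a κ s) * (l / (s - 1) + polarRem b l s) =
        (κ * l : ℂ) / (s - 1) ^ 2 +
          ((κ * polarConst b l + l * polarConst a κ : ℝ) : ℂ) / (s - 1) + g s := by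
  refine ⟨fun s => κ * dslope (polarRem b l) 1 s + l * dslope (polarRem a κ) 1 s +
    polarRem a κ s * polarRem b l s, ?_, fun s hs => ?_⟩
  · exact ((analyticAt_const.mul hB.analyticAt_polarRem.dslope_self).add
      (analyticAt_const.mul hA.analyticAt_polarRem.dslope_self)).add
      (hA.analyticAt_polarRem.mul hB.analyticAt_polarRem)
  · have h0 : s - 1 ≠ 0 := sub_ne_zero.2 hs
    simp only [dslope_of_ne _ hs, slope_def_field, polarRem_one]
    push_cast
    field_simp
    ring

/-- The isolated `L` comes from `κ · (4/3) ζ`. Relative to `κ l`, the other parts of `β` give `2γ -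
t/2 - T/t`, and `t/4 - t/2 = -t/4`. -/
theorem polar_combination {κ α l β L D ζ Z γ t T : ℂ} (hκ : κ = 3 / 4 * (L / ζ))
    (hα : α = 3 / 4 * (L / ζ) * (γ + D / L + t / 4 - 2 * (Z / ζ))) (hl : l = 3 * t / 4)
    (hβ : β = 3 * (γ * t / 2 - t ^ 2 / 8 - T / 4) + 4 / 3 * ζ) (hζ : ζ ≠ 0) (ht : t ≠ 0) :
    κ * β + l * α = L + 9 * t / 16 * (L / ζ) *
      (γ + D / L - 2 * (Z / ζ) + 2 * γ - t / 4 - 1 / t * T) := by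
  subst hκ hα hl hβ
  set q := D / L
  field_simp
  ring

/-! ### Alternating bounds for the logarithm and telescoping bounds for series -/

/-- The derivative of the Taylor remainder is a geometric remainder, whose sign is fixed by the
parity of `m`. This yields the alternating bounds below. -/
theorem hasDerivAt_log_sub_taylor (m : ℕ) {t : ℝ} (ht : 0 ≤ t) :
    HasDerivAt (fun t : ℝ => Real.log (1 + t) -
      ∑ i ∈ Finset.range m, (-1) ^ i * t ^ (i + 1) / (i + 1)) ((-t) ^ m / (1 + t)) t := by
  have h0 : (1 + t) ≠ 0 := by positivity
  have h1 : HasDerivAt (fun t : ℝ => Real.log (1 + t)) (1 / (1 + t)) t :=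
    ((hasDerivAt_id t).const_add 1).log h0
  have h2 : HasDerivAt (fun t : ℝ => ∑ i ∈ Finset.range m, (-1) ^ i * t ^ (i + 1) / (i + 1))
      (∑ i ∈ Finset.range m, (-t) ^ i) t := by
    refine HasDerivAt.fun_sum fun i _ => ?_
    have h := ((hasDerivAt_pow (i + 1) t).const_mul ((-1 : ℝ) ^ i)).div_const ((i : ℝ) + 1)
    refine h.congr_deriv ?_
    have : (i : ℝ) + 1 ≠ 0 := by positivity
    rw [Nat.add_sub_cancel, neg_pow t]
    push_cast
    field_simp
  refine (h1.sub h2).congr_deriv ?_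
  have := mul_neg_geom_sum (-t) m
  rw [div_sub' h0, div_left_inj' h0]
  linear_combination -this

theorem taylor_le_log {m : ℕ} (hm : Even m) {t : ℝ} (ht : 0 ≤ t) :
    ∑ i ∈ Finset.range m, (-1) ^ i * t ^ (i + 1) / (i + 1) ≤ Real.log (1 + t) := by
  have h : MonotoneOn (fun t : ℝ => Real.log (1 + t) -
      ∑ i ∈ Finset.range m, (-1) ^ i * t ^ (i + 1) / (i + 1)) (Set.Ici 0) := by
    refine monotoneOn_of_hasDerivWithinAt_nonneg (convex_Ici 0)
      (fun x hx => (hasDerivAt_log_sub_taylor m hx).continuousAt.continuousWithinAt)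
      (fun x hx => (hasDerivAt_log_sub_taylor m (interior_subset hx)).hasDerivWithinAt)
      fun x hx => ?_
    have : (0 : ℝ) ≤ x := interior_subset hx
    rw [hm.neg_pow]; positivity
  have := h (Set.mem_Ici.2 le_rfl) (Set.mem_Ici.2 ht) ht
  simpa using this

theorem log_le_taylor {m : ℕ} (hm : Odd m) {t : ℝ} (ht : 0 ≤ t) :
    Real.log (1 + t) ≤ ∑ i ∈ Finset.range m, (-1) ^ i * t ^ (i + 1) / (i + 1) := by
  have h : AntitoneOn (fun t : ℝ => Real.log (1 + t) -
      ∑ i ∈ Finset.range m, (-1) ^ i * t ^ (i + 1) / (i + 1)) (Set.Ici 0) := by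
    refine antitoneOn_of_hasDerivWithinAt_nonpos (convex_Ici 0)
      (fun x hx => (hasDerivAt_log_sub_taylor m hx).continuousAt.continuousWithinAt)
      (fun x hx => (hasDerivAt_log_sub_taylor m (interior_subset hx)).hasDerivWithinAt)
      fun x hx => ?_
    have : (0 : ℝ) ≤ x := interior_subset hx
    rw [hm.neg_pow, neg_div]
    exact neg_nonpos.2 (by positivity)
  have := h (Set.mem_Ici.2 le_rfl) (Set.mem_Ici.2 ht) ht
  simpa using this

/-- Monotonicity along one residue class modulo `k` is enough; `k = 2` is used for `rhombDefectOne`,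
whose two-step differences are rational. -/
theorem le_of_tendsto_of_le_add {f : ℕ → ℝ} {S : ℝ} (hf : Tendsto f atTop (𝓝 S)) {N k : ℕ}
    (hk : 0 < k) (h : ∀ n, N ≤ n → f n ≤ f (n + k)) {n : ℕ} (hn : N ≤ n) : f n ≤ S := by
  have hmono : Monotone fun j : ℕ => f (n + j * k) := by
    refine monotone_nat_of_le_succ fun j => ?_
    have := h (n + j * k) (by omega)
    rwa [add_assoc, ← Nat.succ_mul] at this
  have ht : Tendsto (fun j : ℕ => n + j * k) atTop atTop :=
    tendsto_atTop_mono (fun j => (Nat.le_mul_of_pos_right j hk).trans (Nat.le_add_left _ _))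
      tendsto_id
  simpa using hmono.ge_of_tendsto (hf.comp ht) 0

theorem ge_of_tendsto_of_add_le {f : ℕ → ℝ} {S : ℝ} (hf : Tendsto f atTop (𝓝 S)) {N k : ℕ}
    (hk : 0 < k) (h : ∀ n, N ≤ n → f (n + k) ≤ f n) {n : ℕ} (hn : N ≤ n) : S ≤ f n :=
  neg_le_neg_iff.1 (le_of_tendsto_of_le_add hf.neg hk (fun n hn => neg_le_neg (h n hn)) hn)

/-- `U` is a candidate lower bound for the tail; comparing its differences with the terms proves it.
-/
theorem HasSum.add_le_of_telescope {a : ℕ → ℝ} {S : ℝ} (ha : HasSum a S) {U : ℕ → ℝ}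
    (hU : Tendsto U atTop (𝓝 0)) (N : ℕ) (h : ∀ n, N ≤ n → U n - U (n + 1) ≤ a n) :
    ∑ n ∈ Finset.range N, a n + U N ≤ S := by
  have ht : Tendsto (fun n => ∑ i ∈ Finset.range n, a i + U n) atTop (𝓝 S) := by
    simpa using ha.tendsto_sum_nat.add hU
  refine le_of_tendsto_of_le_add ht one_pos (N := N) (fun n hn => ?_) le_rfl
  rw [Finset.sum_range_succ]
  linarith [h n hn]

theorem HasSum.le_add_of_telescope {a : ℕ → ℝ} {S : ℝ} (ha : HasSum a S) {U : ℕ → ℝ}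
    (hU : Tendsto U atTop (𝓝 0)) (N : ℕ) (h : ∀ n, N ≤ n → a n ≤ U n - U (n + 1)) :
    S ≤ ∑ n ∈ Finset.range N, a n + U N := by
  have ht : Tendsto (fun n => ∑ i ∈ Finset.range n, a i + U n) atTop (𝓝 S) := by
    simpa using ha.tendsto_sum_nat.add hU
  refine ge_of_tendsto_of_add_le ht one_pos (N := N) (fun n hn => ?_) le_rfl
  rw [Finset.sum_range_succ]
  linarith [h n hn]

theorem tendsto_log_mul_inv_add {p q : ℝ → ℝ} (hp : Continuous p) (hq : Continuous q)
    (hq0 : q 0 = 0) :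
    Tendsto (fun x : ℝ => Real.log x * x⁻¹ * p x⁻¹ + q x⁻¹) atTop (𝓝 0) := by
  have h1 : Tendsto (fun x : ℝ => Real.log x * x⁻¹) atTop (𝓝 0) := by
    simpa [div_eq_mul_inv] using Real.isLittleO_log_id_atTop.tendsto_div_nhds_zero
  have hz : Tendsto (fun x : ℝ => x⁻¹) atTop (𝓝 0) := tendsto_inv_atTop_zero
  have := (h1.mul ((hp.tendsto 0).comp hz)).add ((hq.tendsto 0).comp hz)
  simpa [hq0] using this

/-! ### Rational inequalities for the tails -/

/-- The tail bounds have the form `log n * P n + Q n`, truncated from Euler–Maclaurin. The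
telescoping inequality is affine in `log n`: the `coeff` statements say that its slope is
nonnegative, the `step` statements that it holds at a rational lower bound of `log n`, with Taylor
polynomials replacing the other logarithms. After shifting the variable to the cut-off, every
polynomial numerator has nonnegative coefficients. -/
theorem zetaTail_lower_coeff {n : ℝ} (hn : 16 ≤ n) :
    0 ≤ (1 / n ^ 2 - (1 / n + 1 / (2 * n ^ 2) + 1 / (6 * n ^ 3) - 1 / (30 * n ^ 5))
    + (1 / (n + 1) + 1 / (2 * (n + 1) ^ 2) + 1 / (6 * (n + 1) ^ 3) - 1 / (30 * (n
    + 1) ^ 5))) := by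
  obtain ⟨x, hx, rfl⟩ : ∃ x, 0 ≤ x ∧ n = 16 + x := ⟨n - 16, by linarith, by ring⟩
  have : 16 + x ≠ 0 := by positivity
  have : 16 + x + 1 ≠ 0 := by positivity
  refine le_of_le_of_eq (b :=
      (1361 + 165 * x + 5 * x ^ 2) / (30 * ((16 + x) ^ 5 * (16 + x + 1) ^ 5))) (by positivity) ?_
  field_simp
  ring

theorem zetaTail_lower_step {n : ℝ} (hn : 16 ≤ n) :
    0 ≤ 277 / 100 * (1 / n ^ 2 - (1 / n + 1 / (2 * n ^ 2) + 1 / (6 * n ^ 3)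
    - 1 / (30 * n ^ 5)) + (1 / (n + 1) + 1 / (2 * (n + 1) ^ 2) + 1 / (6 * (n + 1) ^ 3)
    - 1 / (30 * (n + 1) ^ 5))) + (((1 / n) - (1 / n) ^ 2 / 2 + (1 / n) ^ 3 / 3
    - (1 / n) ^ 4 / 4 + (1 / n) ^ 5 / 5 - (1 / n) ^ 6 / 6 + (1 / n) ^ 7 / 7
    - (1 / n) ^ 8 / 8) * (1 / (n + 1) + 1 / (2 * (n + 1) ^ 2) + 1 / (6 * (n + 1) ^ 3)
    - 1 / (30 * (n + 1) ^ 5)) + (1 / (n + 1) - 1 / (12 * (n + 1) ^ 3) + 13 / (360 * (n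
    + 1) ^ 5)) - (1 / n - 1 / (12 * n ^ 3) + 13 / (360 * n ^ 5))) := by
  obtain ⟨x, hx, rfl⟩ : ∃ x, 0 ≤ x ∧ n = 16 + x := ⟨n - 16, by linarith, by ring⟩
  have : 16 + x ≠ 0 := by positivity
  have : 16 + x + 1 ≠ 0 := by positivity
  refine le_of_le_of_eq (b :=
      (28185929939 + 8670153397 * x + 1066236782 * x ^ 2 + 65530149 * x ^ 3
      + 2012820 * x ^ 4 + 24720 * x ^ 5) / (126000 * ((16 + x) ^ 8 * (16 + x + 1) ^ 5)))
      (by positivity) ?_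
  field_simp
  ring

theorem zetaTail_upper_coeff {n : ℝ} (hn : 16 ≤ n) :
    0 ≤ ((1 / n + 1 / (2 * n ^ 2) + 1 / (6 * n ^ 3)) - (1 / (n + 1) + 1 / (2 * (n + 1) ^ 2)
    + 1 / (6 * (n + 1) ^ 3)) - 1 / n ^ 2) := by
  obtain ⟨x, hx, rfl⟩ : ∃ x, 0 ≤ x ∧ n = 16 + x := ⟨n - 16, by linarith, by ring⟩
  have : 16 + x ≠ 0 := by positivity
  have : 16 + x + 1 ≠ 0 := by positivity
  refine le_of_le_of_eq (b :=
      (1) / (6 * ((16 + x) ^ 3 * (16 + x + 1) ^ 3))) (by positivity) ?_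
  field_simp
  ring

theorem zetaTail_upper_step {n : ℝ} (hn : 16 ≤ n) :
    0 ≤ 277 / 100 * ((1 / n + 1 / (2 * n ^ 2) + 1 / (6 * n ^ 3)) - (1 / (n + 1)
    + 1 / (2 * (n + 1) ^ 2) + 1 / (6 * (n + 1) ^ 3)) - 1 / n ^ 2) + ((1 / n
    - 1 / (12 * n ^ 3)) - (1 / (n + 1) - 1 / (12 * (n + 1) ^ 3)) - ((1 / n)
    - (1 / n) ^ 2 / 2 + (1 / n) ^ 3 / 3 - (1 / n) ^ 4 / 4 + (1 / n) ^ 5 / 5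
    - (1 / n) ^ 6 / 6 + (1 / n) ^ 7 / 7) * (1 / (n + 1) + 1 / (2 * (n + 1) ^ 2)
    + 1 / (6 * (n + 1) ^ 3))) := by
  obtain ⟨x, hx, rfl⟩ : ∃ x, 0 ≤ x ∧ n = 16 + x := ⟨n - 16, by linarith, by ring⟩
  have : 16 + x ≠ 0 := by positivity
  have : 16 + x + 1 ≠ 0 := by positivity
  refine le_of_le_of_eq (b :=
      (104346596 + 25966124 * x + 2422521 * x ^ 2 + 100429 * x ^ 3
      + 1561 * x ^ 4) / (6300 * ((16 + x) ^ 7 * (16 + x + 1) ^ 3))) (by positivity) ?_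
  field_simp
  ring

theorem eulerMascheroni_lower_step {n : ℝ} (hn : 16 ≤ n) :
    0 ≤ 1 / (n + 1) - ((1 / n) - (1 / n) ^ 2 / 2 + (1 / n) ^ 3 / 3 - (1 / n) ^ 4 / 4
    + (1 / n) ^ 5 / 5 - (1 / n) ^ 6 / 6 + (1 / n) ^ 7 / 7 - (1 / n) ^ 8 / 8
    + (1 / n) ^ 9 / 9) + (-1 / (2 * (n + 1)) + 1 / (12 * (n + 1) ^ 2) - 1 / (120 * (n
    + 1) ^ 4)) - (-1 / (2 * n) + 1 / (12 * n ^ 2) - 1 / (120 * n ^ 4)) := by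
  obtain ⟨x, hx, rfl⟩ : ∃ x, 0 ≤ x ∧ n = 16 + x := ⟨n - 16, by linarith, by ring⟩
  have : 16 + x ≠ 0 := by positivity
  have : 16 + x + 1 ≠ 0 := by positivity
  refine le_of_le_of_eq (b :=
      (1036591256 + 387034459 * x + 60192276 * x ^ 2 + 4991494 * x ^ 3 + 232796 * x ^ 4
      + 5790 * x ^ 5 + 60 * x ^ 6) / (2520 * ((16 + x + 1) ^ 4 * (16 + x) ^ 9))) (by positivity) ?_
  field_simp
  ring

theorem eulerMascheroni_upper_step {n : ℝ} (hn : 16 ≤ n) :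
    0 ≤ -1 / (n + 1) + ((1 / n) - (1 / n) ^ 2 / 2 + (1 / n) ^ 3 / 3 - (1 / n) ^ 4 / 4
    + (1 / n) ^ 5 / 5 - (1 / n) ^ 6 / 6 + (1 / n) ^ 7 / 7 - (1 / n) ^ 8 / 8)
    + (-1 / (2 * n) + 1 / (12 * n ^ 2) - 1 / (120 * n ^ 4) + 1 / (200 * n ^ 6))
    - (-1 / (2 * (n + 1)) + 1 / (12 * (n + 1) ^ 2) - 1 / (120 * (n + 1) ^ 4)
    + 1 / (200 * (n + 1) ^ 6)) := by
  obtain ⟨x, hx, rfl⟩ : ∃ x, 0 ≤ x ∧ n = 16 + x := ⟨n - 16, by linarith, by ring⟩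
  have : 16 + x ≠ 0 := by positivity
  have : 16 + x + 1 ≠ 0 := by positivity
  refine le_of_le_of_eq (b :=
      (7659529363 + 3345469642 * x + 623124230 * x ^ 2 + 64208706 * x ^ 3 + 3955655 * x ^ 4
      + 145776 * x ^ 5 + 2977 * x ^ 6 + 26 * x ^ 7) / (4200 * ((16 + x + 1) ^ 6 * (16
      + x) ^ 8))) (by positivity) ?_
  field_simp
  ring

theorem lTail_lower_coeff {n : ℝ} (hn : 30 ≤ n) :
    0 ≤ (1 / (n + 2) - 1 / (n + 1) - (-1 / (3 * n) + 2 / (9 * n ^ 3) - 2 / (3 * n ^ 5))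
    + (-1 / (3 * (n + 3)) + 2 / (9 * (n + 3) ^ 3) - 2 / (3 * (n + 3) ^ 5))) := by
  obtain ⟨x, hx, rfl⟩ : ∃ x, 0 ≤ x ∧ n = 30 + x := ⟨n - 30, by linarith, by ring⟩
  have : 30 + x ≠ 0 := by positivity
  have : 30 + x + 1 ≠ 0 := by positivity
  have : 30 + x + 2 ≠ 0 := by positivity
  have : 30 + x + 3 ≠ 0 := by positivity
  refine le_of_le_of_eq (b :=
      (96388704 + 12246066 * x + 583344 * x ^ 2 + 12348 * x ^ 3 + 98 * x ^ 4) / (1 * ((30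
      + x + 2) ^ 1 * (30 + x + 1) ^ 1 * (30 + x) ^ 5 * (30 + x + 3) ^ 5))) (by positivity) ?_
  field_simp
  ring

theorem lTail_lower_step {n : ℝ} (hn : 30 ≤ n) :
    0 ≤ 34 / 10 * (1 / (n + 2) - 1 / (n + 1) - (-1 / (3 * n) + 2 / (9 * n ^ 3)
    - 2 / (3 * n ^ 5)) + (-1 / (3 * (n + 3)) + 2 / (9 * (n + 3) ^ 3) - 2 / (3 * (n
    + 3) ^ 5))) + (((2 / n) - (2 / n) ^ 2 / 2 + (2 / n) ^ 3 / 3 - (2 / n) ^ 4 / 4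
    + (2 / n) ^ 5 / 5 - (2 / n) ^ 6 / 6) * (1 / (n + 2)) - ((1 / n) - (1 / n) ^ 2 / 2
    + (1 / n) ^ 3 / 3 - (1 / n) ^ 4 / 4 + (1 / n) ^ 5 / 5 - (1 / n) ^ 6 / 6
    + (1 / n) ^ 7 / 7) * (1 / (n + 1)) + ((3 / n) - (3 / n) ^ 2 / 2 + (3 / n) ^ 3 / 3
    - (3 / n) ^ 4 / 4 + (3 / n) ^ 5 / 5 - (3 / n) ^ 6 / 6
    + (3 / n) ^ 7 / 7) * (-1 / (3 * (n + 3)) + 2 / (9 * (n + 3) ^ 3) - 2 / (3 * (n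
    + 3) ^ 5)) + (-1 / (3 * (n + 3) ^ 3) + 25 / (18 * (n + 3) ^ 5)) - (-1 / (3 * n ^ 3)
    + 25 / (18 * n ^ 5))) := by
  obtain ⟨x, hx, rfl⟩ : ∃ x, 0 ≤ x ∧ n = 30 + x := ⟨n - 30, by linarith, by ring⟩
  have : 30 + x ≠ 0 := by positivity
  have : 30 + x + 1 ≠ 0 := by positivity
  have : 30 + x + 2 ≠ 0 := by positivity
  have : 30 + x + 3 ≠ 0 := by positivity
  refine le_of_le_of_eq (b :=
      (3025945097280 + 616670596440 * x + 52000836246 * x ^ 2 + 2324715669 * x ^ 3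
      + 58156041 * x ^ 4 + 772387 * x ^ 5 + 4257 * x ^ 6) / (70 * ((30 + x) ^ 7 * (30 + x
      + 2) ^ 1 * (30 + x + 1) ^ 1 * (30 + x + 3) ^ 5))) (by positivity) ?_
  field_simp
  ring

theorem lTail_upper_coeff {n : ℝ} (hn : 30 ≤ n) :
    0 ≤ ((-1 / (3 * n) + 2 / (9 * n ^ 3)) - (-1 / (3 * (n + 3)) + 2 / (9 * (n + 3) ^ 3))
    - 1 / (n + 2) + 1 / (n + 1)) := by
  obtain ⟨x, hx, rfl⟩ : ∃ x, 0 ≤ x ∧ n = 30 + x := ⟨n - 30, by linarith, by ring⟩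
  have : 30 + x ≠ 0 := by positivity
  have : 30 + x + 1 ≠ 0 := by positivity
  have : 30 + x + 2 ≠ 0 := by positivity
  have : 30 + x + 3 ≠ 0 := by positivity
  refine le_of_le_of_eq (b :=
      (9912 + 630 * x + 10 * x ^ 2) / (1 * ((30 + x) ^ 3 * (30 + x + 3) ^ 3 * (30 + x
      + 2) ^ 1 * (30 + x + 1) ^ 1))) (by positivity) ?_
  field_simp
  ring

theorem lTail_upper_step {n : ℝ} (hn : 30 ≤ n) :
    0 ≤ 34 / 10 * ((-1 / (3 * n) + 2 / (9 * n ^ 3)) - (-1 / (3 * (n + 3)) + 2 / (9 * (n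
    + 3) ^ 3)) - 1 / (n + 2) + 1 / (n + 1)) + (((1 / n) - (1 / n) ^ 2 / 2 + (1 / n) ^ 3 / 3
    - (1 / n) ^ 4 / 4 + (1 / n) ^ 5 / 5 - (1 / n) ^ 6 / 6) * (1 / (n + 1)) - ((2 / n)
    - (2 / n) ^ 2 / 2 + (2 / n) ^ 3 / 3 - (2 / n) ^ 4 / 4 + (2 / n) ^ 5 / 5) * (1 / (n
    + 2)) - ((3 / n) - (3 / n) ^ 2 / 2 + (3 / n) ^ 3 / 3 - (3 / n) ^ 4 / 4
    + (3 / n) ^ 5 / 5 - (3 / n) ^ 6 / 6) * (-1 / (3 * (n + 3)) + 2 / (9 * (n + 3) ^ 3))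
    + (-1 / (3 * n ^ 3)) - (-1 / (3 * (n + 3) ^ 3))) := by
  obtain ⟨x, hx, rfl⟩ : ∃ x, 0 ≤ x ∧ n = 30 + x := ⟨n - 30, by linarith, by ring⟩
  have : 30 + x ≠ 0 := by positivity
  have : 30 + x + 1 ≠ 0 := by positivity
  have : 30 + x + 2 ≠ 0 := by positivity
  have : 30 + x + 3 ≠ 0 := by positivity
  refine le_of_le_of_eq (b :=
      (8901398880 + 1464383880 * x + 96109290 * x ^ 2 + 3146282 * x ^ 3 + 51385 * x ^ 4
      + 335 * x ^ 5) / (30 * ((30 + x) ^ 6 * (30 + x + 3) ^ 3 * (30 + x + 2) ^ 1 * (30 + x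
      + 1) ^ 1))) (by positivity) ?_
  field_simp
  ring

/-- The right-hand bracket is the two-step difference of `rhombDefectOne`, compared with differences
of its truncated expansion in `1 / n`. -/
theorem rhombDefect_upper_step {n : ℝ} (hn : 20 ≤ n) :
    0 ≤ (2 / (3 * n) - 4 / (27 * n ^ 2) + 16 / (243 * n ^ 4)) - (2 / (3 * (n + 2))
    - 4 / (27 * (n + 2) ^ 2) + 16 / (243 * (n + 2) ^ 4)) - (1 / (3 * n) + 1 / (3 * n + 2)
    + 1 / (3 * n + 4) - 1 / (n + 2)) := by
  obtain ⟨x, hx, rfl⟩ : ∃ x, 0 ≤ x ∧ n = 20 + x := ⟨n - 20, by linarith, by ring⟩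
  have : 20 + x ≠ 0 := by positivity
  have : 20 + x + 2 ≠ 0 := by positivity
  have : 3 * (20 + x) + 2 ≠ 0 := by positivity
  have : 3 * (20 + x) + 4 ≠ 0 := by positivity
  refine le_of_le_of_eq (b :=
      (30793728 + 4401664 * x + 209664 * x ^ 2 + 3328 * x ^ 3) / (243 * ((20 + x) ^ 4 * (20
      + x + 2) ^ 4 * (3 * (20 + x) + 2) ^ 1 * (3 * (20 + x) + 4) ^ 1))) (by positivity) ?_
  field_simp
  ring

theorem rhombDefect_lower_step {n : ℝ} (hn : 20 ≤ n) :
    0 ≤ (1 / (3 * n) + 1 / (3 * n + 2) + 1 / (3 * n + 4) - 1 / (n + 2)) - (2 / (3 * n)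
    - 4 / (27 * n ^ 2) + 16 / (243 * n ^ 4) - 13 / (100 * n ^ 6)) + (2 / (3 * (n + 2))
    - 4 / (27 * (n + 2) ^ 2) + 16 / (243 * (n + 2) ^ 4) - 13 / (100 * (n + 2) ^ 6)) := by
  obtain ⟨x, hx, rfl⟩ : ∃ x, 0 ≤ x ∧ n = 20 + x := ⟨n - 20, by linarith, by ring⟩
  have : 20 + x ≠ 0 := by positivity
  have : 20 + x + 2 ≠ 0 := by positivity
  have : 3 * (20 + x) + 2 ≠ 0 := by positivity
  have : 3 * (20 + x) + 4 ≠ 0 := by positivity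
  refine le_of_le_of_eq (b :=
      (5701544282112 + 1716609900128 * x + 223328709072 * x ^ 2 + 16333569688 * x ^ 3
      + 728104020 * x ^ 4 + 19856506 * x ^ 5 + 307671 * x ^ 6
      + 2093 * x ^ 7) / (6075 * ((20 + x) ^ 6 * (3 * (20 + x) + 2) ^ 1 * (3 * (20 + x)
      + 4) ^ 1 * (20 + x + 2) ^ 6))) (by positivity) ?_
  field_simp
  ring

/-- Here the summand is the bound for the defect divided by `n`, and the telescoping function bounds
the tail of the defect series. -/
theorem rhombTail_upper_step {n : ℝ} (hn : 20 ≤ n) :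
    0 ≤ (2 / (3 * n) + 7 / (27 * n ^ 2) + 1 / (27 * n ^ 3) - 5 / (243 * n ^ 4)
    + 13 / (1215 * n ^ 5) + 29 / (729 * n ^ 6) + 1 / (50 * n ^ 7)) - (2 / (3 * (n + 1))
    + 7 / (27 * (n + 1) ^ 2) + 1 / (27 * (n + 1) ^ 3) - 5 / (243 * (n + 1) ^ 4)
    + 13 / (1215 * (n + 1) ^ 5) + 29 / (729 * (n + 1) ^ 6) + 1 / (50 * (n + 1) ^ 7))
    - (2 / (3 * n) - 4 / (27 * n ^ 2) + 16 / (243 * n ^ 4)) / n := by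
  obtain ⟨x, hx, rfl⟩ : ∃ x, 0 ≤ x ∧ n = 20 + x := ⟨n - 20, by linarith, by ring⟩
  have : 20 + x ≠ 0 := by positivity
  have : 20 + x + 1 ≠ 0 := by positivity
  refine le_of_le_of_eq (b :=
      (112968271389 + 31292878513 * x + 3603744149 * x ^ 2 + 220801545 * x ^ 3
      + 7589455 * x ^ 4 + 138719 * x ^ 5 + 1053 * x ^ 6) / (36450 * ((20 + x) ^ 7 * (20 + x
      + 1) ^ 7))) (by positivity) ?_
  field_simp
  ring

theorem rhombTail_lower_step {n : ℝ} (hn : 20 ≤ n) :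
    0 ≤ (2 / (3 * n) - 4 / (27 * n ^ 2) + 16 / (243 * n ^ 4) - 13 / (100 * n ^ 6)) / n
    - (2 / (3 * n) + 7 / (27 * n ^ 2) + 1 / (27 * n ^ 3) - 5 / (243 * n ^ 4)
    + 13 / (1215 * n ^ 5) + 29 / (729 * n ^ 6) - 11 / (400 * n ^ 6)) + (2 / (3 * (n + 1))
    + 7 / (27 * (n + 1) ^ 2) + 1 / (27 * (n + 1) ^ 3) - 5 / (243 * (n + 1) ^ 4)
    + 13 / (1215 * (n + 1) ^ 5) + 29 / (729 * (n + 1) ^ 6) - 11 / (400 * (n + 1) ^ 6)) := by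
  obtain ⟨x, hx, rfl⟩ : ∃ x, 0 ≤ x ∧ n = 20 + x := ⟨n - 20, by linarith, by ring⟩
  have : 20 + x ≠ 0 := by positivity
  have : 20 + x + 1 ≠ 0 := by positivity
  refine le_of_le_of_eq (b :=
      (341306571112 + 121925053931 * x + 17469326274 * x ^ 2 + 1299835405 * x ^ 3
      + 53342660 * x ^ 4 + 1149957 * x ^ 5 + 10206 * x ^ 6) / (291600 * ((20 + x) ^ 7 * (20
      + x + 1) ^ 6))) (by positivity) ?_
  field_simp
  ring

/-! ### Bounds for the constants by finite sums -/

/-- An affine function of `L` with nonnegative slope that is nonnegative at `L₀` stays so for `L ≥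
L₀`. -/
theorem le_of_linear_step {L L₀ l t a P P' Q Q' : ℝ} (hL : L₀ ≤ L) (hl : t ≤ l)
    (hP : 0 ≤ P') (hc : 0 ≤ a - P + P') (hd : 0 ≤ L₀ * (a - P + P') + (t * P' + Q' - Q)) :
    L * P + Q - ((L + l) * P' + Q') ≤ L * a := by
  nlinarith [mul_nonneg (sub_nonneg.2 hL) hc, mul_nonneg (sub_nonneg.2 hl) hP]

theorem ge_of_linear_step {L L₀ l t a P P' Q Q' : ℝ} (hL : L₀ ≤ L) (hl : l ≤ t)
    (hP : 0 ≤ P') (hc : 0 ≤ P - P' - a) (hd : 0 ≤ L₀ * (P - P' - a) + (Q - Q' - t * P')) :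
    L * a ≤ L * P + Q - ((L + l) * P' + Q') := by
  nlinarith [mul_nonneg (sub_nonneg.2 hL) hc, mul_nonneg (sub_nonneg.2 hl) hP]

theorem log_add_eq_add_log {x k : ℝ} (hx : 0 < x) (hk : 0 < k) :
    Real.log (x + k) = Real.log x + Real.log (1 + k / x) := by
  rw [← Real.log_mul hx.ne' (by positivity)]
  congr 1
  field_simp

theorem le_log_of_sixteen_le {x : ℝ} (hx : 16 ≤ x) : 277 / 100 ≤ Real.log x := by
  have h : Real.log 16 = 4 * Real.log 2 := by
    rw [show (16 : ℝ) = 2 ^ 4 by norm_num, Real.log_pow]; norm_num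
  have := Real.log_two_gt_d9
  have := Real.log_le_log (by norm_num) hx
  linarith

theorem le_log_of_thirty_le {x : ℝ} (hx : 30 ≤ x) : 34 / 10 ≤ Real.log x := by
  have h : Real.log 30 = Real.log 2 + Real.log 3 + Real.log 5 := by
    rw [← Real.log_mul (by norm_num) (by norm_num), ← Real.log_mul (by norm_num) (by norm_num)]
    norm_num
  have := Real.log_two_gt_d9
  have := Real.log_three_gt_d9
  have := Real.log_five_gt_d9
  have := Real.log_le_log (by norm_num) hx
  linarith

theorem le_sum_log_div_sq {S : ℝ} (hS : HasSum (fun n : ℕ => Real.log n / (n : ℝ) ^ 2) S) :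
    ∑ n ∈ Finset.range 16, Real.log n / (n : ℝ) ^ 2 +
      (Real.log 16 * (1 / 16 + 1 / (2 * 16 ^ 2) + 1 / (6 * 16 ^ 3) - 1 / (30 * 16 ^ 5)) +
        (1 / 16 - 1 / (12 * 16 ^ 3) + 13 / (360 * 16 ^ 5))) ≤ S := by
  have hU : Tendsto (fun n : ℕ => Real.log n *
      (1 / n + 1 / (2 * n ^ 2) + 1 / (6 * n ^ 3) - 1 / (30 * n ^ 5)) +
        (1 / n - 1 / (12 * n ^ 3) + 13 / (360 * n ^ 5))) atTop (𝓝 0) := by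
    refine ((tendsto_log_mul_inv_add (p := fun z => 1 + z / 2 + z ^ 2 / 6 - z ^ 4 / 30)
      (q := fun z => z - z ^ 3 / 12 + 13 * z ^ 5 / 360) (by fun_prop) (by fun_prop)
      (by norm_num)).comp tendsto_natCast_atTop_atTop).congr fun n => ?_
    simp only [Function.comp_apply]
    ring
  refine le_of_eq_of_le (by norm_num) (hS.add_le_of_telescope hU 16 fun n hn => ?_)
  have hn : (16 : ℝ) ≤ n := by exact_mod_cast hn
  have hl := taylor_le_log (m := 8) (by decide) (t := 1 / n) (by positivity)
  simp only [Finset.sum_range_succ, Finset.sum_range_zero] at hl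
  rw [div_eq_mul_one_div (Real.log n)]
  push_cast
  rw [log_add_eq_add_log (by linarith) one_pos]
  refine le_of_linear_step (le_log_of_sixteen_le hn) (t := _) (hl.trans' (le_of_eq ?_)) ?_
    (zetaTail_lower_coeff hn) (zetaTail_lower_step hn)
  · norm_num; ring
  · have : 1 / (30 * ((n : ℝ) + 1) ^ 5) ≤ 1 / ((n : ℝ) + 1) := by
      gcongr
      have : (1 : ℝ) ≤ n + 1 := by linarith
      nlinarith [pow_le_pow_right₀ this (show 1 ≤ 5 by norm_num)]
    have : 0 ≤ 1 / (2 * ((n : ℝ) + 1) ^ 2) + 1 / (6 * ((n : ℝ) + 1) ^ 3) := by positivity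
    linarith

theorem sum_log_div_sq_le {S : ℝ} (hS : HasSum (fun n : ℕ => Real.log n / (n : ℝ) ^ 2) S) :
    S ≤ ∑ n ∈ Finset.range 16, Real.log n / (n : ℝ) ^ 2 +
      (Real.log 16 * (1 / 16 + 1 / (2 * 16 ^ 2) + 1 / (6 * 16 ^ 3)) +
        (1 / 16 - 1 / (12 * 16 ^ 3))) := by
  have hU : Tendsto (fun n : ℕ => Real.log n *
      (1 / n + 1 / (2 * n ^ 2) + 1 / (6 * n ^ 3)) + (1 / n - 1 / (12 * n ^ 3))) atTop (𝓝 0) := by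
    refine ((tendsto_log_mul_inv_add (p := fun z => 1 + z / 2 + z ^ 2 / 6)
      (q := fun z => z - z ^ 3 / 12) (by fun_prop) (by fun_prop)
      (by norm_num)).comp tendsto_natCast_atTop_atTop).congr fun n => ?_
    simp only [Function.comp_apply]
    ring
  refine (hS.le_add_of_telescope hU 16 fun n hn => ?_).trans_eq (by norm_num)
  have hn : (16 : ℝ) ≤ n := by exact_mod_cast hn
  have hl := log_le_taylor (m := 7) (by decide) (t := 1 / n) (by positivity)
  simp only [Finset.sum_range_succ, Finset.sum_range_zero] at hl
  rw [div_eq_mul_one_div (Real.log n)]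
  push_cast
  rw [log_add_eq_add_log (by linarith) one_pos]
  refine ge_of_linear_step (le_log_of_sixteen_le hn) (t := _) (hl.trans (le_of_eq ?_))
    (by positivity) (zetaTail_upper_coeff hn) (zetaTail_upper_step hn)
  norm_num; ring

/-- The same with three increments, for the logarithms of `y + 1`, `y + 2` and `y + 3`. Since `P' ≤
0`, the third one has to be bounded from above. -/
theorem le_of_linear_steps {L L₀ l₁ l₂ l₃ t₁ t₂ t₃ a₁ a₂ P P' Q Q' : ℝ} (hL : L₀ ≤ L)
    (h₁ : l₁ ≤ t₁) (h₂ : t₂ ≤ l₂) (h₃ : l₃ ≤ t₃) (ha₁ : 0 ≤ a₁) (ha₂ : 0 ≤ a₂) (hP : P' ≤ 0)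
    (hc : 0 ≤ a₂ - a₁ - P + P')
    (hd : 0 ≤ L₀ * (a₂ - a₁ - P + P') + (t₂ * a₂ - t₁ * a₁ + t₃ * P' + Q' - Q)) :
    L * P + Q - ((L + l₃) * P' + Q') ≤ (L + l₂) * a₂ - (L + l₁) * a₁ := by
  nlinarith [mul_nonneg (sub_nonneg.2 hL) hc, mul_nonneg (sub_nonneg.2 h₁) ha₁,
    mul_nonneg (sub_nonneg.2 h₂) ha₂, mul_nonneg (sub_nonneg.2 h₃) (neg_nonneg.2 hP)]

theorem ge_of_linear_steps {L L₀ l₁ l₂ l₃ t₁ t₂ t₃ a₁ a₂ P P' Q Q' : ℝ} (hL : L₀ ≤ L)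
    (h₁ : t₁ ≤ l₁) (h₂ : l₂ ≤ t₂) (h₃ : t₃ ≤ l₃) (ha₁ : 0 ≤ a₁) (ha₂ : 0 ≤ a₂) (hP : P' ≤ 0)
    (hc : 0 ≤ P - P' - a₂ + a₁)
    (hd : 0 ≤ L₀ * (P - P' - a₂ + a₁) + (t₁ * a₁ - t₂ * a₂ - t₃ * P' + Q - Q')) :
    (L + l₂) * a₂ - (L + l₁) * a₁ ≤ L * P + Q - ((L + l₃) * P' + Q') := by
  nlinarith [mul_nonneg (sub_nonneg.2 hL) hc, mul_nonneg (sub_nonneg.2 h₁) ha₁,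
    mul_nonneg (sub_nonneg.2 h₂) ha₂, mul_nonneg (sub_nonneg.2 h₃) (neg_nonneg.2 hP)]

theorem le_sum_log_div_pair {D : ℝ} (hD : HasSum (fun k : ℕ => Real.log (3 * k + 2) / (3 * k + 2) -
      Real.log (3 * k + 1) / (3 * k + 1)) D) :
    ∑ k ∈ Finset.range 10, (Real.log (3 * k + 2) / (3 * k + 2) -
      Real.log (3 * k + 1) / (3 * k + 1)) +
      (Real.log 30 * (-1 / (3 * 30) + 2 / (9 * 30 ^ 3) - 2 / (3 * 30 ^ 5)) +
        (-1 / (3 * 30 ^ 3) + 25 / (18 * 30 ^ 5))) ≤ D := by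
  have h3 : Tendsto (fun n : ℕ => 3 * (n : ℝ)) atTop atTop :=
    tendsto_natCast_atTop_atTop.const_mul_atTop (by norm_num)
  have hU : Tendsto (fun n : ℕ => Real.log (3 * n) *
      (-1 / (3 * (3 * n)) + 2 / (9 * (3 * n) ^ 3) - 2 / (3 * (3 * n) ^ 5)) +
        (-1 / (3 * (3 * n) ^ 3) + 25 / (18 * (3 * n) ^ 5))) atTop (𝓝 0) := by
    refine ((tendsto_log_mul_inv_add (p := fun z => -1 / 3 + 2 * z ^ 2 / 9 - 2 * z ^ 4 / 3)
      (q := fun z => - z ^ 3 / 3 + 25 * z ^ 5 / 18) (by fun_prop) (by fun_prop)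
      (by norm_num)).comp h3).congr fun n => ?_
    simp only [Function.comp_apply]
    generalize (3 * n : ℝ) = y
    ring
  refine le_of_eq_of_le (by norm_num) (hD.add_le_of_telescope hU 10 fun k hk => ?_)
  have hy : (30 : ℝ) ≤ 3 * k := by
    have : (10 : ℝ) ≤ k := by exact_mod_cast hk
    linarith
  have e3 : 3 * ((k + 1 : ℕ) : ℝ) = 3 * k + 3 := by push_cast; ring
  simp only [e3]
  generalize (3 * k : ℝ) = y at hy
  have h1 := log_le_taylor (m := 7) (by decide) (t := 1 / y) (by positivity)
  have h2 := taylor_le_log (m := 6) (by decide) (t := 2 / y) (by positivity)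
  have h3 := log_le_taylor (m := 7) (by decide) (t := 3 / y) (by positivity)
  simp only [Finset.sum_range_succ, Finset.sum_range_zero] at h1 h2 h3
  rw [log_add_eq_add_log (by linarith) one_pos, log_add_eq_add_log (by linarith) two_pos,
    log_add_eq_add_log (by linarith) three_pos, div_eq_mul_one_div _ (y + 2),
    div_eq_mul_one_div _ (y + 1)]
  refine le_of_linear_steps (le_log_of_thirty_le hy) (t₁ := _) (t₂ := _) (t₃ := _)
    (h1.trans (le_of_eq ?_)) (h2.trans' (le_of_eq ?_)) (h3.trans (le_of_eq ?_)) (by positivity)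
    (by positivity) ?_ (lTail_lower_coeff hy) (lTail_lower_step hy)
  · norm_num; ring
  · norm_num; ring
  · norm_num; ring
  · have : 2 / (9 * (y + 3) ^ 3) ≤ 1 / (3 * (y + 3)) := by
      rw [div_le_div_iff₀ (by positivity) (by positivity)]
      nlinarith [pow_le_pow_right₀ (show 1 ≤ y + 3 by linarith) (show 1 ≤ 3 by norm_num)]
    have : 0 ≤ 2 / (3 * (y + 3) ^ 5) := by positivity
    rw [neg_div]
    linarith

theorem sum_log_div_pair_le {D : ℝ} (hD : HasSum (fun k : ℕ => Real.log (3 * k + 2) / (3 * k + 2) -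
      Real.log (3 * k + 1) / (3 * k + 1)) D) :
    D ≤ ∑ k ∈ Finset.range 10, (Real.log (3 * k + 2) / (3 * k + 2) -
      Real.log (3 * k + 1) / (3 * k + 1)) +
      (Real.log 30 * (-1 / (3 * 30) + 2 / (9 * 30 ^ 3)) + -1 / (3 * 30 ^ 3)) := by
  have h3 : Tendsto (fun n : ℕ => 3 * (n : ℝ)) atTop atTop :=
    tendsto_natCast_atTop_atTop.const_mul_atTop (by norm_num)
  have hU : Tendsto (fun n : ℕ => Real.log (3 * n) *
      (-1 / (3 * (3 * n)) + 2 / (9 * (3 * n) ^ 3)) + -1 / (3 * (3 * n) ^ 3)) atTop (𝓝 0) := by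
    refine ((tendsto_log_mul_inv_add (p := fun z => -1 / 3 + 2 * z ^ 2 / 9)
      (q := fun z => - z ^ 3 / 3) (by fun_prop) (by fun_prop)
      (by norm_num)).comp h3).congr fun n => ?_
    simp only [Function.comp_apply]
    generalize (3 * n : ℝ) = y
    ring
  refine (hD.le_add_of_telescope hU 10 fun k hk => ?_).trans_eq (by norm_num)
  have hy : (30 : ℝ) ≤ 3 * k := by
    have : (10 : ℝ) ≤ k := by exact_mod_cast hk
    linarith
  have e3 : 3 * ((k + 1 : ℕ) : ℝ) = 3 * k + 3 := by push_cast; ring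
  simp only [e3]
  generalize (3 * k : ℝ) = y at hy
  have h1 := taylor_le_log (m := 6) (by decide) (t := 1 / y) (by positivity)
  have h2 := log_le_taylor (m := 5) (by decide) (t := 2 / y) (by positivity)
  have h3 := taylor_le_log (m := 6) (by decide) (t := 3 / y) (by positivity)
  simp only [Finset.sum_range_succ, Finset.sum_range_zero] at h1 h2 h3
  rw [log_add_eq_add_log (by linarith) one_pos, log_add_eq_add_log (by linarith) two_pos,
    log_add_eq_add_log (by linarith) three_pos, div_eq_mul_one_div _ (y + 2),
    div_eq_mul_one_div _ (y + 1)]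
  refine ge_of_linear_steps (le_log_of_thirty_le hy) (t₁ := _) (t₂ := _) (t₃ := _)
    (h1.trans' (le_of_eq ?_)) (h2.trans (le_of_eq ?_)) (h3.trans' (le_of_eq ?_)) (by positivity)
    (by positivity) ?_ (lTail_upper_coeff hy) (lTail_upper_step hy)
  · norm_num; ring
  · norm_num; ring
  · norm_num; ring
  · have : 2 / (9 * (y + 3) ^ 3) ≤ 1 / (3 * (y + 3)) := by
      rw [div_le_div_iff₀ (by positivity) (by positivity)]
      nlinarith [pow_le_pow_right₀ (show 1 ≤ y + 3 by linarith) (show 1 ≤ 3 by norm_num)]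
    rw [neg_div]
    linarith

theorem le_eulerMascheroniConstant : (harmonic 16 : ℝ) - Real.log 16 +
    (-1 / (2 * 16) + 1 / (12 * 16 ^ 2) - 1 / (120 * 16 ^ 4)) ≤ Real.eulerMascheroniConstant := by
  have hw : Tendsto (fun n : ℕ => (-1 / (2 * n) + 1 / (12 * n ^ 2) - 1 / (120 * n ^ 4) : ℝ))
      atTop (𝓝 0) := by
    refine ((tendsto_log_mul_inv_add (p := fun z => 0) (q := fun z => -z / 2 + z ^ 2 / 12 -
      z ^ 4 / 120) (by fun_prop) (by fun_prop) (by norm_num)).comp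
      tendsto_natCast_atTop_atTop).congr fun n => ?_
    simp only [Function.comp_apply]
    ring
  have ht := Real.tendsto_harmonic_sub_log.add hw
  rw [add_zero] at ht
  refine (le_of_tendsto_of_le_add ht one_pos (N := 16) (fun n hn => ?_) le_rfl).trans' (by norm_num)
  have hn : (16 : ℝ) ≤ n := by exact_mod_cast hn
  have hl := log_le_taylor (m := 9) (by decide) (t := 1 / n) (by positivity)
  simp only [Finset.sum_range_succ, Finset.sum_range_zero] at hl
  have := eulerMascheroni_lower_step hn
  rw [harmonic_succ]
  push_cast
  rw [log_add_eq_add_log (by linarith) one_pos, ← one_div]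
  norm_num at hl this ⊢
  linarith

theorem eulerMascheroniConstant_le : Real.eulerMascheroniConstant ≤
    (harmonic 16 : ℝ) - Real.log 16 +
    (-1 / (2 * 16) + 1 / (12 * 16 ^ 2) - 1 / (120 * 16 ^ 4) + 1 / (200 * 16 ^ 6)) := by
  have hw : Tendsto (fun n : ℕ => (-1 / (2 * n) + 1 / (12 * n ^ 2) - 1 / (120 * n ^ 4) +
      1 / (200 * n ^ 6) : ℝ)) atTop (𝓝 0) := by
    refine ((tendsto_log_mul_inv_add (p := fun z => 0) (q := fun z => -z / 2 + z ^ 2 / 12 -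
      z ^ 4 / 120 + z ^ 6 / 200) (by fun_prop) (by fun_prop) (by norm_num)).comp
      tendsto_natCast_atTop_atTop).congr fun n => ?_
    simp only [Function.comp_apply]
    ring
  have ht := Real.tendsto_harmonic_sub_log.add hw
  rw [add_zero] at ht
  refine (ge_of_tendsto_of_add_le ht one_pos (N := 16) (fun n hn => ?_) le_rfl).trans (by norm_num)
  have hn : (16 : ℝ) ≤ n := by exact_mod_cast hn
  have hl := taylor_le_log (m := 8) (by decide) (t := 1 / n) (by positivity)
  simp only [Finset.sum_range_succ, Finset.sum_range_zero] at hl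
  have := eulerMascheroni_upper_step hn
  rw [harmonic_succ]
  push_cast
  rw [log_add_eq_add_log (by linarith) one_pos, ← one_div]
  norm_num [neg_div] at hl this ⊢
  linarith

theorem tendsto_rhombDefectOne : Tendsto rhombDefectOne atTop (𝓝 0) := by
  refine tendsto_of_tendsto_of_tendsto_of_le_of_le' tendsto_const_nhds
    (tendsto_inv_atTop_zero.comp tendsto_natCast_atTop_atTop) ?_ ?_
  · filter_upwards [eventually_gt_atTop 0] with b hb using (rhombDefectOne_bound hb).1
  · filter_upwards [eventually_gt_atTop 0] with b hb using (rhombDefectOne_bound hb).2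

theorem sum_Ioo_zero_eq {M : Type*} [AddCommMonoid M] (f : ℕ → M) (m : ℕ) :
    ∑ j ∈ Finset.Ioo 0 (m + 1), f j = ∑ j ∈ Finset.range m, f (j + 1) := by
  rw [Finset.range_eq_Ico, Finset.sum_Ico_add' f 0 m 1]
  rfl

/-- The denominators for `b` are `b + 2, b + 4, …, 3b - 2`; those for `b + 2` are `b + 4, …, 3b +
4`. The lists differ by `b + 2` against `3b`, `3b + 2`, `3b + 4`. -/
theorem rhombDefectOne_sub {b : ℕ} (hb : 0 < b) : rhombDefectOne b - rhombDefectOne (b + 2) =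
    1 / (3 * b) + 1 / (3 * b + 2) + 1 / (3 * b + 4) - 1 / (b + 2) := by
  obtain ⟨m, rfl⟩ : ∃ m, b = m + 1 := ⟨b - 1, by omega⟩
  set F : ℕ → ℝ := fun j => ((2 * j + (m + 3) : ℕ) : ℝ)⁻¹ with hF
  have h1 : ∑ j ∈ Finset.Ioo 0 (m + 1), ((2 * j + (m + 1) : ℕ) : ℝ)⁻¹ =
      ∑ j ∈ Finset.range m, F j := by
    rw [sum_Ioo_zero_eq]
    refine Finset.sum_congr rfl fun j _ => ?_
    rw [hF]
    ring_nf
  have h2 : ∑ j ∈ Finset.Ioo 0 (m + 1 + 2), ((2 * j + (m + 1 + 2) : ℕ) : ℝ)⁻¹ =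
      ∑ j ∈ Finset.range (m + 2), F (j + 1) := sum_Ioo_zero_eq _ (m + 2)
  have h3 := Finset.sum_range_succ' F (m + 2)
  rw [Finset.sum_range_succ, Finset.sum_range_succ, Finset.sum_range_succ] at h3
  rw [rhombDefectOne, rhombDefectOne, h1, h2]
  have e0 : F 0 = 1 / (((m + 1 : ℕ) : ℝ) + 2) := by
    simp only [hF]; push_cast; rw [one_div]; congr 1; ring
  have e1 : F m = 1 / (3 * ((m + 1 : ℕ) : ℝ)) := by
    simp only [hF]; push_cast; rw [one_div]; congr 1; ring
  have e2 : F (m + 1) = 1 / (3 * ((m + 1 : ℕ) : ℝ) + 2) := by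
    simp only [hF]; push_cast; rw [one_div]; congr 1; ring
  have e3 : F (m + 2) = 1 / (3 * ((m + 1 : ℕ) : ℝ) + 4) := by
    simp only [hF]; push_cast; rw [one_div]; congr 1; ring
  rw [← e0, ← e1, ← e2, ← e3]
  linarith

theorem rhombDefectOne_le {b : ℕ} (hb : 20 ≤ b) : rhombDefectOne b ≤
    2 / (3 * b) - 4 / (27 * b ^ 2) + 16 / (243 * b ^ 4) := by
  have hA : Tendsto (fun b : ℕ => (2 / (3 * b) - 4 / (27 * b ^ 2) + 16 / (243 * b ^ 4) : ℝ))
      atTop (𝓝 0) := by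
    refine ((tendsto_log_mul_inv_add (p := fun z => 0) (q := fun z => 2 * z / 3 - 4 * z ^ 2 / 27 +
      16 * z ^ 4 / 243) (by fun_prop) (by fun_prop) (by norm_num)).comp
      tendsto_natCast_atTop_atTop).congr fun n => ?_
    simp only [Function.comp_apply]
    ring
  have ht := tendsto_rhombDefectOne.sub hA
  rw [sub_zero] at ht
  have := le_of_tendsto_of_le_add ht two_pos (N := 20) (fun n hn => ?_) hb
  · linarith
  · have h1 := rhombDefectOne_sub (b := n) (by omega)
    have h2 := rhombDefect_upper_step (n := n) (by exact_mod_cast hn)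
    push_cast
    linarith

theorem le_rhombDefectOne {b : ℕ} (hb : 20 ≤ b) :
    2 / (3 * b) - 4 / (27 * b ^ 2) + 16 / (243 * b ^ 4) - 13 / (100 * b ^ 6) ≤
      rhombDefectOne b := by
  have hA : Tendsto (fun b : ℕ => (2 / (3 * b) - 4 / (27 * b ^ 2) + 16 / (243 * b ^ 4) -
      13 / (100 * b ^ 6) : ℝ)) atTop (𝓝 0) := by
    refine ((tendsto_log_mul_inv_add (p := fun z => 0) (q := fun z => 2 * z / 3 - 4 * z ^ 2 / 27 +
      16 * z ^ 4 / 243 - 13 * z ^ 6 / 100) (by fun_prop) (by fun_prop) (by norm_num)).comp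
      tendsto_natCast_atTop_atTop).congr fun n => ?_
    simp only [Function.comp_apply]
    ring
  have ht := tendsto_rhombDefectOne.sub hA
  rw [sub_zero] at ht
  have := ge_of_tendsto_of_add_le ht two_pos (N := 20) (fun n hn => ?_) hb
  · linarith
  · have h1 := rhombDefectOne_sub (b := n) (by omega)
    have h2 := rhombDefect_lower_step (n := n) (by exact_mod_cast hn)
    push_cast
    linarith

theorem tsum_rhombDefectOne_le : ∑' b : ℕ, (b : ℝ)⁻¹ * rhombDefectOne b ≤
    ∑ b ∈ Finset.range 20, (b : ℝ)⁻¹ * rhombDefectOne b +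
    (2 / (3 * 20) + 7 / (27 * 20 ^ 2) + 1 / (27 * 20 ^ 3) - 5 / (243 * 20 ^ 4) +
      13 / (1215 * 20 ^ 5) + 29 / (729 * 20 ^ 6) + 1 / (50 * 20 ^ 7)) := by
  have hU : Tendsto (fun b : ℕ => (2 / (3 * b) + 7 / (27 * b ^ 2) + 1 / (27 * b ^ 3) -
      5 / (243 * b ^ 4) + 13 / (1215 * b ^ 5) + 29 / (729 * b ^ 6) + 1 / (50 * b ^ 7) : ℝ))
      atTop (𝓝 0) := by
    refine ((tendsto_log_mul_inv_add (p := fun z => 0) (q := fun z => 2 * z / 3 + 7 * z ^ 2 / 27 +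
      z ^ 3 / 27 - 5 * z ^ 4 / 243 + 13 * z ^ 5 / 1215 + 29 * z ^ 6 / 729 + z ^ 7 / 50)
      (by fun_prop) (by fun_prop) (by norm_num)).comp
      tendsto_natCast_atTop_atTop).congr fun n => ?_
    simp only [Function.comp_apply]
    ring
  refine (summable_rhombDefectOne.hasSum.le_add_of_telescope hU 20 fun b hb => ?_).trans_eq
    (by norm_num)
  have hb' : (20 : ℝ) ≤ b := by exact_mod_cast hb
  have h := rhombTail_upper_step hb'
  have h2 := mul_le_mul_of_nonneg_left (rhombDefectOne_le hb) (show 0 ≤ (b : ℝ)⁻¹ by positivity)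
  rw [inv_mul_eq_div, inv_mul_eq_div] at h2
  rw [inv_mul_eq_div]
  push_cast
  linarith

theorem le_tsum_rhombDefectOne : ∑ b ∈ Finset.range 20, (b : ℝ)⁻¹ * rhombDefectOne b +
    (2 / (3 * 20) + 7 / (27 * 20 ^ 2) + 1 / (27 * 20 ^ 3) - 5 / (243 * 20 ^ 4) +
      13 / (1215 * 20 ^ 5) + 29 / (729 * 20 ^ 6) - 11 / (400 * 20 ^ 6)) ≤
    ∑' b : ℕ, (b : ℝ)⁻¹ * rhombDefectOne b := by
  have hU : Tendsto (fun b : ℕ => (2 / (3 * b) + 7 / (27 * b ^ 2) + 1 / (27 * b ^ 3) -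
      5 / (243 * b ^ 4) + 13 / (1215 * b ^ 5) + 29 / (729 * b ^ 6) - 11 / (400 * b ^ 6) : ℝ))
      atTop (𝓝 0) := by
    refine ((tendsto_log_mul_inv_add (p := fun z => 0) (q := fun z => 2 * z / 3 + 7 * z ^ 2 / 27 +
      z ^ 3 / 27 - 5 * z ^ 4 / 243 + 13 * z ^ 5 / 1215 + 29 * z ^ 6 / 729 - 11 * z ^ 6 / 400)
      (by fun_prop) (by fun_prop) (by norm_num)).comp
      tendsto_natCast_atTop_atTop).congr fun n => ?_
    simp only [Function.comp_apply]
    ring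
  refine le_of_eq_of_le (by norm_num)
    (summable_rhombDefectOne.hasSum.add_le_of_telescope hU 20 fun b hb => ?_)
  have hb' : (20 : ℝ) ≤ b := by exact_mod_cast hb
  have h := rhombTail_lower_step hb'
  have h2 := mul_le_mul_of_nonneg_left (le_rhombDefectOne hb) (show 0 ≤ (b : ℝ)⁻¹ by positivity)
  rw [inv_mul_eq_div, inv_mul_eq_div] at h2
  rw [inv_mul_eq_div]
  push_cast
  linarith

/-! ### Numerical values -/

/-- `log((m + 1) / m) = 2 artanh(1 / (2m + 1))`, whose series converges fast. Primes are reached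
from predecessors whose prime factors are already treated. -/
theorem log_add_one_sub_log_bounds {m : ℝ} (hm : 0 < m) (n : ℕ) :
    2 * ∑ i ∈ Finset.range n, (1 / (2 * m + 1)) ^ (2 * i + 1) / (2 * i + 1) ≤
      Real.log (m + 1) - Real.log m ∧
    Real.log (m + 1) - Real.log m ≤ 2 * (∑ i ∈ Finset.range n,
      (1 / (2 * m + 1)) ^ (2 * i + 1) / (2 * i + 1) +
      (1 / (2 * m + 1)) ^ (2 * n + 1) / (1 - (1 / (2 * m + 1)) ^ 2)) := by
  have h0 : (0 : ℝ) ≤ 1 / (2 * m + 1) := by positivity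
  have h1 : 1 / (2 * m + 1) < 1 := by
    rw [div_lt_one (by positivity)]; linarith
  have e : (1 + 1 / (2 * m + 1)) / (1 - 1 / (2 * m + 1)) = (m + 1) / m := by
    have : 1 - 1 / (2 * m + 1) ≠ 0 := by linarith
    have : 2 * m + 1 ≠ 0 := by positivity
    rw [div_eq_div_iff ‹_› hm.ne']
    field_simp
    ring
  have h2 := Real.sum_range_le_log_div h0 h1 n
  have h3 := Real.log_div_le_sum_range_add h0 h1 n
  rw [e, Real.log_div (by positivity) hm.ne'] at h2 h3
  constructor <;> linarith

theorem log_two_bounds : 0.69314718045 ≤ Real.log 2 ∧ Real.log 2 ≤ 0.69314718067 := by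
  have := abs_le.1 Real.log_two_near_10
  constructor <;> norm_num at this ⊢ <;> linarith

theorem log_three_bounds : 1.09861228857 ≤ Real.log 3 ∧ Real.log 3 ≤ 1.09861228877 := by
  have := abs_le.1 Real.log_three_near_10
  constructor <;> norm_num at this ⊢ <;> linarith

theorem log_five_bounds : 1.60943791233 ≤ Real.log 5 ∧ Real.log 5 ≤ 1.60943791253 := by
  have := abs_le.1 Real.log_five_near_10
  constructor <;> norm_num at this ⊢ <;> linarith

theorem log_mul_of_pos {a b : ℝ} (ha : 0 < a) (hb : 0 < b) :
    Real.log (a * b) = Real.log a + Real.log b :=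
  Real.log_mul ha.ne' hb.ne'

theorem log_four : Real.log 4 = 2 * Real.log 2 := by
  rw [show (4 : ℝ) = 2 * 2 by norm_num, log_mul_of_pos two_pos two_pos]; ring

theorem log_six : Real.log 6 = Real.log 2 + Real.log 3 := by
  rw [← log_mul_of_pos two_pos three_pos]; norm_num

theorem log_eight : Real.log 8 = 3 * Real.log 2 := by
  rw [show (8 : ℝ) = 2 ^ 3 by norm_num, Real.log_pow]; norm_num

theorem log_nine : Real.log 9 = 2 * Real.log 3 := by
  rw [show (9 : ℝ) = 3 ^ 2 by norm_num, Real.log_pow]; norm_num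

theorem log_ten : Real.log 10 = Real.log 2 + Real.log 5 := by
  rw [← log_mul_of_pos two_pos (by norm_num)]; norm_num

theorem log_twelve : Real.log 12 = 2 * Real.log 2 + Real.log 3 := by
  rw [← log_four, ← log_mul_of_pos (by norm_num) three_pos]; norm_num

theorem log_fourteen : Real.log 14 = Real.log 2 + Real.log 7 := by
  rw [← log_mul_of_pos two_pos (by norm_num)]; norm_num

theorem log_fifteen : Real.log 15 = Real.log 3 + Real.log 5 := by
  rw [← log_mul_of_pos three_pos (by norm_num)]; norm_num

theorem log_sixteen : Real.log 16 = 4 * Real.log 2 := by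
  rw [show (16 : ℝ) = 2 ^ 4 by norm_num, Real.log_pow]; norm_num

theorem log_eighteen : Real.log 18 = Real.log 2 + 2 * Real.log 3 := by
  rw [← log_nine, ← log_mul_of_pos two_pos (by norm_num)]; norm_num

theorem log_twenty : Real.log 20 = 2 * Real.log 2 + Real.log 5 := by
  rw [← log_four, ← log_mul_of_pos (by norm_num) (by norm_num)]; norm_num

theorem log_twentyTwo : Real.log 22 = Real.log 2 + Real.log 11 := by
  rw [← log_mul_of_pos two_pos (by norm_num)]; norm_num

theorem log_twentyFive : Real.log 25 = 2 * Real.log 5 := by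
  rw [show (25 : ℝ) = 5 ^ 2 by norm_num, Real.log_pow]; norm_num

theorem log_twentySix : Real.log 26 = Real.log 2 + Real.log 13 := by
  rw [← log_mul_of_pos two_pos (by norm_num)]; norm_num

theorem log_twentyEight : Real.log 28 = 2 * Real.log 2 + Real.log 7 := by
  rw [← log_four, ← log_mul_of_pos (by norm_num) (by norm_num)]; norm_num

theorem log_thirty : Real.log 30 = Real.log 2 + Real.log 3 + Real.log 5 := by
  rw [← log_six, ← log_mul_of_pos (by norm_num) (by norm_num)]; norm_num

theorem log_seven_bounds : 1.9459101487 ≤ Real.log 7 ∧ Real.log 7 ≤ 1.9459101494 := by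
  have h := log_add_one_sub_log_bounds (m := 6) (by norm_num) 5
  obtain ⟨h1, h2⟩ := log_two_bounds
  obtain ⟨h3, h4⟩ := log_three_bounds
  norm_num [Finset.sum_range_succ, log_six] at h h1 h2 h3 h4 ⊢
  constructor <;> linarith

theorem log_eleven_bounds : 2.3978952725 ≤ Real.log 11 ∧ Real.log 11 ≤ 2.3978952731 := by
  have h := log_add_one_sub_log_bounds (m := 10) (by norm_num) 5
  obtain ⟨h1, h2⟩ := log_two_bounds
  obtain ⟨h3, h4⟩ := log_five_bounds
  norm_num [Finset.sum_range_succ, log_ten] at h h1 h2 h3 h4 ⊢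
  constructor <;> linarith

theorem log_thirteen_bounds : 2.5649493570 ≤ Real.log 13 ∧ Real.log 13 ≤ 2.5649493579 := by
  have h := log_add_one_sub_log_bounds (m := 12) (by norm_num) 5
  obtain ⟨h1, h2⟩ := log_two_bounds
  obtain ⟨h3, h4⟩ := log_three_bounds
  norm_num [Finset.sum_range_succ, log_twelve] at h h1 h2 h3 h4 ⊢
  constructor <;> linarith

theorem log_seventeen_bounds : 2.8332133435 ≤ Real.log 17 ∧ Real.log 17 ≤ 2.8332133446 := by
  have h := log_add_one_sub_log_bounds (m := 16) (by norm_num) 5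
  obtain ⟨h1, h2⟩ := log_two_bounds
  norm_num [Finset.sum_range_succ, log_sixteen] at h h1 h2 ⊢
  constructor <;> linarith

theorem log_nineteen_bounds : 2.9444389787 ≤ Real.log 19 ∧ Real.log 19 ≤ 2.9444389796 := by
  have h := log_add_one_sub_log_bounds (m := 18) (by norm_num) 5
  obtain ⟨h1, h2⟩ := log_two_bounds
  obtain ⟨h3, h4⟩ := log_three_bounds
  norm_num [Finset.sum_range_succ, log_eighteen] at h h1 h2 h3 h4 ⊢
  constructor <;> linarith

theorem log_twentyThree_bounds : 3.1354942153 ≤ Real.log 23 ∧ Real.log 23 ≤ 3.1354942166 := by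
  have h := log_add_one_sub_log_bounds (m := 22) (by norm_num) 5
  obtain ⟨h1, h2⟩ := log_two_bounds
  obtain ⟨h3, h4⟩ := log_eleven_bounds
  norm_num [Finset.sum_range_succ, log_twentyTwo] at h h1 h2 h3 h4 ⊢
  constructor <;> linarith

theorem log_twentyNine_bounds : 3.3672958293 ≤ Real.log 29 ∧ Real.log 29 ≤ 3.3672958307 := by
  have h := log_add_one_sub_log_bounds (m := 28) (by norm_num) 5
  obtain ⟨h1, h2⟩ := log_two_bounds
  obtain ⟨h3, h4⟩ := log_seven_bounds
  norm_num [Finset.sum_range_succ, log_twentyEight] at h h1 h2 h3 h4 ⊢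
  constructor <;> linarith

theorem eulerMascheroniConstant_bounds : 0.5772156642 ≤ Real.eulerMascheroniConstant ∧
    Real.eulerMascheroniConstant ≤ 0.5772156655 := by
  have h1 := le_eulerMascheroniConstant
  have h2 := eulerMascheroniConstant_le
  obtain ⟨h3, h4⟩ := log_two_bounds
  rw [log_sixteen, harmonic] at h1 h2
  norm_num [Finset.sum_range_succ] at h1 h2 h3 h4 ⊢
  constructor <;> linarith

theorem sum_log_div_sq_bounds {S : ℝ} (hS : HasSum (fun n : ℕ => Real.log n / (n : ℝ) ^ 2) S) :
    0.9375482540 ≤ S ∧ S ≤ 0.9375483081 := by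
  have h1 := le_sum_log_div_sq hS
  have h2 := sum_log_div_sq_le hS
  obtain ⟨a1, a2⟩ := log_two_bounds
  obtain ⟨a3, a4⟩ := log_three_bounds
  obtain ⟨a5, a6⟩ := log_five_bounds
  obtain ⟨a7, a8⟩ := log_seven_bounds
  obtain ⟨b1, b2⟩ := log_eleven_bounds
  obtain ⟨b3, b4⟩ := log_thirteen_bounds
  simp only [Finset.sum_range_succ, Finset.sum_range_zero] at h1 h2
  push_cast at h1 h2
  simp only [log_four, log_six, log_eight, log_nine, log_ten, log_twelve, log_fourteen,
    log_fifteen, log_sixteen, Real.log_one, Real.log_zero] at h1 h2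
  norm_num at h1 h2 a1 a2 a3 a4 a5 a6 a7 a8 b1 b2 b3 b4 ⊢
  constructor <;> linarith

theorem sum_log_div_pair_bounds {D : ℝ} (hD : HasSum (fun k : ℕ => Real.log (3 * k + 2) /
      (3 * k + 2) - Real.log (3 * k + 1) / (3 * k + 1)) D) :
    0.2226629850 ≤ D ∧ D ≤ 0.2226630250 := by
  have h1 := le_sum_log_div_pair hD
  have h2 := sum_log_div_pair_le hD
  obtain ⟨a1, a2⟩ := log_two_bounds
  obtain ⟨a3, a4⟩ := log_three_bounds
  obtain ⟨a5, a6⟩ := log_five_bounds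
  obtain ⟨a7, a8⟩ := log_seven_bounds
  obtain ⟨b1, b2⟩ := log_eleven_bounds
  obtain ⟨b3, b4⟩ := log_thirteen_bounds
  obtain ⟨b5, b6⟩ := log_seventeen_bounds
  obtain ⟨b7, b8⟩ := log_nineteen_bounds
  obtain ⟨c1, c2⟩ := log_twentyThree_bounds
  obtain ⟨c3, c4⟩ := log_twentyNine_bounds
  norm_num [Finset.sum_range_succ, log_four, log_eight, log_ten, log_fourteen, log_sixteen,
    log_twenty, log_twentyTwo, log_twentyFive, log_twentySix, log_twentyEight, log_thirty]
    at h1 h2 a1 a2 a3 a4 a5 a6 a7 a8 b1 b2 b3 b4 b5 b6 b7 b8 c1 c2 c3 c4 ⊢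
  constructor <;> linarith

theorem tsum_rhombDefectOne_bounds : 0.9511565173 ≤ ∑' b : ℕ, (b : ℝ)⁻¹ * rhombDefectOne b ∧
    ∑' b : ℕ, (b : ℝ)⁻¹ * rhombDefectOne b ≤ 0.9511565183 := by
  have h1 := le_tsum_rhombDefectOne
  have h2 := tsum_rhombDefectOne_le
  obtain ⟨a3, a4⟩ := log_three_bounds
  have hI : ∀ m : ℕ, rhombDefectOne (m + 1) = Real.log 3 / 2 -
      ∑ j ∈ Finset.range m, ((2 * j + m + 3 : ℕ) : ℝ)⁻¹ := by
    intro m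
    rw [rhombDefectOne, sum_Ioo_zero_eq]
    congr 1
    refine Finset.sum_congr rfl fun j _ => ?_
    congr 2
    ring
  rw [Finset.sum_range_succ'] at h1 h2
  simp only [hI, Nat.cast_zero, inv_zero, zero_mul, add_zero] at h1 h2
  norm_num [Finset.sum_range_succ] at h1 h2 a3 a4 ⊢
  constructor <;> linarith

theorem sqrt_three_bounds : 1.732050807568 ≤ √3 ∧ √3 ≤ 1.732050807569 :=
  ⟨Real.le_sqrt_of_sq_le (by norm_num), (Real.sqrt_le_left (by norm_num)).2 (by norm_num)⟩

theorem one_div_pi_bounds : 0.3183098861837 ≤ 1 / Real.pi ∧ 1 / Real.pi ≤ 0.3183098861838 := by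
  have h1 := Real.pi_gt_d20
  have h2 := Real.pi_lt_d20
  constructor
  · rw [le_div_iff₀ Real.pi_pos]
    norm_num at h1 h2 ⊢; linarith
  · rw [div_le_iff₀ Real.pi_pos]
    norm_num at h1 h2 ⊢; linarith

/-- A form suited to interval arithmetic: `1 / log 3` has been multiplied out, and only products of
positive enclosed quantities occur. -/
theorem eq_real_of_eq_linCoeff {c : ℝ} (hc : (c : ℂ) = linCoeff) : ∃ D S : ℝ,
    HasSum (fun k : ℕ => Real.log (3 * k + 2) / (3 * k + 2) -
      Real.log (3 * k + 1) / (3 * k + 1)) D ∧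
    HasSum (fun n : ℕ => Real.log n / (n : ℝ) ^ 2) S ∧
    c = Real.pi * √3 / 9 + √3 * (1 / Real.pi) *
      (9 / 8 * (Real.log 3 * Real.eulerMascheroniConstant) - 3 / 32 * (Real.log 3 * Real.log 3) -
        3 / 2 * (∑' b : ℕ, (b : ℝ)⁻¹ * rhombDefectOne b) +
        9 / 2 * ((1 / Real.pi) * (1 / Real.pi) * (Real.log 3 * S))) +
      27 / 8 * ((1 / Real.pi) * (1 / Real.pi) * (Real.log 3 * D)) := by
  obtain ⟨D, hD, hD'⟩ := hasSum_deriv_lFunction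
  obtain ⟨S, hS, hS'⟩ := hasSum_deriv_zeta
  refine ⟨D, S, hD', hS', ?_⟩
  have e1 : Real.pi / (3 * √3) = Real.pi * √3 / 9 := by
    have : √3 ^ 2 = 3 := Real.sq_sqrt (by norm_num)
    field_simp
    linarith
  rw [linCoeff, leadCoeff_eq, lFunction_one, hD, hS, riemannZeta_two, e1] at hc
  rw [tsum_rhombDefectOne]
  generalize (∑' p, evenTerm (p + 1)) = E at *
  generalize (∑' k, oddTerm k) = O at *
  have hl : Real.log 3 ≠ 0 := (Real.log_pos (by norm_num)).ne'
  have h : c = Real.pi * √3 / 9 + 3 * √3 * Real.log 3 / (8 * Real.pi) *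
      (Real.eulerMascheroniConstant + D / (Real.pi * √3 / 9) - 2 * (-S / (Real.pi ^ 2 / 6)) +
        2 * Real.eulerMascheroniConstant - Real.log 3 / 4 - 1 / Real.log 3 * (E + O)) := by
    exact_mod_cast hc
  rw [h]
  field_simp
  ring

theorem mul_bounds {a b a₁ a₂ b₁ b₂ : ℝ} (ha : a₁ ≤ a ∧ a ≤ a₂) (hb : b₁ ≤ b ∧ b ≤ b₂)
    (ha₁ : 0 ≤ a₁) (hb₁ : 0 ≤ b₁) : a₁ * b₁ ≤ a * b ∧ a * b ≤ a₂ * b₂ :=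
  ⟨mul_le_mul ha.1 hb.1 hb₁ (ha₁.trans ha.1),
    mul_le_mul ha.2 hb.2 (hb₁.trans hb.1) (ha₁.trans (ha.1.trans ha.2))⟩

theorem abs_sub_lt_of_eq_linCoeff {c : ℝ} (hc : (c : ℂ) = linCoeff) :
    |c - 0.4915036| < 5 * 10 ^ (-8 : ℤ) := by
  obtain ⟨D, S, hD, hS, rfl⟩ := eq_real_of_eq_linCoeff hc
  have bD := sum_log_div_pair_bounds hD
  have bS := sum_log_div_sq_bounds hS
  have bT := tsum_rhombDefectOne_bounds
  have bγ := eulerMascheroniConstant_bounds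
  have bl := log_three_bounds
  have bs := sqrt_three_bounds
  have bp := one_div_pi_bounds
  have bπ : 3.1415926535897 ≤ Real.pi ∧ Real.pi ≤ 3.1415926535898 :=
    ⟨Real.pi_gt_d20.le.trans' (by norm_num), Real.pi_lt_d20.le.trans (by norm_num)⟩
  have h1 := mul_bounds bπ bs (by norm_num) (by norm_num)
  have h2 := mul_bounds bl bγ (by norm_num) (by norm_num)
  have h3 := mul_bounds bl bl (by norm_num) (by norm_num)
  have bpp := mul_bounds bp bp (by norm_num) (by norm_num)
  have h4 := mul_bounds bpp (mul_bounds bl bS (by norm_num) (by norm_num)) (by norm_num)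
    (by norm_num)
  have h5 := mul_bounds bpp (mul_bounds bl bD (by norm_num) (by norm_num)) (by norm_num)
    (by norm_num)
  have bsp := mul_bounds bs bp (by norm_num) (by norm_num)
  -- The bracket multiplying `√3 / π` is negative. Its negation is bounded below so that the
  -- two-sided bounds for `√3 / π` may be multiplied by it.
  have bM : 0.356 ≤ -(9 / 8 * (Real.log 3 * Real.eulerMascheroniConstant) -
      3 / 32 * (Real.log 3 * Real.log 3) - 3 / 2 * (∑' b : ℕ, (b : ℝ)⁻¹ * rhombDefectOne b) +
      9 / 2 * ((1 / Real.pi) * (1 / Real.pi) * (Real.log 3 * S))) := by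
    norm_num at h2 h3 h4 bT ⊢
    linarith
  generalize (1 / Real.pi) * (1 / Real.pi) * (Real.log 3 * S) = W at *
  generalize (1 / Real.pi) * (1 / Real.pi) * (Real.log 3 * D) = Z at *
  generalize (∑' b : ℕ, (b : ℝ)⁻¹ * rhombDefectOne b) = T' at *
  generalize Real.log 3 * Real.eulerMascheroniConstant = X at *
  generalize Real.log 3 * Real.log 3 = Y at *
  generalize Real.pi * √3 = P at *
  generalize √3 * (1 / Real.pi) = u at *
  have h6 := mul_le_mul_of_nonneg_right bsp.1 (bM.trans' (by norm_num))
  have h7 := mul_le_mul_of_nonneg_right bsp.2 (bM.trans' (by norm_num))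
  rw [abs_lt]
  norm_num at *
  constructor <;> linarith

theorem theorem4 :
    -- the counts are finite, and the two series in the constant converge
    (∀ n : ℕ, 1 ≤ n → (wrSublattices n).Finite) ∧
    Summable (fun p : ℕ => evenTerm (p + 1)) ∧
    Summable oddTerm ∧
    -- the two forms of the leading coefficient agree
    leadCoeff = ((3 * Real.sqrt 3 * Real.log 3 / (8 * Real.pi) : ℝ) : ℂ) ∧
    ∃ c : ℝ,
      -- the explicit value of the constant
      (c : ℂ) = linCoeff ∧
      |c - 0.4915036| < 5 * 10 ^ (-8 : ℤ) ∧
      -- the asymptotics of the summatory function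
      (fun x : ℝ => wrSum x -
          (3 * Real.sqrt 3 * Real.log 3 / (8 * Real.pi) * x * (Real.log x - 1) + c * x))
        =O[atTop] (fun x : ℝ => x ^ (3 / 4 : ℝ) * Real.log x) ∧
      -- the constant is the coefficient of `1 / (s - 1)` in the Laurent series at `s = 1` of the
      -- continuation `F` of the generating Dirichlet series
      (∀ s : ℂ, 1 < s.re → LSeriesSummable (fun n => (wrCount n : ℂ)) s) ∧
      ∃ F : ℂ → ℂ, (∀ s : ℂ, 1 < s.re → F s = LSeries (fun n => (wrCount n : ℂ)) s) ∧
        ∃ g : ℂ → ℂ, AnalyticAt ℂ g 1 ∧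
          ∀ᶠ s in 𝓝[≠] (1 : ℂ), F s = leadCoeff / (s - 1) ^ 2 + (c : ℂ) / (s - 1) + g s := by
  obtain ⟨κ, hP⟩ := exists_linearSum_primCount
  have hV := linearSum_shapeCount
  have hp0 : ∀ n, (0 : ℝ) ≤ (primCount n : ℝ) := fun n => by positivity
  have hv0 : ∀ n, (0 : ℝ) ≤ (shapeCount n : ℝ) := fun n => by positivity
  obtain ⟨hκ, hα⟩ := primCount_polar hP lFunction_one_ne_zero
  have hβ := polarConst_shapeCount
  set l : ℝ := 3 * Real.log 3 / 4 with hl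
  have ht : (Real.log 3 : ℂ) ≠ 0 := by exact_mod_cast (Real.log_pos (by norm_num)).ne'
  have hζ : riemannZeta 2 ≠ 0 := riemannZeta_ne_zero_of_one_lt_re (by norm_num)
  have hlC : (l : ℂ) = 3 * Real.log 3 / 4 := by rw [hl]; push_cast; ring
  have hlead : (κ * l : ℂ) = leadCoeff := by
    rw [hκ, hlC, leadCoeff]; ring
  have hleadR : κ * l = 3 * √3 * Real.log 3 / (8 * Real.pi) := by
    have := hlead.trans leadCoeff_eq
    exact_mod_cast this
  have hc : ((κ * polarConst (fun n => (shapeCount n : ℝ)) l +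
      l * polarConst (fun n => (primCount n : ℝ)) κ : ℝ) : ℂ) = linCoeff := by
    push_cast
    rw [polar_combination hκ hα hlC hβ hζ ht, linCoeff, leadCoeff]
  have hwr : ∀ n : ℕ, n ≠ 0 → (wrCount n : ℝ) =
      ∑ p ∈ n.divisorsAntidiagonal, (primCount p.1 : ℝ) * (shapeCount p.2 : ℝ) := by
    intro n hn
    rw [wrCount_eq hn]; push_cast; rfl
  have hconv : ∀ {n : ℕ}, n ≠ 0 → (fun n => (wrCount n : ℂ)) n =
      LSeries.convolution (fun n => ((primCount n : ℝ) : ℂ))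
        (fun n => ((shapeCount n : ℝ) : ℂ)) n := by
    intro n hn
    rw [LSeries.convolution_def]
    simp only
    rw [← Complex.ofReal_natCast (wrCount n), hwr n hn]
    push_cast
    rfl
  -- The continuation `F` is the product of the two continued factors.
  refine ⟨fun n hn => finite_wrSublattices (by omega), summable_evenTerm, summable_oddTerm,
    leadCoeff_eq, _, hc, abs_sub_lt_of_eq_linCoeff hc, ?_, fun s hs => ?_, fun s => (κ / (s - 1) +
      polarRem (fun n => (primCount n : ℝ)) κ s) * (l / (s - 1) +
      polarRem (fun n => (shapeCount n : ℝ)) l s), fun s hs => ?_, ?_⟩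
  · obtain ⟨C, hC0, hC⟩ := hP.convolution hp0 hv0 hV
    -- For `x ≥ e` one has `1 + log x ≤ 2 log x`.
    refine IsBigO.of_bound (C * 2) ?_
    filter_upwards [eventually_ge_atTop (Real.exp 1)] with x hx
    have hx1 : 1 ≤ x := le_trans (by have := Real.add_one_le_exp 1; linarith) hx
    have hlog : 1 ≤ Real.log x := by
      rw [Real.le_log_iff_exp_le (by linarith)]; exact hx
    have h := hC x hx1
    have e : ∑ n ∈ Finset.Icc 1 ⌊x⌋₊, ∑ p ∈ n.divisorsAntidiagonal,
        (primCount p.1 : ℝ) * (shapeCount p.2 : ℝ) = wrSum x := by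
      rw [wrSum]
      refine Finset.sum_congr rfl fun n hn => (hwr n ?_).symm
      have := (Finset.mem_Icc.1 hn).1
      omega
    rw [e, hleadR] at h
    rw [Real.norm_eq_abs, Real.norm_of_nonneg (by positivity)]
    refine h.trans ?_
    have : 0 ≤ C * x ^ (3 / 4 : ℝ) := by positivity
    nlinarith
  · have := (hP.lSeriesSummable hp0 hs).convolution (hV.lSeriesSummable hv0 hs)
    exact (LSeriesSummable_congr s hconv).2 this
  · rw [LSeries_congr hconv s, LSeries_convolution' (hP.lSeriesSummable hp0 hs)
      (hV.lSeriesSummable hv0 hs), hP.lSeries_eq hp0 hs, hV.lSeries_eq hv0 hs]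
  · obtain ⟨g, hg, hg'⟩ := hP.exists_laurent hV
    refine ⟨g, hg, ?_⟩
    filter_upwards [self_mem_nhdsWithin] with s hs
    rw [hg' s hs, hlead]
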